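/- Let $\mathbf S$ be a compact connected oriented surface with boundary, carrying hyperbolic metrics with geodesic boundary, and let $\mathcal T^*_{\mathbf S}$ be its Teichmüller space: the space of marked hyperbolic metrics on $\mathbf S$ with geodesic boundary (of arbitrary boundary lengths). Let $\mathbf c$ be a loop in the interior of $\mathbf S$, immersed, whose self-intersections are exactly $r\ge 1$ transverse double points. Assume that $\mathbf c$ fills $\mathbf S$ (each component of $\mathbf S\setminus\mathbf c$ is an open disc or a half-open annulus around a boundary component of $\mathbf S$) and that it is a generalized eight, i.e. no component of $\mathbf S\setminus \mathbf c$ is contractible. *Diagram.* Number the double points by $j\in\{1,\dots,r\}$. At the $j$-th one, denote by $(j,+)$ the strand of $\mathbf c$ that crosses the other one, denoted by $(j,-)$, from right to left. Open each double point respecting the orientation of $\mathbf c$. This replaces $\mathbf c$ by an oriented multi-curve $\beta$, together with $r$ bars joining the two arcs at each opened double point. Let $B_j^{+}$ be the $j$-th bar oriented from the right arc to the left arc, and $B_j^-$ the reversed bar: following $\mathbf c$ along the strand $(j,\pm)$ amounts to crossing the bar $B_j^\pm$. The endpoints of the bars cut $\beta$ into $2r$ simple portions $\mathcal I_q$, $q\in\Theta:=\{1,\dots,r\}\times\{\pm\}$,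 oriented as $\mathbf c$, where $\mathcal I_q$ starts at the terminus of $B_q$. The loop $\mathbf c$ is freely homotopic to $B_{q_1}\mathcal I_{q_1}B_{q_2}\mathcal I_{q_2}\cdots B_{q_{2r}}\mathcal I_{q_{2r}}$, where $q_1,\dots,q_{2r}$ is the enumeration of $\Theta$ in the order in which $\mathbf c$ passes through the double points, starting from any passage. *Coordinates.* For $Y\in\mathcal T^*_{\mathbf S}$, represent $\beta$ by closed geodesics of $Y$, and the bars by the orthogeodesics in their homotopy classes with endpoints gliding along $\beta$. The coordinates $(\vec L,\vec\theta)\in\mathbb R_{>0}^r\times\mathbb R^\Theta$ of $Y$ are the lengths $L_j>0$ of the orthogeodesics representing the bars, and the algebraic lengths $\theta_q$ of the corresponding portions $\overline{\mathcal I}_q$ of the closed geodesics (positive in the direction of $\beta$, negative otherwise). For $k\in\{1,\dots,2r\}$ with $q_k=(j,\epsilon)$, write $L_k:=L_j$ (the length of the $k$-th bar crossed), $\theta_k:=\theta_{q_k}$ and $\epsilon_k:=\epsilon$. *Statement.* Let $\ell_Y(\mathbf c)$ be the length of the closed geodesic of $Y$ freely homotopic to $\mathbf c$. Then, for any $Y\in\mathcal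 T^*_{\mathbf S}$ of coordinates $(\vec L,\vec\theta)$, $$\cosh\left(\frac{\ell_Y(\mathbf c)}2\right)=\sum_{\substack{\delta\in\{\pm1\}^{2r}\\ \delta_1\cdots\delta_{2r}=+1}}\ \prod_{k=1}^{2r}\operatorname{hyp}_{\delta_k}\left(\frac{\theta_k}2\right)\ \cosh\left(\frac12\sum_{k=1}^{2r}\rho_k^\delta\,\epsilon_k\,L_k\right),$$ where $\operatorname{hyp}_{+1}=\cosh$, $\operatorname{hyp}_{-1}=\sinh$ and $\rho_k^\delta=\prod_{1\le j<k}\delta_j$ (so $\rho^\delta_1=1$). -/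

import Mathlib

open scoped Topology UpperHalfPlane unitInterval ComplexConjugate

noncomputable section

/-- `hyp 1 x = cosh x` and `hyp (-1) x = sinh x`. -/
def hyp (δ : ℤˣ) (x : ℝ) : ℝ :=
  (Real.exp x + ((δ : ℤ) : ℝ) * Real.exp (-x)) / 2

/-- `rho δ k = ∏_{j < k} δ j` (the empty product being `1`). -/
def rho {n : ℕ} (δ : Fin n → ℤˣ) (k : Fin n) : ℤˣ :=
  ∏ j ∈ Finset.Iio k, δ j

/-- The tangent vector of a path in the upper half-plane, as a complex number. The hyperbolic metric
is conformal to the Euclidean one, so angles and orientation may be read off in `ℂ`. -/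
def tangent (f : ℝ → ℍ) (t : ℝ) : ℂ :=
  deriv (fun s : ℝ => (f s : ℂ)) t

/-- A (marked) hyperbolic structure with geodesic boundary on the surface `S`: an identification of
`S` with a quotient `Γ \ C`, where `C` is a closed convex region of the hyperbolic plane bounded by
disjoint geodesics, and `Γ` is a group of orientation preserving isometries, acting freely and
properly discontinuously on `C`. When `S` is compact, these are the representatives of the points of
the Teichmüller space of `S` (with all boundary lengths allowed): the marking is the homeomorphism
from `S` to `Γ \ C` induced by `proj`. The surface is oriented by the orientation of `ℍ`. -/
structure HyperbolicStructure (S : Type*) [TopologicalSpace S] where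
  /-- The universal cover `C`. -/
  region : Set ℍ
  /-- The group `Γ`, or rather a subgroup of `SL(2, ℝ)` inducing it. -/
  group : Subgroup (Matrix.SpecialLinearGroup (Fin 2) ℝ)
  /-- The covering map from `C` to `S` (its values outside of `C` are irrelevant). -/
  proj : ℍ → S
  nonempty : region.Nonempty
  isClosed : IsClosed region
  convex : ∀ x ∈ region, ∀ y ∈ region, ∀ z : ℍ, dist x z + dist z y = dist x y → z ∈ region
  /-- Near each of its boundary points, `C` is a closed hyperbolic half-plane
  (the set of points closer to `a` than to `b`). -/
  geodesic_boundary : ∀ z ∈ frontier region, ∃ a b : ℍ, a ≠ b ∧ dist z a = dist z b ∧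
    ∀ᶠ w in 𝓝 z, (w ∈ region ↔ dist w a ≤ dist w b)
  smul_mem : ∀ g ∈ group, ∀ z ∈ region, g • z ∈ region
  /-- The action is free and properly discontinuous. -/
  discrete : ∀ z ∈ region, ∃ ε > 0, ∀ g ∈ group, dist z (g • z) < ε → ∀ w : ℍ, g • w = w
  isQuotientMap : Topology.IsQuotientMap (region.domRestrict proj)
  proj_eq_iff : ∀ z ∈ region, ∀ w ∈ region, (proj z = proj w ↔ ∃ g ∈ group, g • z = w)

namespace HyperbolicStructure

variable {S : Type*} [TopologicalSpace S]

/-- `Y.IsGeodesicLength c ℓ`: the loop `c` (a map on `ℝ` of period `1`) is freely homotopic to a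
closed geodesic of `Y` of length `ℓ`. The closed geodesic is the projection of a unit speed complete
geodesic `u` of `ℍ`, contained in the universal cover of `S`, with period `ℓ` modulo the group. -/
def IsGeodesicLength (Y : HyperbolicStructure S) (c : ℝ → S) (ℓ : ℝ) : Prop :=
  0 < ℓ ∧ ∃ u : ℝ → ℍ, Isometry u ∧ (∀ s, u s ∈ Y.region) ∧
    (∃ g ∈ Y.group, ∀ s, g • u s = u (s + ℓ)) ∧
    ∃ h : C(I × ℝ, S), (∀ x t, h (x, t + 1) = h (x, t)) ∧
      (∀ t, h (0, t) = c t) ∧ (∀ t, h (1, t) = Y.proj (u (ℓ * t)))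

/-- The length `ℓ_Y(c)` of the geodesic representative of the free homotopy class of `c`. -/
def length (Y : HyperbolicStructure S) (c : ℝ → S) : ℝ :=
  sInf {ℓ : ℝ | Y.IsGeodesicLength c ℓ}

end HyperbolicStructure

/-- `c` fills `S`: each connected component of the complement of `c` is an open disc or a half-open
annulus around a boundary component of `S`. -/
def IsFilling {S : Type*} [TopologicalSpace S] (c : ℝ → S) : Prop :=
  ∀ x ∈ (Set.range c)ᶜ,
    Nonempty (connectedComponentIn (Set.range c)ᶜ x ≃ₜ Metric.ball (0 : ℂ) 1) ∨
    Nonempty (connectedComponentIn (Set.range c)ᶜ x ≃ₜ Circle × Set.Ico (0 : ℝ) 1)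

/-- The condition that makes a filling loop in general position a generalized eight: none of the
components that `c` cuts out of `S` is contractible. -/
def IsGeneralizedEight {S : Type*} [TopologicalSpace S] (c : ℝ → S) : Prop :=
  ∀ x ∈ (Set.range c)ᶜ, ¬ ContractibleSpace (connectedComponentIn (Set.range c)ᶜ x)

/-- The index set `Θ = {1, …, r} × {±}`. -/
abbrev Theta (r : ℕ) : Type := Fin r × ℤˣ

/-- The involution `(j, ε) ↦ (j, -ε)` of `Θ`, which reverses the bars. -/
def Theta.flip (r : ℕ) : Equiv.Perm (Theta r) :=
  (Equiv.refl (Fin r)).prodCongr (Equiv.neg ℤˣ)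

/-- `c` is an immersed loop in the interior of `S`, whose self-intersections are exactly `r`
transverse double points, labelled by `Fin r`. The loop passes twice through the `j`-th double
point, at the times `time (j, 1)` and `time (j, -1)`; the labels `±1` are determined by the
requirement that the strand `(j, 1)` crosses the strand `(j, -1)` from right to left.

When the intersection is opened respecting the orientation of `c`, it is replaced by a bar going
from the arc at its right (incoming strand `(j, 1)`, outgoing strand `(j, -1)`) to the arc at its
left (incoming strand `(j, -1)`, outgoing strand `(j, 1)`). This is the positive bar `B (j, 1)`,
crossed when one follows `c` along the strand `(j, 1)`: one arrives on it from the left and leaves it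
to the right. The reversed bar `B (j, -1)` is crossed when one follows the strand `(j, -1)`. -/
structure GeneralPosition {S : Type*} [TopologicalSpace S] (Y : HyperbolicStructure S)
    (c : ℝ → S) (r : ℕ) where
  periodic : Function.Periodic c 1
  /-- A lift of `c` to the universal cover. -/
  lift : ℝ → ℍ
  lift_mem : ∀ t, lift t ∈ interior Y.region
  proj_lift : ∀ t, Y.proj (lift t) = c t
  contDiff : ContDiff ℝ 1 (fun t : ℝ => (lift t : ℂ))
  immersed : ∀ t, tangent lift t ≠ 0
  /-- The times of passage at the double points. -/
  time : Theta r → ℝ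
  /-- The order in which the passages occur, from an arbitrary first one. -/
  order : Fin (2 * r) ≃ Theta r
  strictMono : StrictMono (fun k => time (order k))
  time_lt : ∀ q q', time q < time q' + 1
  double : ∀ j, c (time (j, 1)) = c (time (j, -1))
  eq_imp : ∀ s t, c s = c t → (∃ n : ℤ, t = s + n) ∨
    ∃ (q : Theta r) (m n : ℤ), s = time q + m ∧ t = time (Theta.flip r q) + n
  transverse : ∀ j, ∃ g ∈ Y.group, g • lift (time (j, 1)) = lift (time (j, -1)) ∧
    0 < (conj (tangent lift (time (j, -1))) *
      tangent (fun t => g • lift t) (time (j, 1))).im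

namespace GeneralPosition

variable {S : Type*} [TopologicalSpace S] {Y : HyperbolicStructure S} {c : ℝ → S} {r : ℕ}

/-- The cyclic permutation `σ` of `Θ`: the passage that follows the passage `q` along `c`.
Thus `order k = σ ^ k (order 0)`. -/
def next (P : GeneralPosition Y c r) : Equiv.Perm (Theta r) :=
  P.order.symm.trans ((finRotate (2 * r)).trans P.order)

/-- The simple portion `I q` is the arc of `c` between the times `time q` and `endTime q`. -/
def endTime (P : GeneralPosition Y c r) (q : Theta r) : ℝ :=
  if P.time q < P.time (P.next q) then P.time (P.next q) else P.time (P.next q) + 1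

/-- On the opened diagram, the simple portion `I q` starts at the terminus of the bar `B q`, and
ends at the origin of the bar `B (σ q)`, i.e. at the terminus of `B (flip (σ q))`. There it is
followed, on the multi-curve `β`, by the simple portion `I (flip (σ q))`. The cycles of this
permutation are the components of `β`. -/
def nextOnBeta (P : GeneralPosition Y c r) : Equiv.Perm (Theta r) :=
  P.next.trans (Theta.flip r)

open Classical in
/-- The sum of the `θ q'` over the simple portions `I q'` of the component of `β` containing
`I q`. -/
def betaLength (P : GeneralPosition Y c r) (θ : Theta r → ℝ) (q : Theta r) : ℝ :=
  ∑ q' ∈ Finset.univ.filter (fun q' => P.nextOnBeta.SameCycle q q'), θ q'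

end GeneralPosition

/-- The geodesic representative of the diagram `(β, B)` obtained by opening the intersections of
`c`. The simple portion `I q` is represented by a segment of algebraic length `θ q` of a complete
oriented geodesic `u q` (starting at parameter `0`), the bar `B (j, 1)` by a segment of length
`L j > 0` of a geodesic `w j` (starting at parameter `0`). Modulo the group, the segments match as
those of the diagram do: the simple portions form closed geodesics, with the orientation of `β`, and
the bars are orthogonal to them at both endpoints. -/
structure GeodesicDiagram {S : Type*} [TopologicalSpace S] {Y : HyperbolicStructure S} {c : ℝ → S}
    {r : ℕ} (P : GeneralPosition Y c r) (L : Fin r → ℝ) (θ : Theta r → ℝ) where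
  u : Theta r → ℝ → ℍ
  w : Fin r → ℝ → ℍ
  isometry_u : ∀ q, Isometry (u q)
  isometry_w : ∀ j, Isometry (w j)
  u_mem : ∀ q s, u q s ∈ Y.region
  w_mem : ∀ j, ∀ s ∈ Set.Icc 0 (L j), w j s ∈ Y.region
  L_pos : ∀ j, 0 < L j
  /-- The segments of `β` continue each other without angle. -/
  beta_geodesic : ∀ q, ∃ g ∈ Y.group, ∀ s, g • u (P.nextOnBeta q) s = u q (θ q + s)
  /-- The closed geodesics are oriented as the components of `β`: going once around a component of
  `β` is going forward on the closed geodesic. -/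
  beta_oriented : ∀ q, 0 < P.betaLength θ q
  /-- The bar `B (j, 1)` starts at the terminus of `B (j, -1)`, i.e. at the origin of `I (j, -1)`,
  with a right angle. -/
  bar_origin : ∀ j, ∃ g ∈ Y.group, g • u (j, -1) 0 = w j 0 ∧
    (conj (tangent (fun s => g • u (j, -1) s) 0) * tangent (w j) 0).re = 0
  /-- The bar `B (j, 1)` ends at the origin of `I (j, 1)`, with a right angle. -/
  bar_terminus : ∀ j, ∃ g ∈ Y.group, g • u (j, 1) 0 = w j (L j) ∧
    (conj (tangent (fun s => g • u (j, 1) s) 0) * tangent (w j) (L j)).re = 0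
  /-- A homotopy, through maps of the graph consisting of the bars and of the simple portions, from
  the topological diagram to the geodesic one; the first variable is the homotopy parameter. As the
  bars opened at the intersections can be taken arbitrarily small, they are shrunk to the double
  points of `c` at parameter `0`, where the simple portions then are the arcs of `c` between
  successive passages at double points. -/
  barHomotopy : Fin r → C(I × I, S)
  portionHomotopy : Theta r → C(I × I, S)
  bar_zero : ∀ j s, barHomotopy j (0, s) = c (P.time (j, 1))
  portion_zero : ∀ q (s : I),
    portionHomotopy q (0, s) = c (P.time q + s * (P.endTime q - P.time q))
  bar_one : ∀ j (s : I), barHomotopy j (1, s) = Y.proj (w j (s * L j))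
  portion_one : ∀ q (s : I), portionHomotopy q (1, s) = Y.proj (u q (s * θ q))
  glue_origin : ∀ j t, barHomotopy j (t, 0) = portionHomotopy (j, -1) (t, 0)
  glue_terminus : ∀ j t, barHomotopy j (t, 1) = portionHomotopy (j, 1) (t, 0)
  glue_beta : ∀ q t, portionHomotopy q (t, 1) = portionHomotopy (P.nextOnBeta q) (t, 0)

/-- `Y` has the coordinates `(L, θ)`: these are the (algebraic) lengths of the bars and of the
simple portions in the geodesic representative, for `Y`, of the diagram of `c`. -/
def HasCoordinates {S : Type*} [TopologicalSpace S] (Y : HyperbolicStructure S) {c : ℝ → S} {r : ℕ}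
    (P : GeneralPosition Y c r) (L : Fin r → ℝ) (θ : Theta r → ℝ) : Prop :=
  Nonempty (GeodesicDiagram P L θ)

end

/-! Up to sign, the deck transformation of the loop is conjugate in SL(2, ℝ) to a product of
matrices. Each portion contributes a translation `transl θ` along its line, and each bar crossed
with sign ε contributes the common-perpendicular translation `cross (-ε L)`. A hyperbolic element of
translation length ℓ has trace ±2 cosh(ℓ/2), so the theorem is a trace computation plus the
determination of a sign.

The trace. Write `transl θ` as cosh(θ/2) · 1 + sinh(θ/2) · diag(1, -1). The matrix diag(1, -1)
conjugates `cross a` to `cross (-a)`. Moving all these diagonal factors to the right turns each term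
of the expanded product into one `cross`, with the signs ρ, times diag(1, ∏ δ). Its trace is 2 cosh
if ∏ δ = 1 and 0 otherwise (`trace_prod_cross_mul_transl`).

The sign. The trace exceeds 2 because suitable bases turn every factor into a matrix with positive
entries (`two_lt_trace_prod`). When two consecutive bars lie on the same side of a line, this
requires exp θ · tanh(L/2) · tanh(L'/2) > 1: the lines at the far ends of the two bars are disjoint
and in the expected order (`one_lt_of_next`).

The topology. This inequality, and the side of each line on which a bar lies (`opp_mul_frame`), come
from the full preimage G of the loop in the universal cover. Since the loop fills and no
complementary component is contractible, each component is a half-open annulus, so every point off G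
can be joined to the circle at infinity without meeting G (`exists_joinedIn_real`). At a lifted
double point, two corners on either side of an outgoing edge are thus joined by a crosscut which
meets G at one point of that edge only. It separates the ends reached through this edge from those
reached without using it. A winding number makes this precise and gives the cyclic order at infinity
of the ends of the geodesic lines (`cyclic_order_of_strands`, `LiftedDiagram.cyclic_order`). These
ends are reached along lifts of the multi-curve, which never return to the same edge because the
closed geodesics have positive length.

The existence of the closed geodesic follows from the convexity of the region: a closed convex set
invariant under a hyperbolic element contains its axis, and the lifted loop retracts to it along
segments. -/

open Matrix
local notation "SL2" => Matrix.SpecialLinearGroup (Fin 2) ℝ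
local notation "M2" => Matrix (Fin 2) (Fin 2) ℝ

/-! ### Expansion of the trace of a product of translations -/

/-- The translation of length `θ` along the imaginary axis. -/
noncomputable def transl (θ : ℝ) : SL2 :=
  ⟨!![Real.exp (θ / 2), 0; 0, Real.exp (-(θ / 2))], by
    rw [det_fin_two_of, ← Real.exp_add]; simp⟩

/-- The translation of length `a` along the unit half-circle, oriented from left to right. -/
noncomputable def cross (a : ℝ) : SL2 :=
  ⟨!![Real.cosh (a / 2), Real.sinh (a / 2); Real.sinh (a / 2), Real.cosh (a / 2)], by
    rw [det_fin_two_of]; nlinarith [Real.cosh_sq (a / 2)]⟩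

/-- The diagonal matrix with entries `1` and `δ`. -/
def signMatrix (δ : ℤˣ) : M2 := !![1, 0; 0, ((δ : ℤ) : ℝ)]

theorem signMatrix_mul (δ ε : ℤˣ) : signMatrix δ * signMatrix ε = signMatrix (δ * ε) := by
  simp [signMatrix]

/-- The reflection diag(1, -1) reverses the unit half-circle, hence conjugates `cross b` to its
inverse; translations along the same line then add up. -/
theorem cross_mul_sign_mul_cross (a b : ℝ) (δ : ℤˣ) :
    (cross a : M2) * signMatrix δ * (cross b : M2) =
      (cross (a + ((δ : ℤ) : ℝ) * b) : M2) * signMatrix δ := by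
  rcases Int.units_eq_one_or δ with rfl | rfl
  · simp only [cross, signMatrix, add_div, Real.cosh_add, Real.sinh_add]
    ext i j; fin_cases i <;> fin_cases j <;> simp <;> ring
  · simp only [cross, signMatrix, Units.val_neg, Units.val_one, Int.cast_neg, Int.cast_one,
      neg_mul, one_mul, ← sub_eq_add_neg, sub_div, Real.cosh_sub, Real.sinh_sub]
    ext i j; fin_cases i <;> fin_cases j <;> simp <;> ring

/-- The two eigenvalues exp(±θ/2) split into cosh and sinh. This is where the sum over signs δ
originates. -/
theorem transl_eq_sum (θ : ℝ) :
    (transl θ : M2) = ∑ δ : ℤˣ, hyp δ (θ / 2) • signMatrix δ := by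
  rw [show (Finset.univ : Finset ℤˣ) = {1, -1} from rfl, Finset.sum_pair (by decide)]
  ext i j
  fin_cases i <;> fin_cases j <;> simp [transl, hyp, signMatrix] <;> ring

theorem rho_cons_zero {n : ℕ} (d : ℤˣ) (δ : Fin n → ℤˣ) :
    rho (Fin.cons d δ : Fin (n + 1) → ℤˣ) 0 = 1 := by
  simp [rho, show Finset.Iio (0 : Fin (n + 1)) = ∅ from by ext; simp]

theorem rho_cons_succ {n : ℕ} (d : ℤˣ) (δ : Fin n → ℤˣ) (k : Fin n) :
    rho (Fin.cons d δ : Fin (n + 1) → ℤˣ) k.succ = d * rho δ k := by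
  have : Finset.Iio k.succ = insert 0 ((Finset.Iio k).map (Fin.succEmb n)) := by
    ext i
    refine Fin.cases ?_ (fun i => ?_) i
    · simp
    · simp
  rw [rho, this, Finset.prod_insert (by simp), Finset.prod_map]
  simp [rho]

theorem sum_fin_succ_arrow {n : ℕ} {α M : Type*} [Fintype α] [AddCommMonoid M]
    (f : (Fin (n + 1) → α) → M) :
    ∑ δ, f δ = ∑ d, ∑ δ : Fin n → α, f (Fin.cons d δ : Fin (n + 1) → α) := by
  rw [← (Fin.consEquiv fun _ : Fin (n + 1) => α).sum_comp, Fintype.sum_prod_type]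
  rfl

/-- The first sign d flips every later crossing. This is the recursion satisfied by `rho`, so that
peeling off the first factor closes the induction. -/
theorem prod_cross_mul_transl {n : ℕ} (a θ : Fin n → ℝ) :
    (List.ofFn fun k => (cross (a k) : M2) * (transl (θ k) : M2)).prod =
      ∑ δ : Fin n → ℤˣ, (∏ k, hyp (δ k) (θ k / 2)) •
        ((cross (∑ k, ((rho δ k : ℤ) : ℝ) * a k) : M2) * signMatrix (∏ k, δ k)) := by
  induction n with
  | zero =>
    simp only [List.ofFn_zero, List.prod_nil, Finset.univ_eq_empty, Finset.prod_empty,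
      Finset.sum_empty, one_smul, Finset.sum_const, Finset.card_univ, Fintype.card_unique]
    ext i j; fin_cases i <;> fin_cases j <;> simp [cross, signMatrix]
  | succ n ih =>
    rw [List.ofFn_succ, List.prod_cons, ih,
      sum_fin_succ_arrow, transl_eq_sum]
    simp only [Finset.mul_sum, Finset.sum_mul]
    rw [Finset.sum_comm]
    refine Finset.sum_congr rfl fun d _ => ?_
    refine Finset.sum_congr rfl fun δ _ => ?_
    simp only [Fin.prod_univ_succ, Fin.sum_univ_succ, Fin.cons_zero,
      Fin.cons_succ, rho_cons_zero, rho_cons_succ, Units.val_one, Int.cast_one, one_mul,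
      Units.val_mul, Int.cast_mul, mul_assoc]
    simp only [← Finset.mul_sum]
    rw [← signMatrix_mul, ← Matrix.mul_assoc, ← Matrix.mul_assoc,
      ← cross_mul_sign_mul_cross]
    simp only [Matrix.mul_smul, Matrix.smul_mul, smul_smul, Matrix.mul_assoc]
    rw [mul_comm]

theorem trace_cross_mul_signMatrix (a : ℝ) (δ : ℤˣ) :
    trace ((cross a : M2) * signMatrix δ) = if δ = 1 then 2 * Real.cosh (a / 2) else 0 := by
  rcases Int.units_eq_one_or δ with rfl | rfl
  · simp [cross, signMatrix, trace_fin_two]; ring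
  · simp [cross, signMatrix, trace_fin_two]

theorem trace_prod_cross_mul_transl {n : ℕ} (a θ : Fin n → ℝ) :
    trace (List.ofFn fun k => (cross (a k) : M2) * (transl (θ k) : M2)).prod =
      2 * ∑ δ : Fin n → ℤˣ with ∏ k, δ k = 1, (∏ k, hyp (δ k) (θ k / 2)) *
        Real.cosh ((1 / 2) * ∑ k, ((rho δ k : ℤ) : ℝ) * a k) := by
  rw [prod_cross_mul_transl, trace_sum, Finset.sum_filter, Finset.mul_sum]
  refine Finset.sum_congr rfl fun δ _ => ?_
  rw [trace_smul, trace_cross_mul_signMatrix, smul_eq_mul]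
  split_ifs
  · rw [show (∑ k, ((rho δ k : ℤ) : ℝ) * a k) / 2 = (1 / 2) * ∑ k, ((rho δ k : ℤ) : ℝ) * a k by
      ring]
    ring
  · simp

/-! ### Positivity of the trace by nested cones -/

/-- The product of the diagonal entries is 1 plus a positive number, and their sum is at least twice
the square root of this product. -/
theorem two_lt_trace_of_entries_pos {A : M2} (hA : ∀ i j, 0 < A i j)
    (hdet : A.det = 1) : 2 < A.trace := by
  rw [det_fin_two] at hdet
  rw [trace_fin_two]
  nlinarith [mul_pos (hA 0 1) (hA 1 0), sq_nonneg (A 0 0 - A 1 1), hA 0 0, hA 1 1]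

theorem mul_entries_pos {A B : M2} (hA : ∀ i j, 0 < A i j)
    (hB : ∀ i j, 0 < B i j) : ∀ i j, 0 < (A * B) i j := fun i j => by
  rw [Matrix.mul_apply, Fin.sum_univ_two]
  exact add_pos (mul_pos (hA _ _) (hB _ _)) (mul_pos (hA _ _) (hB _ _))

/-- A basis of the cone attached to a bar of length `L` crossed with the sign `ε`. -/
noncomputable def coneBasis (ε : ℤˣ) (L : ℝ) : M2 :=
  !![1, 0; ((ε : ℤ) : ℝ) * Real.tanh (L / 2), -((ε : ℤ) : ℝ)]

/-- The inverse of `coneBasis`. -/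
noncomputable def coneBasisInv (ε : ℤˣ) (L : ℝ) : M2 :=
  !![1, 0; Real.tanh (L / 2), -((ε : ℤ) : ℝ)]

theorem coneBasis_mul_inv (ε : ℤˣ) (L : ℝ) : coneBasis ε L * coneBasisInv ε L = 1 := by
  rcases Int.units_eq_one_or ε with rfl | rfl <;>
  · ext i j; fin_cases i <;> fin_cases j <;> simp [coneBasis, coneBasisInv]

/-- Positivity of the entries says that the translation followed by the crossing sends the cone of
the next bar into the interior of the cone of the current one. Only the lower right entry can fail
to be positive: its two terms have opposite signs when ε ≠ ε', and the hypothesis compares them. -/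
theorem cone_step_pos {ε ε' : ℤˣ} {L L' θ : ℝ} (hL : 0 < L) (hL' : 0 < L')
    (h : ε ≠ ε' → 1 < Real.exp θ * (Real.tanh (L / 2) * Real.tanh (L' / 2))) (i j : Fin 2) :
    0 < (coneBasisInv ε L * ((transl θ : M2) * (cross (-((ε' : ℤ) : ℝ) * L') : M2)) *
      coneBasis ε' L') i j := by
  have ht : 0 < Real.tanh (L / 2) := by
    rw [Real.tanh_eq_sinh_div_cosh]
    exact div_pos (Real.sinh_pos_iff.2 (by linarith)) (Real.cosh_pos _)
  have hs' : 0 < Real.sinh (L' / 2) := Real.sinh_pos_iff.2 (by linarith)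
  have hc' := Real.cosh_pos (L' / 2)
  have hsq := Real.cosh_sq (L' / 2)
  have he := Real.exp_pos (θ / 2)
  have he' := Real.exp_pos (-(θ / 2))
  set t := Real.tanh (L / 2)
  set s := Real.sinh (L' / 2)
  set c := Real.cosh (L' / 2)
  set e := Real.exp (θ / 2)
  set f := Real.exp (-(θ / 2))
  have ht' : Real.tanh (L' / 2) = s / c := Real.tanh_eq_sinh_div_cosh _
  -- By cosh² - sinh² = 1, `cross (-ε' L')` sends the first vector of the cone basis to the first
  -- axis, which `transl` preserves.
  have hinv : c - s * (s / c) = 1 / c := by field_simp; linarith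
  have key : coneBasisInv ε L * ((transl θ : M2) * (cross (-((ε' : ℤ) : ℝ) * L') : M2)) *
      coneBasis ε' L' = !![e * (1 / c), e * s; t * (e * (1 / c)),
        t * (e * s) + ((ε : ℤ) : ℝ) * ((ε' : ℤ) : ℝ) * (f * c)] := by
    rw [← hinv]
    rcases Int.units_eq_one_or ε with rfl | rfl <;> rcases Int.units_eq_one_or ε' with rfl | rfl <;>
    · ext i j
      fin_cases i <;> fin_cases j <;>
      simp [coneBasis, coneBasisInv, transl, cross, ht', neg_div, t, s, c, e,
        f] <;> field_simp <;> ring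
  have hlast : 0 < t * (e * s) + ((ε : ℤ) : ℝ) * ((ε' : ℤ) : ℝ) * (f * c) := by
    by_cases hε : ε = ε'
    · subst hε
      rcases Int.units_eq_one_or ε with rfl | rfl <;> simp <;> positivity
    · have h1 := h hε
      have hee : ((ε : ℤ) : ℝ) * ((ε' : ℤ) : ℝ) = -1 := by
        rcases Int.units_eq_one_or ε with rfl | rfl <;>
          rcases Int.units_eq_one_or ε' with rfl | rfl <;> simp at hε ⊢
      have hexp : Real.exp θ = e * e := by
        rw [← Real.exp_add]; ring_nf
      have hef : e * f = 1 := by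
        rw [← Real.exp_add]; simp
      rw [hee]
      rw [ht', hexp] at h1
      have h2 : f * c * 1 < f * c * (e * e * (t * (s / c))) :=
        mul_lt_mul_of_pos_left h1 (mul_pos he' hc')
      have h3 : f * c * (e * e * (t * (s / c))) = (e * f) * (t * (e * s)) := by field_simp
      rw [h3, hef] at h2
      linarith
  rw [key]
  fin_cases i <;> fin_cases j <;> simp only [Fin.zero_eta, Fin.mk_one, Matrix.of_apply,
    Matrix.cons_val', Matrix.cons_val_zero, Matrix.cons_val_one, Matrix.cons_val_fin_one] <;>
    first | exact hlast | positivity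

/-- If two consecutive bars on the same side of a line are far enough from each other, then the
product of the translations has a positive trace. -/
theorem two_lt_trace_prod {n : ℕ} (hn : 0 < n) (ε : ℕ → ℤˣ) (L θ : ℕ → ℝ) (hL : ∀ k, 0 < L k)
    (hε : ε n = ε 0) (hLn : L n = L 0)
    (h : ∀ k < n, ε k ≠ ε (k + 1) →
      1 < Real.exp (θ k) * (Real.tanh (L k / 2) * Real.tanh (L (k + 1) / 2))) :
    2 < trace (List.ofFn fun k : Fin n =>
      (cross (-((ε k : ℤ) : ℝ) * L k) : M2) * (transl (θ k) : M2)).prod := by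
  set X : ℕ → M2 := fun k => (cross (-((ε k : ℤ) : ℝ) * L k) : M2) with hX
  set T : ℕ → M2 := fun k => (transl (θ k) : M2) with hT
  set N : ℕ → M2 := fun k =>
    coneBasisInv (ε k) (L k) * (T k * X (k + 1)) * coneBasis (ε (k + 1)) (L (k + 1)) with hN
  have hpos : ∀ k < n, ∀ i j, 0 < N k i j := fun k hk =>
    cone_step_pos (hL k) (hL (k + 1)) (h k hk)
  -- Each factor N k is T k · X (k+1) written in the cone bases at k and k+1, so inner bases cancel.
  -- As the data at n and at 0 agree, the product of the N k is conjugate to the product of the X k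
  -- · T k.
  have tele : ∀ m, (List.ofFn fun k : Fin m => X k * T k).prod *
      (X m * coneBasis (ε m) (L m)) =
        X 0 * coneBasis (ε 0) (L 0) * (List.ofFn fun k : Fin m => N k).prod := by
    intro m
    induction m with
    | zero => simp
    | succ m ih =>
      rw [List.ofFn_succ', List.ofFn_succ', List.prod_concat, List.prod_concat]
      simp only [Fin.val_castSucc, Fin.val_last]
      rw [← Matrix.mul_assoc (X 0 * coneBasis (ε 0) (L 0)), ← ih, hN]
      simp only [Matrix.mul_assoc]
      rw [← Matrix.mul_assoc (coneBasis (ε m) (L m)), coneBasis_mul_inv, Matrix.one_mul]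
  have posprod : ∀ m, 0 < m → m ≤ n →
      ∀ i j, 0 < (List.ofFn fun k : Fin m => N k).prod i j := by
    intro m hm
    induction m, hm using Nat.le_induction with
    | base => intro h1; simpa using hpos 0 (by omega)
    | succ m hm ih =>
      intro h1
      rw [List.ofFn_succ', List.prod_concat]
      exact mul_entries_pos (by simpa using ih (by omega)) (hpos m (by omega))
  have hC : (X 0 * coneBasis (ε 0) (L 0)).det ≠ 0 := by
    rw [det_mul]
    refine mul_ne_zero (by simp [hX]) ?_
    intro h0
    have := congrArg det (coneBasis_mul_inv (ε 0) (L 0))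
    rw [det_mul, h0] at this; simp at this
  have htel := tele n
  rw [hε, hLn, show X n = X 0 by simp only [hX, hε, hLn]] at htel
  set C := X 0 * coneBasis (ε 0) (L 0)
  set R := (List.ofFn fun k : Fin n => X k * T k).prod
  have hR1 : R.det = 1 := by
    rw [← Matrix.coe_detMonoidHom, map_list_prod]
    refine List.prod_eq_one fun x hx => ?_
    simp only [List.map_ofFn, List.mem_ofFn, Function.comp_apply] at hx
    obtain ⟨k, rfl⟩ := hx
    simp [hX, hT]
  have hR : (List.ofFn fun k : Fin n => N k).prod = C⁻¹ * R * C := by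
    rw [Matrix.mul_assoc, htel, ← Matrix.mul_assoc, Matrix.nonsing_inv_mul _ (by simpa using hC),
      Matrix.one_mul]
  have htr : trace R = trace (List.ofFn fun k : Fin n => N k).prod := by
    rw [hR, Matrix.mul_assoc, trace_mul_comm, Matrix.mul_assoc,
      Matrix.mul_nonsing_inv _ (by simpa using hC), Matrix.mul_one]
  rw [htr]
  refine two_lt_trace_of_entries_pos (posprod n hn le_rfl) ?_
  exact mul_left_cancel₀ hC (by rw [mul_one, ← det_mul, ← htel, det_mul, hR1, one_mul])

/-! ### Frames: complete geodesics as images of the imaginary axis -/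

/-- The point `i e ^ s` of the upper half-plane. -/
noncomputable def expI (s : ℝ) : ℍ :=
  ⟨Real.exp s * Complex.I, by simpa [-Complex.ofReal_exp] using Real.exp_pos s⟩

@[simp] theorem coe_expI (s : ℝ) : (expI s : ℂ) = Real.exp s * Complex.I := rfl

@[simp] theorem expI_re (s : ℝ) : (expI s).re = 0 := by
  simp [UpperHalfPlane.re, -Complex.ofReal_exp]

@[simp] theorem expI_im (s : ℝ) : (expI s).im = Real.exp s := by
  simp [UpperHalfPlane.im, -Complex.ofReal_exp]

theorem expI_zero : expI 0 = UpperHalfPlane.I := by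
  ext; simp

theorem coe_sl_smul (g : SL2) (z : ℍ) :
    ((g • z : ℍ) : ℂ) = ((g 0 0 : ℝ) * z + (g 0 1 : ℝ)) / ((g 1 0 : ℝ) * z + (g 1 1 : ℝ)) := by
  simp [UpperHalfPlane.coe_specialLinearGroup_apply]

theorem sl_denom_ne_zero (g : SL2) {z : ℂ} (hz : z.im ≠ 0) :
    ((g 1 0 : ℝ) * z + (g 1 1 : ℝ) : ℂ) ≠ 0 := by
  intro h
  have h1 := congrArg Complex.im h
  have h2 := congrArg Complex.re h
  simp only [Complex.add_im, Complex.mul_im, Complex.ofReal_re, Complex.ofReal_im, zero_mul,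
    add_zero, Complex.zero_im, mul_eq_zero, hz, or_false] at h1
  simp [h1] at h2
  have := g.det_coe
  rw [det_fin_two, h1, h2] at this
  simp at this

theorem sl_det (g : SL2) : g 0 0 * g 1 1 - g 0 1 * g 1 0 = 1 := by
  have := g.det_coe
  rwa [det_fin_two] at this

/-- Equality of two elements of `SL(2, ℝ)` up to sign. -/
def PMEq (A B : SL2) : Prop := A = B ∨ A = -B

namespace PMEq

variable {A B C D : SL2}

theorem refl (A : SL2) : PMEq A A := Or.inl rfl

theorem symm (h : PMEq A B) : PMEq B A := by
  rcases h with rfl | rfl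
  exacts [Or.inl rfl, Or.inr (neg_neg _).symm]

theorem trans (h : PMEq A B) (h' : PMEq B C) : PMEq A C := by
  rcases h with rfl | rfl <;> rcases h' with rfl | rfl
  exacts [Or.inl rfl, Or.inr rfl, Or.inr rfl, Or.inl (neg_neg _)]

theorem mul (h : PMEq A B) (h' : PMEq C D) : PMEq (A * C) (B * D) := by
  rcases h with rfl | rfl <;> rcases h' with rfl | rfl
  · exact Or.inl rfl
  · exact Or.inr (mul_neg _ _)
  · exact Or.inr (neg_mul _ _)
  · exact Or.inl (neg_mul_neg _ _)

theorem mul_left (h : PMEq A B) (C : SL2) : PMEq (C * A) (C * B) := (refl C).mul h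

theorem mul_right (h : PMEq A B) (C : SL2) : PMEq (A * C) (B * C) := h.mul (refl C)

theorem smul (h : PMEq A B) (z : ℍ) : A • z = B • z := by
  rcases h with rfl | rfl
  · rfl
  · ext
    rw [coe_sl_smul, coe_sl_smul]
    simp only [Matrix.SpecialLinearGroup.coe_neg, Matrix.neg_apply, Complex.ofReal_neg]
    rw [neg_mul, neg_mul, ← neg_add, ← neg_add, neg_div_neg_eq]

end PMEq

theorem stabilizer_I {K : SL2} (h : K • expI 0 = expI 0) :
    K 1 1 = K 0 0 ∧ K 1 0 = -K 0 1 ∧ K 0 0 ^ 2 + K 0 1 ^ 2 = 1 := by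
  have h1 := congrArg UpperHalfPlane.coe h
  rw [coe_sl_smul, div_eq_iff (sl_denom_ne_zero K (by simp))] at h1
  have hre := congrArg Complex.re h1
  have him := congrArg Complex.im h1
  simp at hre him
  have hd := sl_det K
  refine ⟨him.symm, by linarith, ?_⟩
  rw [← him, show K 1 0 = -K 0 1 by linarith] at hd
  linarith

/-- An orientation preserving isometry with two fixed points is the identity, so only the sign of
the matrix is left. All later identifications of matrices rest on this. -/
theorem pmEq_one_of_smul_expI {K : SL2} {t : ℝ} (ht : t ≠ 0) (h : K • expI 0 = expI 0)
    (h' : K • expI t = expI t) : PMEq K 1 := by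
  obtain ⟨h1, h2, h3⟩ := stabilizer_I h
  have h4 := congrArg UpperHalfPlane.coe h'
  rw [coe_sl_smul, div_eq_iff (sl_denom_ne_zero K (by simp [-Complex.ofReal_exp]))] at h4
  have hre := congrArg Complex.re h4
  simp [-Complex.ofReal_exp] at hre
  have hb : K 0 1 = 0 := by
    rw [h2] at hre
    have h5 : K 0 1 * (1 - Real.exp t * Real.exp t) = 0 := by linarith
    refine (mul_eq_zero.mp h5).resolve_right fun h6 => ht ?_
    rw [← Real.exp_add] at h6
    have : t + t = 0 := Real.exp_eq_one_iff _ |>.mp (by linarith)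
    linarith
  rw [hb] at h3
  have h6 : (K 0 0 - 1) * (K 0 0 + 1) = 0 := by nlinarith
  rcases mul_eq_zero.mp h6 with h7 | h7
  · refine Or.inl (Matrix.SpecialLinearGroup.ext _ _ fun i j => ?_)
    fin_cases i <;> fin_cases j <;> simp [hb, h1, h2] <;> linarith
  · refine Or.inr (Matrix.SpecialLinearGroup.ext _ _ fun i j => ?_)
    fin_cases i <;> fin_cases j <;> simp [hb, h1, h2] <;> linarith

theorem pmEq_of_smul_expI {A B : SL2} {t : ℝ} (ht : t ≠ 0) (h : A • expI 0 = B • expI 0)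
    (h' : A • expI t = B • expI t) : PMEq A B := by
  have := pmEq_one_of_smul_expI (K := B⁻¹ * A) ht (by rw [mul_smul, h, inv_smul_smul])
    (by rw [mul_smul, h', inv_smul_smul])
  simpa using this.mul_left B

theorem pmEq_of_smul {A B : SL2} (h : ∀ z : ℍ, A • z = B • z) : PMEq A B :=
  pmEq_of_smul_expI one_ne_zero (h _) (h _)

theorem transl_smul_expI (θ s : ℝ) : transl θ • expI s = expI (θ + s) := by
  ext
  rw [coe_sl_smul]
  have : Real.exp θ = Real.exp (θ / 2) * Real.exp (θ / 2) := by rw [← Real.exp_add]; ring_nf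
  simp only [transl, of_apply, cons_val', cons_val_zero, cons_val_one,
    cons_val_fin_one, coe_expI, Real.exp_add, this, Real.exp_neg]
  push_cast
  have := Complex.exp_ne_zero (θ / 2)
  field_simp
  simp

theorem transl_mul (a b : ℝ) : transl a * transl b = transl (a + b) := by
  refine Matrix.SpecialLinearGroup.ext _ _ fun i j => ?_
  rw [Matrix.SpecialLinearGroup.coe_mul]
  fin_cases i <;> fin_cases j <;> simp [transl, ← Real.exp_add] <;> ring

theorem transl_zero : transl 0 = 1 := by
  refine Matrix.SpecialLinearGroup.ext _ _ fun i j => ?_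
  fin_cases i <;> fin_cases j <;> simp [transl]

theorem transl_inv (a : ℝ) : (transl a)⁻¹ = transl (-a) :=
  inv_eq_of_mul_eq_one_left (by rw [transl_mul, neg_add_cancel, transl_zero])

theorem cross_mul (a b : ℝ) : cross a * cross b = cross (a + b) := by
  refine Matrix.SpecialLinearGroup.ext _ _ fun i j => ?_
  rw [Matrix.SpecialLinearGroup.coe_mul]
  fin_cases i <;> fin_cases j <;>
    simp [cross, add_div, Real.cosh_add, Real.sinh_add] <;> ring

theorem cross_zero : cross 0 = 1 := by
  refine Matrix.SpecialLinearGroup.ext _ _ fun i j => ?_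
  fin_cases i <;> fin_cases j <;> simp [cross]

theorem cross_inv (a : ℝ) : (cross a)⁻¹ = cross (-a) :=
  inv_eq_of_mul_eq_one_left (by rw [cross_mul, neg_add_cancel, cross_zero])

theorem isometry_expI : Isometry expI := by
  have := UpperHalfPlane.isometry_vertical_line 0
  convert this using 2 with s
  ext
  apply Complex.ext <;> simp [expI, -Complex.ofReal_exp]

/-- In the formula for cosh of the distance, |z|² occurs in both equations. Eliminating it
determines the imaginary part; the real part then vanishes. The absolute values disappear because
cosh is even. -/
theorem eq_expI_of_dist {z : ℍ} {t : ℝ} (h0 : dist (expI 0) z = |t|)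
    (h1 : dist (expI 1) z = |t - 1|) : z = expI t := by
  have e0 := UpperHalfPlane.cosh_dist' (expI 0) z
  have e1 := UpperHalfPlane.cosh_dist' (expI 1) z
  have hy := z.im_pos
  simp only [expI_re, expI_im, h0, h1, Real.cosh_abs, Real.exp_zero] at e0 e1
  rw [eq_div_iff (by positivity)] at e0 e1
  rw [Real.cosh_eq] at e0 e1
  set x := z.re with hx
  set y := z.im with hy'
  have hte : Real.exp (t - 1) * Real.exp 1 = Real.exp t := by rw [← Real.exp_add]; ring_nf
  have hte' : Real.exp (-(t - 1)) = Real.exp (-t) * Real.exp 1 := by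
    rw [← Real.exp_add]; ring_nf
  have htt : Real.exp t * Real.exp (-t) = 1 := by rw [← Real.exp_add]; simp
  have hE : 1 < Real.exp 1 := Real.one_lt_exp_iff.mpr one_pos
  rw [hte'] at e1
  have e2 : (Real.exp 1 ^ 2 - 1) * (y * Real.exp (-t) - 1) = 0 := by
    have : (Real.exp (t - 1) + Real.exp (-t) * Real.exp 1) / 2 * (2 * Real.exp 1 * y) =
      (Real.exp t + Real.exp (-t) * Real.exp 1 ^ 2) * y := by
      rw [← hte]; ring
    rw [this] at e1
    nlinarith
  have e3 : y * Real.exp (-t) = 1 := by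
    rcases mul_eq_zero.mp e2 with h | h
    · nlinarith
    · linarith
  have e4 : y = Real.exp t := by
    have : y * Real.exp (-t) * Real.exp t = Real.exp t := by rw [e3, one_mul]
    rw [mul_assoc, mul_comm (Real.exp (-t)), htt, mul_one] at this
    exact this
  have e5 : x = 0 := by
    rw [e4] at e0
    have : x ^ 2 = 0 := by nlinarith
    exact pow_eq_zero_iff (two_ne_zero) |>.mp this
  exact UpperHalfPlane.ext_re_im (by rw [expI_re]; exact e5) (by rw [expI_im]; exact e4)

/-- The rotation of angle `-2 φ` around `i`. -/
noncomputable def rot (φ : ℝ) : SL2 :=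
  ⟨!![Real.cos φ, Real.sin φ; -Real.sin φ, Real.cos φ], by
    rw [det_fin_two_of]; nlinarith [Real.sin_sq_add_cos_sq φ]⟩

theorem rot_smul_I (φ : ℝ) : rot φ • expI 0 = expI 0 := by
  ext
  rw [coe_sl_smul, div_eq_iff (sl_denom_ne_zero _ (by simp))]
  simp [rot]
  ring_nf
  simp

theorem exists_smul_expI_eq (z w : ℍ) :
    ∃ m : SL2, m • expI 0 = z ∧ m • expI (dist z w) = w := by
  suffices H : ∀ w : ℍ, ∃ (m : SL2) (s : ℝ), 0 ≤ s ∧ m • expI 0 = expI 0 ∧ m • expI s = w by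
    obtain ⟨m, s, hs, h0, h1⟩ := H ((UpperHalfPlane.toSL2R z)⁻¹ • w)
    have hz : (UpperHalfPlane.toSL2R z * m) • expI 0 = z := by
      rw [mul_smul, h0, expI_zero, UpperHalfPlane.toSL2R_smul_I]
    have hw : (UpperHalfPlane.toSL2R z * m) • expI s = w := by
      rw [mul_smul, h1, smul_inv_smul]
    have hd : dist z w = s := by
      rw [← hz, ← hw, dist_smul, isometry_expI.dist_eq, Real.dist_eq, zero_sub, abs_neg,
        abs_of_nonneg hs]
    exact ⟨_, hz, hd ▸ hw⟩
  intro w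
  -- The equation is the vanishing of the real part of `rot φ • w`, linear in cos 2φ and sin 2φ; the
  -- argument of q solves it.
  obtain ⟨φ, hφ⟩ : ∃ φ : ℝ, w.re * Real.cos (2 * φ) +
      (1 - (w.re ^ 2 + w.im ^ 2)) / 2 * Real.sin (2 * φ) = 0 := by
    set q : ℂ := ⟨(w.re ^ 2 + w.im ^ 2 - 1) / 2, w.re⟩
    refine ⟨q.arg / 2, ?_⟩
    rw [mul_div_cancel₀ _ (two_ne_zero)]
    have h1 : ‖q‖ * Real.cos q.arg = (w.re ^ 2 + w.im ^ 2 - 1) / 2 := Complex.norm_mul_cos_arg q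
    have h2 : ‖q‖ * Real.sin q.arg = w.re := Complex.norm_mul_sin_arg q
    linear_combination (-Real.cos q.arg) * h2 + Real.sin q.arg * h1
  have hre : (rot φ • w).re = 0 := by
    have hne := sl_denom_ne_zero (rot φ) (z := w) w.im_pos.ne'
    have : (((rot φ • w : ℍ) : ℂ)).re = 0 := by
      rw [coe_sl_smul, Complex.div_re, ← add_div, div_eq_zero_iff]
      left
      simp [rot, -Complex.ofReal_cos, -Complex.ofReal_sin]
      rw [Real.cos_two_mul, Real.sin_two_mul] at hφ
      linear_combination hφ - w.re * Real.sin_sq_add_cos_sq φ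
    exact this
  obtain ⟨s, hs⟩ : ∃ s, rot φ • w = expI s :=
    ⟨Real.log (rot φ • w).im, UpperHalfPlane.ext_re_im (by simp [hre])
      (by rw [expI_im, Real.exp_log (rot φ • w).im_pos])⟩
  rcases le_total 0 s with h | h
  · refine ⟨(rot φ)⁻¹, s, h, ?_, by rw [← hs, inv_smul_smul]⟩
    rw [inv_smul_eq_iff, rot_smul_I]
  -- If w lands below i, the half turn around i exchanges the two rays of the axis.
  · refine ⟨(rot φ)⁻¹ * rot (Real.pi / 2), -s, by linarith, ?_, ?_⟩
    · rw [mul_smul, rot_smul_I, inv_smul_eq_iff, rot_smul_I]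
    · rw [mul_smul, inv_smul_eq_iff, hs]
      ext
      rw [coe_sl_smul]
      simp [rot, Complex.exp_neg]
      have := Complex.exp_ne_zero s
      field_simp

/-- A frame adapted to the points of parameters 0 and 1 fits the whole line, since the distances to
these two points determine each point `u t`. -/
theorem exists_frame {u : ℝ → ℍ} (hu : Isometry u) : ∃ m : SL2, ∀ s, u s = m • expI s := by
  obtain ⟨m, h0, h1⟩ := exists_smul_expI_eq (u 0) (u 1)
  have hd : dist (u 0) (u 1) = 1 := by rw [hu.dist_eq]; simp
  rw [hd] at h1
  refine ⟨m, fun t => ?_⟩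
  rw [← inv_smul_eq_iff]
  apply eq_expI_of_dist
  · rw [← dist_smul m, smul_inv_smul, h0, hu.dist_eq, Real.dist_eq, zero_sub, abs_neg]
  · rw [← dist_smul m, smul_inv_smul, h1, hu.dist_eq, Real.dist_eq, abs_sub_comm]

theorem isometry_smul_expI (m : SL2) : Isometry fun s => m • expI s :=
  (isometry_smul ℍ m).comp isometry_expI

theorem hasDerivAt_frame (m : SL2) (s : ℝ) :
    HasDerivAt (fun s : ℝ => ((m • expI s : ℍ) : ℂ))
      (Real.exp s * Complex.I / ((m 1 0 : ℝ) * (Real.exp s * Complex.I) + (m 1 1 : ℝ)) ^ 2) s := by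
  have hne : ((m 1 0 : ℝ) * (Real.exp s * Complex.I) + (m 1 1 : ℝ) : ℂ) ≠ 0 :=
    sl_denom_ne_zero m (by simp [-Complex.ofReal_exp])
  have he : HasDerivAt (fun s : ℝ => (Real.exp s * Complex.I : ℂ)) (Real.exp s * Complex.I) s :=
    ((Real.hasDerivAt_exp s).ofReal_comp).mul_const _
  have h := ((he.const_mul ((m 0 0 : ℝ) : ℂ)).add_const ((m 0 1 : ℝ) : ℂ)).div
    ((he.const_mul ((m 1 0 : ℝ) : ℂ)).add_const ((m 1 1 : ℝ) : ℂ)) hne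
  have hd : ((m 0 0 : ℝ) * (m 1 1 : ℝ) - (m 0 1 : ℝ) * (m 1 0 : ℝ) : ℂ) = 1 := by
    exact_mod_cast sl_det m
  have hf : (fun s : ℝ => ((m • expI s : ℍ) : ℂ)) =
      (fun s : ℝ => ((m 0 0 : ℝ) * (Real.exp s * Complex.I) + (m 0 1 : ℝ) : ℂ)) /
        fun s : ℝ => ((m 1 0 : ℝ) * (Real.exp s * Complex.I) + (m 1 1 : ℝ) : ℂ) := by
    funext t; rw [coe_sl_smul]; rfl
  rw [hf]
  refine h.congr_deriv ?_
  congr 1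
  linear_combination (Real.exp s * Complex.I : ℂ) * hd

theorem tangent_frame (m : SL2) (s : ℝ) : tangent (fun s => m • expI s) s =
    Real.exp s * Complex.I / ((m 1 0 : ℝ) * (Real.exp s * Complex.I) + (m 1 1 : ℝ)) ^ 2 :=
  (hasDerivAt_frame m s).deriv

theorem tangent_frame_eq_zero (m : SL2) (s : ℝ) :
    tangent (fun s => m • expI s) s = tangent (fun t => (m * transl s) • expI t) 0 := by
  have : (fun t => (m * transl s) • expI t) = fun t => m • expI (s + t) := by
    funext t; rw [mul_smul, transl_smul_expI]
  rw [this]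
  simp only [tangent]
  rw [deriv_comp_const_add (f := fun t : ℝ => ((m • expI t : ℍ) : ℂ)), add_zero]

/-- The rotation by a right angle around `i`. -/
noncomputable def quarter (κ : ℤˣ) : SL2 :=
  ⟨!![1 / √2, ((κ : ℤ) : ℝ) / √2; -((κ : ℤ) : ℝ) / √2, 1 / √2], by
    rw [det_fin_two_of]
    have : √2 ≠ 0 := by positivity
    rcases Int.units_eq_one_or κ with rfl | rfl <;> field_simp <;> norm_num⟩

theorem quarter_inv (κ : ℤˣ) : (quarter κ)⁻¹ = quarter (-κ) := by
  refine inv_eq_of_mul_eq_one_left (Matrix.SpecialLinearGroup.ext _ _ fun i j => ?_)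
  have h2 : √2 ≠ 0 := by positivity
  have h3 : √2 ^ 2 = 2 := Real.sq_sqrt (by norm_num)
  rw [Matrix.SpecialLinearGroup.coe_mul]
  rcases Int.units_eq_one_or κ with rfl | rfl <;> fin_cases i <;> fin_cases j <;>
    simp [quarter] <;> field_simp <;> rw [h3] <;> norm_num

/-- The transition between two frames with the same base point is a rotation with entries a, b. It
multiplies the tangent direction by (a + bi)², and a right angle forces a² = b². The sign κ says to
which side the second line turns. -/
theorem orthogonal_frames {M N : SL2} (h0 : M • expI 0 = N • expI 0)
    (h : (conj (tangent (fun s => M • expI s) 0) * tangent (fun s => N • expI s) 0).re = 0) :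
    ∃ κ, PMEq N (M * quarter κ) := by
  obtain ⟨h1, h2, h3⟩ := stabilizer_I (K := M⁻¹ * N) (by rw [mul_smul, ← h0, inv_smul_smul])
  set K := M⁻¹ * N with hK
  have hN : N = M * K := by rw [hK, mul_inv_cancel_left]
  set a := K 0 0
  set b := K 0 1
  have hD := sl_denom_ne_zero M (z := Complex.I) (by simp)
  have hab : a ^ 2 - b ^ 2 = 0 := by
    rw [tangent_frame, tangent_frame] at h
    have hden : ((N 1 0 : ℝ) * (Real.exp 0 * Complex.I) + (N 1 1 : ℝ) : ℂ) =
        ((M 1 0 : ℝ) * Complex.I + (M 1 1 : ℝ)) * (a - b * Complex.I) := by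
      rw [hN, Matrix.SpecialLinearGroup.coe_mul, Matrix.mul_apply, Matrix.mul_apply, Fin.sum_univ_two,
        Fin.sum_univ_two, h1, h2]
      push_cast
      simp only [Complex.exp_zero]
      linear_combination (M 1 0 : ℂ) * b * Complex.I_sq
    rw [hden] at h
    simp only [Real.exp_zero, Complex.ofReal_one, one_mul] at h
    set D : ℂ := (M 1 0 : ℝ) * Complex.I + (M 1 1 : ℝ)
    have hnn : ((a : ℂ) - b * Complex.I) * (a + b * Complex.I) = 1 := by
      have : ((a ^ 2 + b ^ 2 : ℝ) : ℂ) = 1 := by rw [h3]; simp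
      push_cast at this
      linear_combination this - (b : ℂ) ^ 2 * Complex.I_sq
    have hne : ((a : ℂ) - b * Complex.I) ≠ 0 := left_ne_zero_of_mul_eq_one hnn
    have key : conj (Complex.I / D ^ 2) * (Complex.I / (D * (a - b * Complex.I)) ^ 2) =
        (((Complex.normSq D) ^ 2)⁻¹ : ℝ) * (a + b * Complex.I) ^ 2 := by
      have hc : conj D ≠ 0 := by simpa using hD
      rw [map_div₀, map_pow, Complex.conj_I, Complex.ofReal_inv, Complex.ofReal_pow,
        Complex.normSq_eq_conj_mul_self]
      have hinv : (a + b * Complex.I : ℂ) = (a - b * Complex.I)⁻¹ :=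
        eq_inv_of_mul_eq_one_right hnn
      rw [hinv]
      field_simp
      simp [neg_div]
    rw [key, Complex.re_ofReal_mul] at h
    have hn : ((Complex.normSq D) ^ 2)⁻¹ ≠ 0 := by simpa using hD
    have := (mul_eq_zero.mp h).resolve_left hn
    simp [pow_two] at this
    nlinarith
  have h2' := h2
  have ha : a ^ 2 = (1 / √2) ^ 2 := by
    rw [div_pow, Real.sq_sqrt (by norm_num)]; linarith
  have hb : (b - a) * (b + a) = 0 := by linarith
  obtain ⟨κ, hκ⟩ : ∃ κ : ℤˣ, b = ((κ : ℤ) : ℝ) * a := by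
    rcases mul_eq_zero.mp hb with h | h
    · exact ⟨1, by simp; linarith⟩
    · exact ⟨-1, by simp; linarith⟩
  refine ⟨κ, ?_⟩
  rw [hN]
  refine PMEq.mul_left ?_ M
  rcases sq_eq_sq_iff_eq_or_eq_neg.mp ha with ha | ha
  · refine Or.inl (Matrix.SpecialLinearGroup.ext _ _ fun i j => ?_)
    have e00 : K 0 0 = 1 / √2 := ha
    have e01 : K 0 1 = ((κ : ℤ) : ℝ) / √2 := by rw [← mul_one_div, ← ha]; exact hκ
    have e10 : K 1 0 = -((κ : ℤ) : ℝ) / √2 := by rw [neg_div, ← e01]; exact h2'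
    have e11 : K 1 1 = 1 / √2 := by rw [← ha]; exact h1
    fin_cases i <;> fin_cases j
    exacts [e00, e01, e10, e11]
  · refine Or.inr (Matrix.SpecialLinearGroup.ext _ _ fun i j => ?_)
    have e00 : K 0 0 = -(1 / √2) := ha
    have e01 : K 0 1 = -(((κ : ℤ) : ℝ) / √2) := by rw [← mul_one_div, ← mul_neg, ← ha]; exact hκ
    have e10 : K 1 0 = -(-((κ : ℤ) : ℝ) / √2) := by rw [neg_div, ← e01]; exact h2'
    have e11 : K 1 1 = -(1 / √2) := by rw [← ha]; exact h1
    fin_cases i <;> fin_cases j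
    exacts [e00, e01, e10, e11]

theorem orthogonal_frames_at {M N : SL2} {L : ℝ} (h0 : M • expI 0 = N • expI L)
    (h : (conj (tangent (fun s => M • expI s) 0) * tangent (fun s => N • expI s) L).re = 0) :
    ∃ κ, PMEq (N * transl L) (M * quarter κ) := by
  rw [tangent_frame_eq_zero N L] at h
  exact orthogonal_frames (by rw [h0, mul_smul, transl_smul_expI, add_zero]) h

/-! ### Covering theory of the convex region -/

namespace HyperbolicStructure

variable {S : Type*} [TopologicalSpace S] (Y : HyperbolicStructure S)

/-- By discreteness, an element of the group fixing a point of the region acts trivially. One common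
value thus identifies two deck transformations, up to the sign of the matrices. -/
theorem pmEq_of_smul_eq {g h : SL2} (hg : g ∈ Y.group) (hh : h ∈ Y.group) {z : ℍ}
    (hz : z ∈ Y.region) (e : g • z = h • z) : PMEq g h := by
  obtain ⟨ε, hε, H⟩ := Y.discrete z hz
  have h1 : (h⁻¹ * g) • z = z := by rw [mul_smul, e, inv_smul_smul]
  have h2 := H (h⁻¹ * g) (mul_mem (inv_mem hh) hg) (by rw [h1, dist_self]; exact hε)
  refine pmEq_of_smul fun w => ?_
  have h3 := h2 w
  rwa [mul_smul, inv_smul_eq_iff] at h3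

/-- The action of the group on the region. -/
@[reducible] noncomputable def regionAction : MulAction Y.group Y.region where
  smul g z := ⟨(g : SL2) • (z : ℍ), Y.smul_mem g g.2 z z.2⟩
  one_smul z := Subtype.ext (one_smul SL2 (z : ℍ))
  mul_smul g h z := Subtype.ext (mul_smul (g : SL2) (h : SL2) (z : ℍ))

theorem isCoveringMap : IsCoveringMap (Y.region.domRestrict Y.proj) := by
  let := Y.regionAction
  -- The image in the permutations of the region replaces the group, whose action need not be
  -- faithful: -1 acts trivially.
  let G := (MulAction.toPermHom Y.group Y.region).range
  have key : IsQuotientCoveringMap (Y.region.domRestrict Y.proj) G :=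
    { toIsQuotientMap := Y.isQuotientMap
      continuous_const_smul := by
        rintro ⟨_, g, rfl⟩
        change Continuous fun z : Y.region =>
          (⟨(g : SL2) • (z : ℍ), Y.smul_mem g g.2 z z.2⟩ : Y.region)
        exact ((continuous_const_smul (g : SL2)).comp continuous_subtype_val).subtype_mk _
      apply_eq_iff_mem_orbit := by
        intro z w
        have h1 := Y.proj_eq_iff w w.2 z z.2
        constructor
        · intro h
          obtain ⟨g, hg, e⟩ := h1.mp h.symm
          exact ⟨⟨_, ⟨g, hg⟩, rfl⟩, Subtype.ext e⟩
        · rintro ⟨⟨_, g, rfl⟩, e⟩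
          exact (h1.mpr ⟨g, g.2, congrArg Subtype.val e⟩).symm
      disjoint := by
        intro z
        obtain ⟨ε, hε, H⟩ := Y.discrete z z.2
        refine ⟨Metric.ball z (ε / 2), Metric.ball_mem_nhds _ (half_pos hε), ?_⟩
        rintro ⟨_, g, rfl⟩ ⟨w', ⟨w, hw, e⟩, hw'⟩
        have e' : (g : SL2) • (w : ℍ) = w' := congrArg Subtype.val e
        have h1 : dist (w : ℍ) (z : ℍ) < ε / 2 := hw
        have h2 : dist (w' : ℍ) (z : ℍ) < ε / 2 := hw'
        have h3 := H g g.2 (by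
          calc dist (z : ℍ) ((g : SL2) • (z : ℍ))
              ≤ dist (z : ℍ) w' + dist (w' : ℍ) ((g : SL2) • (z : ℍ)) := dist_triangle _ _ _
            _ = dist (w' : ℍ) z + dist (w : ℍ) z := by rw [dist_comm, ← e', dist_smul]
            _ < ε := by linarith)
        ext x
        exact congrArg UpperHalfPlane.coe (h3 x) }
  exact key.isCoveringMap

theorem exists_lift_homotopy {A : Type*} [TopologicalSpace A] (H : C(I × A, S)) {f : A → ℍ}
    (hf : Continuous f) (hfm : ∀ a, f a ∈ Y.region) (h0 : ∀ a, H (0, a) = Y.proj (f a)) :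
    ∃ H' : C(I × A, ℍ), (∀ p, H' p ∈ Y.region) ∧ (∀ p, Y.proj (H' p) = H p) ∧
      ∀ a, H' (0, a) = f a := by
  let f' : C(A, Y.region) := ⟨fun a => ⟨f a, hfm a⟩, hf.subtype_mk _⟩
  let H' := Y.isCoveringMap.liftHomotopy H f' h0
  refine ⟨⟨fun p => (H' p : ℍ), by fun_prop⟩, fun p => (H' p).2, fun p => ?_, fun a => ?_⟩
  · exact congrFun (Y.isCoveringMap.liftHomotopy_lifts H f' h0) p
  · exact congrArg Subtype.val (Y.isCoveringMap.liftHomotopy_zero H f' h0 a)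

/-- Uniqueness of lifts from a connected space: the deck transformation that works at one point
works everywhere. -/
theorem exists_smul_eq_of_proj_eq {A : Type*} [TopologicalSpace A] [PreconnectedSpace A]
    [Nonempty A] {f₁ f₂ : A → ℍ} (h₁ : Continuous f₁) (h₂ : Continuous f₂)
    (hm₁ : ∀ a, f₁ a ∈ Y.region) (hm₂ : ∀ a, f₂ a ∈ Y.region)
    (h : ∀ a, Y.proj (f₁ a) = Y.proj (f₂ a)) : ∃ g ∈ Y.group, ∀ a, g • f₁ a = f₂ a := by
  obtain ⟨a₀⟩ := ‹Nonempty A›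
  obtain ⟨g, hg, e⟩ := (Y.proj_eq_iff _ (hm₁ a₀) _ (hm₂ a₀)).mp (h a₀)
  refine ⟨g, hg, ?_⟩
  have := Y.isCoveringMap.eq_of_comp_eq
    (g₁ := fun a => (⟨g • f₁ a, Y.smul_mem g hg _ (hm₁ a)⟩ : Y.region))
    (g₂ := fun a => (⟨f₂ a, hm₂ a⟩ : Y.region))
    ((((continuous_const_smul g).comp h₁)).subtype_mk _) (h₂.subtype_mk _)
    (by
      funext a
      refine Eq.trans ?_ (h a)
      exact ((Y.proj_eq_iff _ (hm₁ a) _ (Y.smul_mem g hg _ (hm₁ a))).mpr ⟨g, hg, rfl⟩).symm)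
    a₀ (Subtype.ext e)
  exact fun a => congrArg Subtype.val (congrFun this a)

end HyperbolicStructure

/-! ### Lifting the loop and the geodesic diagram -/

namespace GeneralPosition

variable {S : Type*} [TopologicalSpace S] {Y : HyperbolicStructure S} {c : ℝ → S} {r : ℕ}
  (P : GeneralPosition Y c r)

include P in
theorem continuous_lift : Continuous P.lift :=
  UpperHalfPlane.isEmbedding_coe.continuous_iff.mpr P.contDiff.continuous

theorem lift_mem_region (t : ℝ) : P.lift t ∈ Y.region := interior_subset (P.lift_mem t)

theorem exists_deck : ∃ g ∈ Y.group, ∀ t, g • P.lift t = P.lift (t + 1) :=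
  Y.exists_smul_eq_of_proj_eq P.continuous_lift
    (P.continuous_lift.comp (continuous_add_const 1)) P.lift_mem_region
    (fun t => P.lift_mem_region (t + 1)) fun t => by
      rw [P.proj_lift, P.proj_lift, P.periodic]

end GeneralPosition

/-- The geodesic diagram in the universal cover. The line that carries the simple portion `I q`,
starting at time `time q` on the lift of the loop, is the image of the imaginary axis by `frame q`;
its starting point is the image of `i`. -/
structure LiftedDiagram {S : Type*} [TopologicalSpace S] {Y : HyperbolicStructure S} {c : ℝ → S}
    {r : ℕ} (P : GeneralPosition Y c r) (L : Fin r → ℝ) (θ : Theta r → ℝ) where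
  frame : Theta r → SL2
  deck : SL2
  deck_mem : deck ∈ Y.group
  deck_smul : ∀ t, deck • P.lift t = P.lift (t + 1)
  cont : Theta r → SL2
  cont_mem : ∀ q, cont q ∈ Y.group
  cont_smul : ∀ q, cont q • P.lift (P.time (P.nextOnBeta q)) = P.lift (P.endTime q)
  cont_frame : ∀ q, PMEq (frame q * transl (θ q)) (cont q * frame (P.nextOnBeta q))
  opp : Fin r → SL2
  opp_mem : ∀ j, opp j ∈ Y.group
  opp_smul : ∀ j, opp j • P.lift (P.time (j, 1)) = P.lift (P.time (j, -1))
  opp_pos : ∀ j, 0 < (conj (tangent P.lift (P.time (j, -1))) *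
      tangent (fun t => opp j • P.lift t) (P.time (j, 1))).im
  opp_frame : ∀ j, ∃ κ κ', PMEq (opp j * frame (j, 1))
    (frame (j, -1) * quarter κ * transl (L j) * quarter κ')
  L_pos : ∀ j, 0 < L j
  beta_pos : ∀ q, 0 < P.betaLength θ q

/-- The homotopy from the topological diagram to the geodesic one is lifted piece by piece. The
gluing conditions persist in the cover up to deck transformations that are constant along the
homotopy; they are identified at its start and used at its end. -/
theorem HasCoordinates.nonempty_liftedDiagram {S : Type*} [TopologicalSpace S]
    {Y : HyperbolicStructure S} {c : ℝ → S} {r : ℕ} {P : GeneralPosition Y c r} {L : Fin r → ℝ}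
    {θ : Theta r → ℝ} (hY : HasCoordinates Y P L θ) : Nonempty (LiftedDiagram P L θ) := by
  obtain ⟨D⟩ := hY
  obtain ⟨deck, deck_mem, deck_smul⟩ := P.exists_deck
  choose opp opp_mem opp_smul opp_pos using P.transverse
  choose n hn using fun q => exists_frame (D.isometry_u q)
  choose N hN using fun j => exists_frame (D.isometry_w j)
  have hcl := P.continuous_lift
  have hs : Continuous fun s : I => (s : ℝ) := continuous_subtype_val
  -- Each portion starts on the chosen lift of the loop. At the end of the homotopy it lies on a
  -- translate, by k q, of the line `u q`.
  choose Φ Φmem Φproj Φzero using fun q => Y.exists_lift_homotopy (D.portionHomotopy q)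
    (f := fun s : I => P.lift (P.time q + s * (P.endTime q - P.time q)))
    (hcl.comp (by fun_prop)) (fun s => P.lift_mem_region _)
    (fun s => by rw [D.portion_zero, P.proj_lift])
  choose k kmem hk using fun q => Y.exists_smul_eq_of_proj_eq
    (f₁ := fun s : I => D.u q (s * θ q)) (f₂ := fun s : I => Φ q (1, s))
    ((D.isometry_u q).continuous.comp (by fun_prop)) (by fun_prop) (fun s => D.u_mem q _)
    (fun s => Φmem q _) (fun s => by rw [Φproj, D.portion_one])
  have k0 : ∀ q, k q • D.u q 0 = Φ q (1, 0) := fun q => by simpa using hk q 0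
  have k1 : ∀ q, k q • D.u q (θ q) = Φ q (1, 1) := fun q => by simpa using hk q 1
  -- At time 0 this gives `cont_smul`, at time 1 it gives `cont_frame`.
  choose γ γmem hγ using fun q => Y.exists_smul_eq_of_proj_eq
    (f₁ := fun t : I => Φ (P.nextOnBeta q) (t, 0)) (f₂ := fun t : I => Φ q (t, 1))
    (by fun_prop) (by fun_prop) (fun s => Φmem _ _) (fun s => Φmem _ _)
    (fun s => by rw [Φproj, Φproj, D.glue_beta])
  choose Ψ Ψmem Ψproj Ψzero using fun j => Y.exists_lift_homotopy (D.barHomotopy j)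
    (f := fun _ : I => P.lift (P.time (j, -1))) continuous_const (fun s => P.lift_mem_region _)
    (fun s => by rw [D.bar_zero, P.proj_lift, P.double])
  choose b bmem hb using fun j => Y.exists_smul_eq_of_proj_eq
    (f₁ := fun s : I => D.w j (s * L j)) (f₂ := fun s : I => Ψ j (1, s))
    ((D.isometry_w j).continuous.comp (by fun_prop)) (by fun_prop)
    (fun s => D.w_mem j _ ⟨mul_nonneg s.2.1 (D.L_pos j).le,
      mul_le_of_le_one_left (D.L_pos j).le s.2.2⟩)
    (fun s => Ψmem j _) (fun s => by rw [Ψproj, D.bar_one])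
  have b0 : ∀ j, b j • D.w j 0 = Ψ j (1, 0) := fun j => by simpa using hb j 0
  have b1 : ∀ j, b j • D.w j (L j) = Ψ j (1, 1) := fun j => by simpa using hb j 1
  -- The lifted bar is based at the passage (j, -1), so no deck transformation occurs at its origin,
  -- whereas `opp j` occurs at its terminus.
  have start : ∀ j, Φ (j, -1) (1, 0) = Ψ j (1, 0) := by
    intro j
    obtain ⟨g, gmem, hg⟩ := Y.exists_smul_eq_of_proj_eq
      (f₁ := fun t : I => Φ (j, -1) (t, 0)) (f₂ := fun t : I => Ψ j (t, 0))
      (by fun_prop) (by fun_prop) (fun s => Φmem _ _) (fun s => Ψmem _ _)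
      (fun s => by rw [Φproj, Ψproj, D.glue_origin])
    have h1 : PMEq g 1 := by
      refine Y.pmEq_of_smul_eq gmem (one_mem _) (Φmem (j, -1) (0, 0)) ?_
      rw [hg 0, Ψzero, Φzero, one_smul]
      simp
    rw [← hg 1, h1.smul, one_smul]
  have fin : ∀ j, opp j • Φ (j, 1) (1, 0) = Ψ j (1, 1) := by
    intro j
    obtain ⟨g, gmem, hg⟩ := Y.exists_smul_eq_of_proj_eq
      (f₁ := fun t : I => Φ (j, 1) (t, 0)) (f₂ := fun t : I => Ψ j (t, 1))
      (by fun_prop) (by fun_prop) (fun s => Φmem _ _) (fun s => Ψmem _ _)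
      (fun s => by rw [Φproj, Ψproj, D.glue_terminus])
    have h1 : PMEq g (opp j) := by
      refine Y.pmEq_of_smul_eq gmem (opp_mem j) (Φmem (j, 1) (0, 0)) ?_
      rw [hg 0, Ψzero, Φzero]
      simpa using (opp_smul j).symm
    rw [← hg 1, h1.smul]
  refine ⟨⟨fun q => k q * n q, deck, deck_mem, deck_smul, γ, γmem, fun q => ?_, fun q => ?_, opp,
    opp_mem, opp_smul, opp_pos, fun j => ?_, D.L_pos, D.beta_oriented⟩⟩
  · have := hγ q 0
    rw [Φzero, Φzero] at this
    simpa using this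
  · obtain ⟨g, gmem, hg⟩ := D.beta_geodesic q
    have h1 : PMEq (k q * g) (γ q * k (P.nextOnBeta q)) := by
      refine Y.pmEq_of_smul_eq (mul_mem (kmem _) gmem) (mul_mem (γmem _) (kmem _))
        (D.u_mem (P.nextOnBeta q) 0) ?_
      rw [mul_smul, mul_smul, hg, add_zero, k1, k0, hγ q 1]
    have h2 : ∀ s, (k q * n q * transl (θ q)) • expI s =
        (γ q * (k (P.nextOnBeta q) * n (P.nextOnBeta q))) • expI s := by
      intro s
      rw [mul_smul, mul_smul, transl_smul_expI, ← hn, ← hg, ← mul_smul, h1.smul, mul_smul,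
        mul_smul, mul_smul, ← hn]
    exact pmEq_of_smul_expI one_ne_zero (h2 0) (h2 1)
  · obtain ⟨g, gmem, hg, horth⟩ := D.bar_origin j
    obtain ⟨g', gmem', hg', horth'⟩ := D.bar_terminus j
    have hw : D.w j = fun s => N j • expI s := funext (hN j)
    have hu : (fun s => g • D.u (j, -1) s) = fun s => (g * n (j, -1)) • expI s := by
      funext s; rw [hn, mul_smul]
    have hu' : (fun s => g' • D.u (j, 1) s) = fun s => (g' * n (j, 1)) • expI s := by
      funext s; rw [hn, mul_smul]
    rw [hw, hu] at horth
    rw [hw, hu'] at horth'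
    -- Moving from one line to the other amounts to a quarter turn, a translation of length L j
    -- along the bar, and the inverse of the quarter turn found at its terminus.
    obtain ⟨κ, hκ⟩ := orthogonal_frames (by rw [mul_smul, ← hn, hg, hN]) horth
    obtain ⟨τ, hτ⟩ := orthogonal_frames_at (by rw [mul_smul, ← hn, hg', hN]) horth'
    have h1 : PMEq (b j * g) (k (j, -1)) := by
      refine Y.pmEq_of_smul_eq (mul_mem (bmem _) gmem) (kmem _) (D.u_mem (j, -1) 0) ?_
      rw [mul_smul, hg, b0, k0, start]
    have h2 : PMEq (b j * g') (opp j * k (j, 1)) := by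
      refine Y.pmEq_of_smul_eq (mul_mem (bmem _) gmem') (mul_mem (opp_mem _) (kmem _))
        (D.u_mem (j, 1) 0) ?_
      rw [mul_smul, hg', b1, mul_smul, k0, fin]
    have h3 : PMEq (b j * N j) (k (j, -1) * n (j, -1) * quarter κ) := by
      have := (hκ.mul_left (b j)).trans
        (show PMEq (b j * (g * n (j, -1) * quarter κ)) (k (j, -1) * n (j, -1) * quarter κ) by
          rw [← mul_assoc, ← mul_assoc]
          exact (h1.mul_right _).mul_right _)
      exact this
    have h4 : PMEq (b j * N j * transl (L j)) (opp j * (k (j, 1) * n (j, 1)) * quarter τ) := by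
      have := (hτ.mul_left (b j)).trans
        (show PMEq (b j * (g' * n (j, 1) * quarter τ))
            (opp j * (k (j, 1) * n (j, 1)) * quarter τ) by
          rw [← mul_assoc, ← mul_assoc, ← mul_assoc]
          exact (h2.mul_right _).mul_right _)
      rwa [← mul_assoc] at this
    refine ⟨κ, -τ, ?_⟩
    have h5 := ((h4.symm.trans (h3.mul_right (transl (L j))))).mul_right (quarter τ)⁻¹
    rwa [mul_inv_cancel_right, quarter_inv] at h5

/-! ### Translation length and trace -/

theorem PMEq.abs_trace {A B : SL2} (h : PMEq A B) : |trace (A : M2)| = |trace (B : M2)| := by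
  rcases h with rfl | rfl
  · rfl
  · rw [Matrix.SpecialLinearGroup.coe_neg, trace_neg, abs_neg]

theorem trace_transl (ℓ : ℝ) : trace (transl ℓ : M2) = 2 * Real.cosh (ℓ / 2) := by
  rw [trace_fin_two, Real.cosh_eq]
  simp [transl]
  ring

theorem trace_conj (k A : SL2) : trace ((k * A * k⁻¹ : SL2) : M2) = trace (A : M2) := by
  rw [Matrix.SpecialLinearGroup.coe_mul, trace_mul_comm, ← Matrix.SpecialLinearGroup.coe_mul,
    ← mul_assoc, inv_mul_cancel, one_mul]

theorem abs_trace_of_mul_eq {D A k : SL2} (h : PMEq (D * k) (k * A)) :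
    |trace (D : M2)| = |trace (A : M2)| := by
  have := (h.mul_right k⁻¹).abs_trace
  rwa [mul_inv_cancel_right, trace_conj] at this

/-- Hyperbolic elements of `SL(2, ℝ)` are conjugate to translations along the imaginary axis. -/
theorem exists_conj_transl {D : SL2} (hD : 2 < |trace (D : M2)|) :
    ∃ (k : SL2) (ℓ : ℝ), 0 < ℓ ∧ PMEq (D * k) (k * transl ℓ) := by
  wlog h : 2 < trace (D : M2) generalizing D
  · have h' : 2 < trace ((-D : SL2) : M2) := by
      rw [Matrix.SpecialLinearGroup.coe_neg, trace_neg]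
      rcases abs_cases (trace (D : M2)) with h1 | h1 <;> linarith
    obtain ⟨k, ℓ, hℓ, e⟩ := this (D := -D) (h'.trans_le (le_abs_self _)) h'
    refine ⟨k, ℓ, hℓ, PMEq.trans (Or.inr ?_) e⟩
    rw [neg_mul, neg_neg]
  -- Chosen so that the eigenvalues, which have product 1, are exp(±ℓ/2).
  set ℓ := 2 * Real.arcosh (trace (D : M2) / 2) with hℓd
  have htr : trace (D : M2) = Real.exp (ℓ / 2) + Real.exp (-(ℓ / 2)) := by
    have h1 : Real.cosh (ℓ / 2) = trace (D : M2) / 2 := by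
      rw [hℓd, mul_div_cancel_left₀ _ two_ne_zero, Real.cosh_arcosh (by linarith)]
    rw [Real.cosh_eq] at h1
    linarith
  have hℓ : 0 < ℓ := by
    have := Real.arcosh_pos (x := trace (D : M2) / 2) (by linarith)
    positivity
  have hprod : Real.exp (ℓ / 2) * Real.exp (-(ℓ / 2)) = 1 := by rw [← Real.exp_add]; simp
  have hlt : Real.exp (-(ℓ / 2)) < Real.exp (ℓ / 2) := Real.exp_lt_exp.mpr (by linarith)
  have hd := sl_det D
  have hroot : ∀ x y : ℝ, x * y = 1 → trace (D : M2) = x + y →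
      ∃ v : Fin 2 → ℝ, v ≠ 0 ∧ (D : M2) *ᵥ v = x • v := by
    intro x y hxy hx
    obtain ⟨v, hv, e⟩ := Matrix.exists_mulVec_eq_zero_iff.mpr
      (show ((D : M2) - x • (1 : M2)).det = 0 by
        rw [trace_fin_two] at hx
        rw [det_fin_two]
        simp
        linear_combination hd - x * hx - hxy)
    refine ⟨v, hv, ?_⟩
    rw [sub_mulVec, smul_mulVec, one_mulVec, sub_eq_zero] at e
    exact e
  obtain ⟨v, hv, ev⟩ := hroot _ _ hprod htr
  obtain ⟨w, hw, ew⟩ := hroot _ _ (by rw [mul_comm]; exact hprod) (by rw [htr, add_comm])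
  have ev0 := congrFun ev 0
  have ev1 := congrFun ev 1
  have ew0 := congrFun ew 0
  have ew1 := congrFun ew 1
  simp only [mulVec, dotProduct, Fin.sum_univ_two, Pi.smul_apply, smul_eq_mul] at ev0 ev1 ew0 ew1
  have hxy : Real.exp (ℓ / 2) - Real.exp (-(ℓ / 2)) ≠ 0 := (sub_pos.mpr hlt).ne'
  have hΔ : v 0 * w 1 - v 1 * w 0 ≠ 0 := by
    intro h0
    have c00 : v 0 * w 0 = 0 := mul_left_cancel₀ hxy (by
      linear_combination v 0 * ew0 - w 0 * ev0 - (D : M2) 0 1 * h0)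
    have c11 : v 1 * w 1 = 0 := mul_left_cancel₀ hxy (by
      linear_combination v 1 * ew1 - w 1 * ev1 + (D : M2) 1 0 * h0)
    have c10 : v 1 * w 0 = v 0 * w 1 := by linear_combination -h0
    rcases mul_eq_zero.mp c00 with h1 | h1 <;> rcases mul_eq_zero.mp c11 with h2 | h2
    · exact hv (by ext i; fin_cases i <;> simp [h1, h2])
    · rw [h1, zero_mul] at c10
      rcases mul_eq_zero.mp c10 with h3 | h3
      · exact hv (by ext i; fin_cases i <;> simp [h1, h3])
      · exact hw (by ext i; fin_cases i <;> simp [h2, h3])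
    · rw [h2, zero_mul] at c10
      rcases mul_eq_zero.mp c10.symm with h3 | h3
      · exact hv (by ext i; fin_cases i <;> simp [h2, h3])
      · exact hw (by ext i; fin_cases i <;> simp [h1, h3])
    · exact hw (by ext i; fin_cases i <;> simp [h1, h2])
  set Δ := v 0 * w 1 - v 1 * w 0
  -- The columns are the eigenvectors; dividing the second one by Δ makes the determinant 1.
  obtain ⟨k, hk⟩ : ∃ k : SL2, (k : M2) = !![v 0, w 0 / Δ; v 1, w 1 / Δ] :=
    ⟨⟨!![v 0, w 0 / Δ; v 1, w 1 / Δ], by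
      rw [det_fin_two_of, ← div_self hΔ]; ring⟩, rfl⟩
  refine ⟨k, ℓ, hℓ, Or.inl ?_⟩
  · refine Matrix.SpecialLinearGroup.ext _ _ fun i j => ?_
    rw [Matrix.SpecialLinearGroup.coe_mul, Matrix.SpecialLinearGroup.coe_mul, hk]
    fin_cases i <;> fin_cases j <;> simp [transl, mul_apply, Fin.sum_univ_two] <;>
      first
        | linear_combination ev0
        | linear_combination ev1
        | linear_combination ew0 / Δ
        | linear_combination ew1 / Δ

/-- If a loop is freely homotopic to a closed geodesic of length `ℓ`, its deck transformation is a
hyperbolic element of translation length `ℓ`. -/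
theorem HyperbolicStructure.IsGeodesicLength.abs_trace {S : Type*} [TopologicalSpace S]
    {Y : HyperbolicStructure S} {c : ℝ → S} {f : ℝ → ℍ} {ℓ : ℝ} (hℓ : Y.IsGeodesicLength c ℓ)
    (hf : Continuous f) (hm : ∀ t, f t ∈ Y.region) (hfc : ∀ t, Y.proj (f t) = c t) {D : SL2}
    (hD : D ∈ Y.group) (hDf : ∀ t, D • f t = f (t + 1)) :
    |trace (D : M2)| = 2 * Real.cosh (ℓ / 2) := by
  obtain ⟨h0, u, hu, um, ⟨g, hg, hgu⟩, h, hper, hz, ho⟩ := hℓ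
  obtain ⟨H, Hm, Hp, H0⟩ := Y.exists_lift_homotopy h hf hm fun t => by rw [hz, hfc]
  obtain ⟨g', hg', e'⟩ := Y.exists_smul_eq_of_proj_eq (f₁ := fun t : ℝ => u (ℓ * t))
    (f₂ := fun t : ℝ => H (1, t)) (hu.continuous.comp (by fun_prop)) (by fun_prop)
    (fun t => um _) (fun t => Hm _) fun t => by rw [Hp, ho]
  -- One deck transformation realizes the period all along the homotopy: it is D at the loop, and
  -- the translation of length ℓ at the geodesic.
  obtain ⟨g₂, hg₂, e₂⟩ := Y.exists_smul_eq_of_proj_eq (f₁ := fun p : I × ℝ => H p)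
    (f₂ := fun p : I × ℝ => H (p.1, p.2 + 1)) (by fun_prop) (by fun_prop)
    (fun t => Hm _) (fun t => Hm _) fun p => by rw [Hp, Hp, hper]
  have h1 : PMEq g₂ D := Y.pmEq_of_smul_eq hg₂ hD (hm 0) (by
    rw [hDf, ← H0, ← H0]; exact e₂ (0, 0))
  obtain ⟨m, hmu⟩ := exists_frame hu
  have h2 : ∀ s, (D * (g' * m)) • expI s = ((g' * m) * transl ℓ) • expI s := by
    intro s
    obtain ⟨t, rfl⟩ : ∃ t, s = ℓ * t := ⟨s / ℓ, by field_simp⟩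
    rw [mul_smul, mul_smul, mul_smul, mul_smul, transl_smul_expI, ← hmu, ← hmu, e', ← h1.smul,
      e₂ (1, t), ← e']
    congr 2
    ring
  rw [abs_trace_of_mul_eq (pmEq_of_smul_expI one_ne_zero (h2 0) (h2 1)), trace_transl,
    abs_of_pos (by positivity)]

/-! ### Geodesic segments and existence of the closed geodesic -/

/-- The points of the upper half-plane correspond to the unimodular positive symmetric matrices.
These are the entries of the combination of two such matrices. -/
noncomputable def segP (a b : ℝ) (z w : ℍ) : ℝ :=
  a * (z.re ^ 2 + z.im ^ 2) / z.im + b * (w.re ^ 2 + w.im ^ 2) / w.im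

/-- The second coefficient of the matrix of a point of the segment, up to scaling. -/
noncomputable def segQ (a b : ℝ) (z w : ℍ) : ℝ := a * z.re / z.im + b * w.re / w.im

/-- The third coefficient of the matrix of a point of the segment, up to scaling. -/
noncomputable def segR (a b : ℝ) (z w : ℍ) : ℝ := a / z.im + b / w.im

theorem segR_pos {a b : ℝ} (ha : 0 ≤ a) (hb : 0 ≤ b) (hab : 0 < a + b) (z w : ℍ) :
    0 < segR a b z w := by
  have hz := z.im_pos
  have hw := w.im_pos
  unfold segR
  rcases ha.eq_or_lt with rfl | ha
  · have : 0 < b := by linarith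
    positivity
  · positivity

/-- Each point corresponds to a form of determinant 1, and the polarization of the determinant at
two points is 2 cosh of their distance. -/
theorem seg_disc (a b : ℝ) (z w : ℍ) : segP a b z w * segR a b z w - segQ a b z w ^ 2 =
    a ^ 2 + b ^ 2 + 2 * a * b * Real.cosh (dist z w) := by
  have hz := z.im_pos.ne'
  have hw := w.im_pos.ne'
  rw [UpperHalfPlane.cosh_dist']
  unfold segP segQ segR
  field_simp
  ring

theorem seg_disc_pos {a b : ℝ} (ha : 0 ≤ a) (hb : 0 ≤ b) (hab : 0 < a + b) (z w : ℍ) :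
    0 < segP a b z w * segR a b z w - segQ a b z w ^ 2 := by
  rw [seg_disc]
  have := Real.cosh_pos (dist z w)
  rcases ha.eq_or_lt with rfl | ha
  · have : 0 < b := by linarith
    positivity
  · positivity

/-- A point of the geodesic segment from `z` to `w`. -/
noncomputable def segmentPoint {a b : ℝ} (ha : 0 ≤ a) (hb : 0 ≤ b) (hab : 0 < a + b) (z w : ℍ) :
    ℍ :=
  ⟨⟨segQ a b z w / segR a b z w,
    √(segP a b z w * segR a b z w - segQ a b z w ^ 2) / segR a b z w⟩,
    div_pos (Real.sqrt_pos.mpr (seg_disc_pos ha hb hab z w)) (segR_pos ha hb hab z w)⟩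

/-- With C = cosh d and N² = a² + b² + 2abC, the distances to the two ends have cosh (a + bC)/N and
(aC + b)/N, and sinh b sinh d/N and a sinh d/N. The addition formula then returns C. -/
theorem dist_segmentPoint {a b : ℝ} (ha : 0 ≤ a) (hb : 0 ≤ b) (hab : 0 < a + b) (z w : ℍ) :
    dist z (segmentPoint ha hb hab z w) + dist (segmentPoint ha hb hab z w) w = dist z w := by
  set m := segmentPoint ha hb hab z w with hm
  set C := Real.cosh (dist z w) with hC
  set N := √(segP a b z w * segR a b z w - segQ a b z w ^ 2) with hN
  have hr := segR_pos ha hb hab z w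
  have hdp := seg_disc_pos ha hb hab z w
  have hN0 : 0 < N := Real.sqrt_pos.mpr hdp
  have hN2 : N ^ 2 = segP a b z w * segR a b z w - segQ a b z w ^ 2 := Real.sq_sqrt hdp.le
  have hre : m.re = segQ a b z w / segR a b z w := rfl
  have him : m.im = N / segR a b z w := rfl
  have hzi := z.im_pos
  have hwi := w.im_pos
  have key : ∀ x : ℍ, Real.cosh (dist x m) = (segR a b z w * (x.re ^ 2 + x.im ^ 2) -
      2 * x.re * segQ a b z w + segP a b z w) / (2 * x.im * N) := by
    intro x
    have hx := x.im_pos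
    rw [UpperHalfPlane.cosh_dist', hre, him]
    field_simp
    linear_combination hN2
  have hC' : C = ((z.re - w.re) ^ 2 + z.im ^ 2 + w.im ^ 2) / (2 * z.im * w.im) :=
    UpperHalfPlane.cosh_dist' z w
  have hcz : Real.cosh (dist z m) = (a + b * C) / N := by
    rw [key, hC']
    unfold segP segQ segR
    field_simp
    ring
  have hcw : Real.cosh (dist m w) = (a * C + b) / N := by
    rw [dist_comm, key, hC']
    unfold segP segQ segR
    field_simp
    ring
  have hN3 : N ^ 2 = a ^ 2 + b ^ 2 + 2 * a * b * C := by rw [hN2, seg_disc]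
  have hsinh : ∀ d e y : ℝ, 0 ≤ d → Real.cosh d = y / N → 0 ≤ e → y ^ 2 - N ^ 2 = e ^ 2 →
      Real.sinh d = e / N := by
    intro d e y hd hc he h
    have h1 : Real.sinh d ^ 2 = (e / N) ^ 2 := by
      rw [Real.sinh_sq, hc]
      field_simp
      linarith
    exact (pow_left_inj₀ (Real.sinh_nonneg_iff.mpr hd) (by positivity) two_ne_zero).mp h1
  have hS0 : 0 ≤ Real.sinh (dist z w) := Real.sinh_nonneg_iff.mpr dist_nonneg
  have hS2 : Real.sinh (dist z w) ^ 2 = C ^ 2 - 1 := Real.sinh_sq _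
  have hsz := hsinh _ (b * Real.sinh (dist z w)) _ dist_nonneg hcz (mul_nonneg hb hS0)
    (by rw [mul_pow, hS2, hN3]; ring)
  have hsw := hsinh _ (a * Real.sinh (dist z w)) _ dist_nonneg hcw (mul_nonneg ha hS0)
    (by rw [mul_pow, hS2, hN3]; ring)
  have : Real.cosh (dist z m + dist m w) = Real.cosh (dist z w) := by
    rw [Real.cosh_add, hcz, hcw, hsz, hsw, ← hC]
    field_simp
    rw [hN3, hS2]
    ring
  exact Real.cosh_injOn (by simp; positivity) (by simp [dist_nonneg]) this

theorem continuous_segmentPoint {A : Type*} [TopologicalSpace A] {a b : A → ℝ}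
    (ha : ∀ x, 0 ≤ a x) (hb : ∀ x, 0 ≤ b x) (hab : ∀ x, 0 < a x + b x) {z w : A → ℍ}
    (hac : Continuous a) (hbc : Continuous b) (hz : Continuous z) (hw : Continuous w) :
    Continuous fun x => segmentPoint (ha x) (hb x) (hab x) (z x) (w x) := by
  have h1 : Continuous fun x => (z x).re := UpperHalfPlane.continuous_re.comp hz
  have h2 : Continuous fun x => (z x).im := UpperHalfPlane.continuous_im.comp hz
  have h3 : Continuous fun x => (w x).re := UpperHalfPlane.continuous_re.comp hw
  have h4 : Continuous fun x => (w x).im := UpperHalfPlane.continuous_im.comp hw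
  have hzi : ∀ x, (z x).im ≠ 0 := fun x => (z x).im_pos.ne'
  have hwi : ∀ x, (w x).im ≠ 0 := fun x => (w x).im_pos.ne'
  have hP : Continuous fun x => segP (a x) (b x) (z x) (w x) := by
    unfold segP
    exact ((hac.mul ((h1.pow 2).add (h2.pow 2))).div h2 hzi).add
      ((hbc.mul ((h3.pow 2).add (h4.pow 2))).div h4 hwi)
  have hQ : Continuous fun x => segQ (a x) (b x) (z x) (w x) := by
    unfold segQ
    exact ((hac.mul h1).div h2 hzi).add ((hbc.mul h3).div h4 hwi)
  have hR : Continuous fun x => segR (a x) (b x) (z x) (w x) := by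
    unfold segR
    exact (hac.div h2 hzi).add (hbc.div h4 hwi)
  have hR0 : ∀ x, segR (a x) (b x) (z x) (w x) ≠ 0 := fun x =>
    (segR_pos (ha x) (hb x) (hab x) _ _).ne'
  rw [UpperHalfPlane.isEmbedding_coe.continuous_iff]
  refine Complex.equivRealProdCLM.toHomeomorph.isInducing.continuous_iff.mpr ?_
  exact (hQ.div hR hR0).prodMk ((((hP.mul hR).sub (hQ.pow 2)).sqrt).div hR hR0)

theorem transl_smul_re_im (ℓ : ℝ) (z : ℍ) :
    (transl ℓ • z).re = Real.exp ℓ * z.re ∧ (transl ℓ • z).im = Real.exp ℓ * z.im := by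
  have h : ((transl ℓ • z : ℍ) : ℂ) = ((Real.exp ℓ : ℝ) : ℂ) * z := by
    have : Real.exp ℓ = Real.exp (ℓ / 2) * Real.exp (ℓ / 2) := by rw [← Real.exp_add]; ring_nf
    have h0 : Real.exp (ℓ / 2) * Real.exp (-(ℓ / 2)) = 1 := by rw [← Real.exp_add]; simp
    rw [coe_sl_smul, div_eq_iff (sl_denom_ne_zero _ z.im_pos.ne'), this]
    simp [transl, -Complex.ofReal_exp]
    have h0' := congrArg (fun x : ℝ => (x : ℂ)) h0
    push_cast [-Complex.ofReal_exp] at h0'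
    linear_combination (-((Real.exp (ℓ / 2) : ℝ) : ℂ) * z) * h0'
  constructor
  · have := congrArg Complex.re h
    simpa [-Complex.ofReal_exp] using this
  · have := congrArg Complex.im h
    simpa [-Complex.ofReal_exp] using this

theorem transl_smul_segmentPoint {a b : ℝ} (ha : 0 ≤ a) (hb : 0 ≤ b) (hab : 0 < a + b) (z w : ℍ)
    (ℓ : ℝ) : transl ℓ • segmentPoint ha hb hab z w =
      segmentPoint ha hb hab (transl ℓ • z) (transl ℓ • w) := by
  obtain ⟨h1, h2⟩ := transl_smul_re_im ℓ (segmentPoint ha hb hab z w)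
  obtain ⟨h3, h4⟩ := transl_smul_re_im ℓ z
  obtain ⟨h5, h6⟩ := transl_smul_re_im ℓ w
  have he := Real.exp_pos ℓ
  have hz := z.im_pos
  have hw := w.im_pos
  have hP : segP a b (transl ℓ • z) (transl ℓ • w) = Real.exp ℓ * segP a b z w := by
    unfold segP; rw [h3, h4, h5, h6]; field_simp
  have hQ : segQ a b (transl ℓ • z) (transl ℓ • w) = segQ a b z w := by
    unfold segQ; rw [h3, h4, h5, h6]; field_simp
  have hR : segR a b (transl ℓ • z) (transl ℓ • w) = segR a b z w / Real.exp ℓ := by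
    unfold segR; rw [h4, h6]; field_simp
  have hr := segR_pos ha hb hab z w
  have hD : Real.exp ℓ * segP a b z w * (segR a b z w / Real.exp ℓ) =
    segP a b z w * segR a b z w := by field_simp
  ext
  apply Complex.ext
  · change (transl ℓ • segmentPoint ha hb hab z w).re = segQ a b (transl ℓ • z) (transl ℓ • w) /
      segR a b (transl ℓ • z) (transl ℓ • w)
    rw [h1, hQ, hR]
    change Real.exp ℓ * (segQ a b z w / segR a b z w) = _
    field_simp
  · change (transl ℓ • segmentPoint ha hb hab z w).im = √(segP a b (transl ℓ • z) (transl ℓ • w) *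
      segR a b (transl ℓ • z) (transl ℓ • w) - segQ a b (transl ℓ • z) (transl ℓ • w) ^ 2) /
      segR a b (transl ℓ • z) (transl ℓ • w)
    rw [h2, hQ, hR, hP, hD]
    change Real.exp ℓ * (√_ / segR a b z w) = _
    field_simp

theorem segmentPoint_left {a b : ℝ} (ha : 0 ≤ a) (hb : 0 ≤ b) (hab : 0 < a + b) (z w : ℍ)
    (h1 : a = 1) (h0 : b = 0) : segmentPoint ha hb hab z w = z := by
  subst h1 h0
  have hz := z.im_pos.ne'
  have hR : segR 1 0 z w = 1 / z.im := by simp [segR]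
  have hQ : segQ 1 0 z w = z.re / z.im := by simp [segQ]
  ext
  apply Complex.ext
  · change segQ 1 0 z w / segR 1 0 z w = z.re
    rw [hR, hQ]
    field_simp
  · change √_ / segR 1 0 z w = z.im
    rw [seg_disc, hR]
    simp

theorem segmentPoint_right {a b : ℝ} (ha : 0 ≤ a) (hb : 0 ≤ b) (hab : 0 < a + b) (z w : ℍ)
    (h0 : a = 0) (h1 : b = 1) : segmentPoint ha hb hab z w = w := by
  subst h1 h0
  have hw := w.im_pos.ne'
  have hR : segR 0 1 z w = 1 / w.im := by simp [segR]
  have hQ : segQ 0 1 z w = w.re / w.im := by simp [segQ]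
  ext
  apply Complex.ext
  · change segQ 0 1 z w / segR 0 1 z w = w.re
    rw [hR, hQ]
    field_simp
  · change √_ / segR 0 1 z w = w.im
    rw [seg_disc, hR]
    simp

/-- A closed convex set which contains the translates of a point contains the axis. -/
theorem expI_mem_of_closed_convex {C : Set ℍ} (hC : IsClosed C)
    (hconv : ∀ x ∈ C, ∀ y ∈ C, ∀ z : ℍ, dist x z + dist z y = dist x y → z ∈ C) {ℓ : ℝ}
    (hℓ : 0 < ℓ) {w : ℍ} (hw : ∀ n : ℕ, transl (n * ℓ) • w ∈ C)
    (hw' : ∀ n : ℕ, transl (-(n * ℓ)) • w ∈ C) (s : ℝ) : expI s ∈ C := by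
  set E := Real.exp s with hE
  have hE0 : 0 < E := Real.exp_pos s
  set A := w.re ^ 2 + w.im ^ 2 with hA
  have hwi := w.im_pos
  have hA0 : 0 < A := by positivity
  let e : ℕ → ℝ := fun n => Real.exp (-(n * ℓ))
  have he0 : ∀ n, 0 < e n := fun n => Real.exp_pos _
  have he1 : ∀ n : ℕ, Real.exp (n * ℓ) = 1 / e n := fun n => by
    simp only [e]
    rw [Real.exp_neg, one_div, inv_inv]
  have het : Filter.Tendsto e Filter.atTop (𝓝 0) :=
    Real.tendsto_exp_neg_atTop_nhds_zero.comp (tendsto_natCast_atTop_atTop.atTop_mul_const hℓ)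
  -- The weights are tuned to the target. As e n tends to 0, the coefficients P, Q, R of the
  -- combination tend to AE²/Im w, 0 and A/Im w, which are those of i E up to scaling.
  let a : ℕ → ℝ := fun n => E ^ 2 * e n
  let b : ℕ → ℝ := fun n => A * e n
  have ha : ∀ n, 0 < a n := fun n => mul_pos (by positivity) (he0 n)
  have hb : ∀ n, 0 < b n := fun n => mul_pos hA0 (he0 n)
  let x : ℕ → ℍ := fun n => segmentPoint (ha n).le (hb n).le (add_pos (ha n) (hb n))
    (transl (n * ℓ) • w) (transl (-(n * ℓ)) • w)
  have hx : ∀ n, x n ∈ C := fun n => hconv _ (hw n) _ (hw' n) _ (dist_segmentPoint _ _ _ _ _)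
  have hP : ∀ n, segP (a n) (b n) (transl (n * ℓ) • w) (transl (-(n * ℓ)) • w) =
      A * (E ^ 2 + A * e n ^ 2) / w.im := by
    intro n
    have := (he0 n).ne'
    unfold segP
    rw [(transl_smul_re_im _ w).1, (transl_smul_re_im _ w).1, (transl_smul_re_im _ w).2,
      (transl_smul_re_im _ w).2, he1]
    change _ / _ + A * e n * ((e n * w.re) ^ 2 + (e n * w.im) ^ 2) / (e n * w.im) = _
    simp only [a]
    field_simp
    rw [← hA]
  have hQ : ∀ n, segQ (a n) (b n) (transl (n * ℓ) • w) (transl (-(n * ℓ)) • w) =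
      (E ^ 2 + A) * e n * w.re / w.im := by
    intro n
    have := (he0 n).ne'
    unfold segQ
    rw [(transl_smul_re_im _ w).1, (transl_smul_re_im _ w).1, (transl_smul_re_im _ w).2,
      (transl_smul_re_im _ w).2, he1]
    change _ / _ + A * e n * (e n * w.re) / (e n * w.im) = _
    simp only [a]
    field_simp
  have hR : ∀ n, segR (a n) (b n) (transl (n * ℓ) • w) (transl (-(n * ℓ)) • w) =
      (E ^ 2 * e n ^ 2 + A) / w.im := by
    intro n
    have := (he0 n).ne'
    unfold segR
    rw [(transl_smul_re_im _ w).2, (transl_smul_re_im _ w).2, he1]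
    change _ / _ + A * e n / (e n * w.im) = _
    simp only [a]
    field_simp
  have hlim : Filter.Tendsto x Filter.atTop (𝓝 (expI s)) := by
    rw [UpperHalfPlane.isEmbedding_coe.tendsto_nhds_iff]
    refine Complex.equivRealProdCLM.toHomeomorph.isInducing.tendsto_nhds_iff.mpr ?_
    refine Filter.Tendsto.congr (f₁ := fun n => (((E ^ 2 + A) * e n * w.re / w.im) /
      ((E ^ 2 * e n ^ 2 + A) / w.im), √((A * (E ^ 2 + A * e n ^ 2) / w.im) *
        ((E ^ 2 * e n ^ 2 + A) / w.im) - ((E ^ 2 + A) * e n * w.re / w.im) ^ 2) /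
        ((E ^ 2 * e n ^ 2 + A) / w.im))) ?_ ?_
    · intro n
      rw [← hP, ← hQ, ← hR]
      rfl
    · have hc : Continuous fun ε : ℝ => ((((E ^ 2 + A) * ε * w.re / w.im) /
        ((E ^ 2 * ε ^ 2 + A) / w.im), √((A * (E ^ 2 + A * ε ^ 2) / w.im) *
        ((E ^ 2 * ε ^ 2 + A) / w.im) - ((E ^ 2 + A) * ε * w.re / w.im) ^ 2) /
        ((E ^ 2 * ε ^ 2 + A) / w.im)) : ℝ × ℝ) := by
        have : ∀ ε : ℝ, (E ^ 2 * ε ^ 2 + A) / w.im ≠ 0 := fun ε => by positivity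
        fun_prop (disch := assumption)
      refine (hc.tendsto' 0 _ ?_).comp het
      have h4 : A * (E ^ 2 + A * 0 ^ 2) / w.im * ((E ^ 2 * 0 ^ 2 + A) / w.im) -
          ((E ^ 2 + A) * 0 * w.re / w.im) ^ 2 = (A * E / w.im) ^ 2 := by ring
      rw [h4, Real.sqrt_sq (by positivity)]
      apply Prod.ext
      · simp [-Complex.ofReal_exp]
      · simp [-Complex.ofReal_exp]
        rw [← hE]
        field_simp
  exact hC.mem_of_tendsto hlim (Filter.Eventually.of_forall hx)

/-- Conjugating the deck transformation to a translation, the region contains the orbit of a point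
under its powers, hence its axis. The segments from f t to the axis point at parameter ℓt stay in
the region and are equivariant, so they project to a free homotopy. -/
theorem HyperbolicStructure.exists_isGeodesicLength {S : Type*} [TopologicalSpace S]
    (Y : HyperbolicStructure S) {c : ℝ → S} {f : ℝ → ℍ}
    (hf : Continuous f) (hm : ∀ t, f t ∈ Y.region) (hfc : ∀ t, Y.proj (f t) = c t) {D : SL2}
    (hD : D ∈ Y.group) (hDf : ∀ t, D • f t = f (t + 1)) (hDt : 2 < |trace (D : M2)|) :
    ∃ ℓ, Y.IsGeodesicLength c ℓ := by
  obtain ⟨k, ℓ, hℓ, hk⟩ := exists_conj_transl hDt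
  have hkD : ∀ z : ℍ, k • transl ℓ • z = D • k • z := fun z => by
    rw [← mul_smul, ← mul_smul, hk.smul]
  have hstep : ∀ t, transl ℓ • (k⁻¹ • f t) = k⁻¹ • f (t + 1) := by
    intro t
    rw [eq_inv_smul_iff, hkD, smul_inv_smul, hDf]
  have hn : ∀ (n : ℕ) (t : ℝ), transl (n * ℓ) • (k⁻¹ • f t) = k⁻¹ • f (t + n) := by
    intro n
    induction n with
    | zero => intro t; simp [transl_zero]
    | succ n ih =>
      intro t
      have : transl ((n + 1 : ℕ) * ℓ) = transl (n * ℓ) * transl ℓ := by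
        rw [transl_mul]; congr 1; push_cast; ring
      rw [this, mul_smul, hstep, ih]
      congr 2
      push_cast
      ring
  have hn' : ∀ (n : ℕ) (t : ℝ), transl (-(n * ℓ)) • (k⁻¹ • f t) = k⁻¹ • f (t - n) := by
    intro n t
    rw [← transl_inv, inv_smul_eq_iff, hn, sub_add_cancel]
  have haxis : ∀ s, k • expI s ∈ Y.region := by
    intro s
    refine expI_mem_of_closed_convex (C := (fun z => k • z) ⁻¹' Y.region) (w := k⁻¹ • f 0)
      (Y.isClosed.preimage (continuous_const_smul k)) ?_ hℓ ?_ ?_ s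
    · intro x hx y hy z hz
      exact Y.convex _ hx _ hy _ (by simpa only [dist_smul] using hz)
    · intro n
      rw [hn, Set.mem_preimage, smul_inv_smul]
      exact hm _
    · intro n
      rw [hn', Set.mem_preimage, smul_inv_smul]
      exact hm _
  have hx0 : ∀ p : I × ℝ, 0 ≤ 1 - (p.1 : ℝ) := fun p => by linarith [p.1.2.2]
  have hx1 : ∀ p : I × ℝ, 0 ≤ (p.1 : ℝ) := fun p => p.1.2.1
  have hx2 : ∀ p : I × ℝ, 0 < 1 - (p.1 : ℝ) + p.1 := fun p => by linarith
  let F : I × ℝ → ℍ := fun p => k • segmentPoint (hx0 p) (hx1 p) (hx2 p) (k⁻¹ • f p.2)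
    (expI (ℓ * p.2))
  have hFm : ∀ p, F p ∈ Y.region := fun p => by
    have := dist_segmentPoint (hx0 p) (hx1 p) (hx2 p) (k⁻¹ • f p.2) (expI (ℓ * p.2))
    rw [← dist_smul k, ← dist_smul k _ (expI (ℓ * p.2)), ← dist_smul k (k⁻¹ • f p.2) (expI _),
      smul_inv_smul] at this
    exact Y.convex _ (hm p.2) _ (haxis (ℓ * p.2)) _ this
  have hFc : Continuous F :=
    (continuous_segmentPoint hx0 hx1 hx2 (by fun_prop) (by fun_prop)
      ((hf.comp continuous_snd).const_smul k⁻¹)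
      (isometry_expI.continuous.comp (by fun_prop))).const_smul k
  refine ⟨ℓ, hℓ, fun s => k • expI s, isometry_smul_expI k, haxis, ⟨D, hD, fun s => ?_⟩,
    ⟨fun p => Y.proj (F p), ?_⟩, fun x t => ?_, fun t => ?_, fun t => ?_⟩
  · rw [← hkD, transl_smul_expI, add_comm]
  · exact Y.isQuotientMap.continuous.comp (hFc.subtype_mk hFm)
  · refine ((Y.proj_eq_iff _ (hFm _) _ (hFm _)).mpr ⟨D, hD, ?_⟩).symm
    simp only [F]
    rw [← hkD, transl_smul_segmentPoint, hstep, transl_smul_expI]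
    congr 3
    ring
  · have : F (0, t) = f t := by
      simp only [F]
      rw [segmentPoint_left _ _ _ _ _ (by simp) (by simp), smul_inv_smul]
    exact (congrArg Y.proj this).trans (hfc t)
  · have : F (1, t) = k • expI (ℓ * t) := by
      simp only [F]
      rw [segmentPoint_right _ _ _ _ _ (by simp) (by simp)]
    exact congrArg Y.proj this

/-- The trace determines ℓ > 0, so the set defining the infimum is a singleton. -/
theorem HyperbolicStructure.isGeodesicLength_length {S : Type*} [TopologicalSpace S]
    (Y : HyperbolicStructure S) {c : ℝ → S} {f : ℝ → ℍ}
    (hf : Continuous f) (hm : ∀ t, f t ∈ Y.region) (hfc : ∀ t, Y.proj (f t) = c t) {D : SL2}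
    (hD : D ∈ Y.group) (hDf : ∀ t, D • f t = f (t + 1)) (hDt : 2 < |trace (D : M2)|) :
    Y.IsGeodesicLength c (Y.length c) ∧ |trace (D : M2)| = 2 * Real.cosh (Y.length c / 2) := by
  obtain ⟨ℓ, hℓ⟩ := Y.exists_isGeodesicLength hf hm hfc hD hDf hDt
  have : {ℓ | Y.IsGeodesicLength c ℓ} = {ℓ} := by
    ext ℓ'
    refine ⟨fun h => ?_, fun h => by rw [Set.mem_singleton_iff.mp h]; exact hℓ⟩
    have h1 := h.abs_trace hf hm hfc hD hDf
    rw [hℓ.abs_trace hf hm hfc hD hDf] at h1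
    have h2 := Real.cosh_injOn (Set.mem_Ici.mpr (half_pos hℓ.1).le)
      (Set.mem_Ici.mpr (half_pos h.1).le) (mul_left_cancel₀ two_ne_zero h1)
    rw [Set.mem_singleton_iff]
    linarith
  have h2 : Y.length c = ℓ := by
    rw [HyperbolicStructure.length, this, csInf_singleton]
  rw [h2]
  exact ⟨hℓ, hℓ.abs_trace hf hm hfc hD hDf⟩

/-! ### Variation of the argument and the index of a crosscut -/

/-- A null-homotopic family of nonzero complex numbers has a continuous logarithm. -/
theorem exists_log_homotopy {A : Type*} [TopologicalSpace A] {h : I × A → ℂ} (hc : Continuous h)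
    (h0 : ∀ p, h p ≠ 0) {w : ℂ} (hw : ∀ a, h (0, a) = w) :
    ∃ g : I × A → ℂ, Continuous g ∧ ∀ p, Complex.exp (g p) = h p := by
  rcases isEmpty_or_nonempty A with hA | ⟨⟨a₀⟩⟩
  · exact ⟨fun _ => 0, continuous_const, fun p => (hA.false p.2).elim⟩
  have hw0 : w ≠ 0 := by rw [← hw a₀]; exact h0 _
  let H : C(I × A, {z : ℂ // z ≠ 0}) := ⟨fun p => ⟨h p, h0 p⟩, hc.subtype_mk _⟩
  let f : C(A, ℂ) := ⟨fun _ => Complex.log w, continuous_const⟩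
  have hf : ∀ a, H (0, a) = (⟨_, (f a).exp_ne_zero⟩ : {z : ℂ // z ≠ 0}) := fun a =>
    Subtype.ext ((hw a).trans (Complex.exp_log hw0).symm)
  let G := Complex.isCoveringMap_exp.liftHomotopy H f hf
  exact ⟨G, G.continuous, fun p =>
    congrArg Subtype.val (congrFun (Complex.isCoveringMap_exp.liftHomotopy_lifts H f hf) p)⟩

theorem exists_log_path (T : C(I, ℂ)) (h0 : ∀ x, T x ≠ 0) :
    ∃ L : C(I, ℂ), ∀ x, Complex.exp (L x) = T x := by
  obtain ⟨g, hg, hge⟩ := exists_log_homotopy (A := I) (h := fun p => T (p.1 * p.2)) (w := T 0)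
    (by fun_prop) (fun p => h0 _) (fun a => by simp)
  exact ⟨⟨fun x => g (1, x), by fun_prop⟩, fun x => by simpa using hge (1, x)⟩

/-- Two logarithms of the same path are lifts for the exponential covering, so they differ by a
constant. -/
theorem sub_eq_of_exp_eq {L L' : C(I, ℂ)} (h : ∀ x, Complex.exp (L x) = Complex.exp (L' x)) :
    L 1 - L 0 = L' 1 - L' 0 := by
  have := Complex.isCoveringMap_exp.eq_of_comp_eq (g₁ := L) (g₂ := fun x => L' x + (L 0 - L' 0))
    L.continuous (by fun_prop) (by
      funext x
      refine Subtype.ext ?_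
      simp only [Function.comp_apply]
      rw [Complex.exp_add, Complex.exp_sub, h, h 0, div_self (Complex.exp_ne_zero _), mul_one])
    0 (by ring)
  have h1 := congrFun this 1
  linear_combination h1

open Classical in
/-- The variation of the argument of `T - z` along the path `T`. -/
noncomputable def argChange (T : C(I, ℂ)) (z : ℂ) : ℝ :=
  if h : ∃ L : C(I, ℂ), ∀ x, Complex.exp (L x) = T x - z then (h.choose 1 - h.choose 0).im else 0

theorem argChange_eq {T : C(I, ℂ)} {z : ℂ} {L : C(I, ℂ)}
    (hL : ∀ x, Complex.exp (L x) = T x - z) : argChange T z = (L 1 - L 0).im := by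
  have h : ∃ L : C(I, ℂ), ∀ x, Complex.exp (L x) = T x - z := ⟨L, hL⟩
  rw [argChange, dif_pos h, sub_eq_of_exp_eq fun x => (h.choose_spec x).trans (hL x).symm]

theorem exists_log_path_sub {T : C(I, ℂ)} {z : ℂ} (hz : z ∉ Set.range T) :
    ∃ L : C(I, ℂ), ∀ x, Complex.exp (L x) = T x - z :=
  exists_log_path ⟨fun x => T x - z, by fun_prop⟩ fun x => sub_ne_zero.mpr fun e => hz ⟨x, e⟩

theorem continuousAt_argChange {T : C(I, ℂ)} {z₀ : ℂ} (hz : z₀ ∉ Set.range T) :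
    ContinuousAt (argChange T) z₀ := by
  have hne : ∀ x, T x - z₀ ≠ 0 := fun x => sub_ne_zero.mpr fun e => hz ⟨x, e⟩
  have hopen : (Set.range T)ᶜ ∈ 𝓝 z₀ :=
    (isCompact_range T.continuous).isClosed.isOpen_compl.mem_nhds hz
  obtain ⟨d, hd, hball⟩ := Metric.mem_nhds_iff.mp hopen
  have hdT : ∀ x, d ≤ ‖T x - z₀‖ := fun x => by
    by_contra! h
    exact hball (by rwa [Metric.mem_ball, dist_eq_norm]) ⟨x, rfl⟩
  obtain ⟨L, hL⟩ := exists_log_path_sub hz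
  -- Within the distance d from z₀ to the path, the quotient stays at distance less than 1 from 1,
  -- so its principal logarithm corrects a logarithm of T - z₀ to one of T - z.
  have hslit : ∀ z ∈ Metric.ball z₀ d, ∀ x, (T x - z) / (T x - z₀) ∈ Complex.slitPlane := by
    intro z hz x
    rw [Metric.mem_ball, dist_eq_norm] at hz
    have h1 : (T x - z) / (T x - z₀) = 1 + (z₀ - z) / (T x - z₀) := by
      field_simp [hne x]
      ring
    rw [h1]
    apply Complex.mem_slitPlane_of_norm_lt_one
    rw [norm_div, div_lt_one (norm_pos_iff.mpr (hne x)), norm_sub_rev]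
    exact hz.trans_le (hdT x)
  have hformula : ∀ z ∈ Metric.ball z₀ d, argChange T z₀ +
      (((T 1 - z) / (T 1 - z₀)).arg - ((T 0 - z) / (T 0 - z₀)).arg) = argChange T z := by
    intro z hz
    have hcont : Continuous fun x => L x + Complex.log ((T x - z) / (T x - z₀)) :=
      L.continuous.add (Continuous.clog ((T.continuous.sub continuous_const).div
        (T.continuous.sub continuous_const) hne) (hslit z hz))
    rw [argChange_eq (z := z) (L := ⟨_, hcont⟩), argChange_eq hL]
    · simp [Complex.log_im]
      ring
    · intro x
      change Complex.exp (L x + Complex.log ((T x - z) / (T x - z₀))) = _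
      rw [Complex.exp_add, Complex.exp_log (Complex.slitPlane_ne_zero (hslit z hz x)), hL,
        mul_div_cancel₀ _ (hne x)]
  refine ContinuousAt.congr ?_ (Filter.eventually_of_mem (Metric.ball_mem_nhds z₀ hd) hformula)
  have harg : ∀ x, ContinuousAt (fun z => ((T x - z) / (T x - z₀)).arg) z₀ := fun x =>
    ContinuousAt.comp (g := Complex.arg)
      (Complex.continuousAt_arg (hslit z₀ (Metric.mem_ball_self hd) x)) (by fun_prop)
  exact continuousAt_const.add ((harg 1).sub (harg 0))

/-- For a path in the closed upper half-plane, seen from a real point. -/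
theorem argChange_ofReal {T : C(I, ℂ)} (hT : ∀ x, 0 ≤ (T x).im) {p : ℝ}
    (hp : (p : ℂ) ∉ Set.range T) :
    argChange T p = (-Complex.I * (T 1 - p)).arg - (-Complex.I * (T 0 - p)).arg := by
  have hne : ∀ x, T x - p ≠ 0 := fun x => sub_ne_zero.mpr fun e => hp ⟨x, e⟩
  have hs : ∀ x, -Complex.I * (T x - p) ∈ Complex.slitPlane := by
    intro x
    rw [Complex.mem_slitPlane_iff]
    by_contra! h
    simp only [Complex.mul_re, Complex.neg_re, Complex.I_re, Complex.neg_im, Complex.I_im,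
      Complex.sub_re, Complex.sub_im, Complex.ofReal_re, Complex.ofReal_im, Complex.mul_im] at h
    exact hne x (Complex.ext (by simp; linarith) (by simp; linarith [hT x]))
  have hcont : Continuous fun x => Complex.log (-Complex.I * (T x - p)) + Complex.log Complex.I :=
    (Continuous.clog (by fun_prop) hs).add continuous_const
  rw [argChange_eq (L := ⟨_, hcont⟩)]
  · simp [Complex.log_im]
  · intro x
    change Complex.exp (Complex.log (-Complex.I * (T x - p)) + Complex.log Complex.I) = _
    rw [Complex.exp_add, Complex.exp_log (Complex.slitPlane_ne_zero (hs x)),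
      Complex.exp_log Complex.I_ne_zero]
    linear_combination (-(T x - p)) * Complex.I_sq

/-- The angle under which the segment from `A` to `B` is seen from `z`. -/
noncomputable def segArg (A B z : ℂ) : ℝ := ((B - z) / (A - z)).arg

/-- The winding number, around a point of the upper half-plane, of the loop obtained by following
backwards the path `TA` from the real axis to `A`, then the segment from `A` to `B`, the path `TB`
from `B` to the real axis, and the real axis. -/
noncomputable def crosscutIndex (TA TB : C(I, ℂ)) (z : ℂ) : ℝ :=
  (argChange TB z - argChange TA z + segArg (TA 0) (TB 0) z +
    (Complex.I * (TA 1 - z)).arg - (Complex.I * (TB 1 - z)).arg) / (2 * Real.pi)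

theorem I_mul_sub_mem_slitPlane {a z : ℂ} (ha : a.im = 0) (hz : 0 ≤ z.im) (h : z ≠ a) :
    Complex.I * (a - z) ∈ Complex.slitPlane := by
  rw [Complex.mem_slitPlane_iff]
  by_contra! h'
  simp [ha] at h'
  exact h (Complex.ext (by linarith) (by linarith))

theorem mem_slitPlane_of_notMem_segment {A B z : ℂ} (h : z ∉ segment ℝ A B) :
    (B - z) / (A - z) ∈ Complex.slitPlane := by
  have hA : A - z ≠ 0 := sub_ne_zero.mpr fun e => h (e ▸ left_mem_segment ℝ A B)
  by_contra hs
  rw [Complex.mem_slitPlane_iff, not_or, not_lt, not_not] at hs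
  set r := -((B - z) / (A - z)).re with hr
  have hr0 : 0 ≤ r := by linarith [hs.1]
  have e : (B - z) / (A - z) = -(r : ℂ) := Complex.ext (by simp [hr]) (by simp [hs.2])
  rw [div_eq_iff hA] at e
  apply h
  refine ⟨r / (1 + r), 1 / (1 + r), by positivity, by positivity, by field_simp; ring, ?_⟩
  have h1 : (1 + r : ℂ) ≠ 0 := by
    intro h0
    have := congrArg Complex.re h0
    simp at this
    linarith
  rw [Complex.real_smul, Complex.real_smul]
  push_cast
  field_simp
  linear_combination e

variable {TA TB : C(I, ℂ)}

/-- The loop is closed: the quotients of endpoints over its four pieces have product 1, so the total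
logarithm is a multiple of 2πi. -/
theorem exists_int_crosscutIndex {z : ℂ} (hzA : z ∉ Set.range TA) (hzB : z ∉ Set.range TB) :
    ∃ n : ℤ, crosscutIndex TA TB z = n := by
  obtain ⟨L, hL⟩ := exists_log_path_sub hzA
  obtain ⟨M, hM⟩ := exists_log_path_sub hzB
  have hA0 : TA 0 - z ≠ 0 := sub_ne_zero.mpr fun e => hzA ⟨0, e⟩
  have hB0 : TB 0 - z ≠ 0 := sub_ne_zero.mpr fun e => hzB ⟨0, e⟩
  have hA1 : TA 1 - z ≠ 0 := sub_ne_zero.mpr fun e => hzA ⟨1, e⟩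
  have hB1 : TB 1 - z ≠ 0 := sub_ne_zero.mpr fun e => hzB ⟨1, e⟩
  have key : Complex.exp ((M 1 - M 0) - (L 1 - L 0) +
      Complex.log ((TB 0 - z) / (TA 0 - z)) + Complex.log (Complex.I * (TA 1 - z)) -
      Complex.log (Complex.I * (TB 1 - z))) = 1 := by
    rw [Complex.exp_sub, Complex.exp_add, Complex.exp_add, Complex.exp_sub, Complex.exp_sub,
      Complex.exp_sub, hL, hL, hM, hM, Complex.exp_log (div_ne_zero hB0 hA0),
      Complex.exp_log (mul_ne_zero Complex.I_ne_zero hA1),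
      Complex.exp_log (mul_ne_zero Complex.I_ne_zero hB1)]
    have := Complex.I_ne_zero
    field_simp
  obtain ⟨n, hn⟩ := Complex.exp_eq_one_iff.mp key
  refine ⟨n, ?_⟩
  have h1 := congrArg Complex.im hn
  simp only [Complex.add_im, Complex.sub_im, Complex.log_im] at h1
  rw [crosscutIndex, argChange_eq hL, argChange_eq hM, segArg, div_eq_iff (by positivity)]
  simp only [Complex.sub_im]
  have h2 : ((n : ℂ) * (2 * Real.pi * Complex.I)).im = n * (2 * Real.pi) := by
    simp
  rw [h2] at h1
  exact h1

/-- Only the angle of the segment jumps. The factor I places the branch cut so that the angles of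
the real endpoints are continuous from the closed upper half-plane; the index thus extends to the
real axis by its values from above. -/
theorem continuousAt_crosscutIndex_sub (hA : (TA 1).im = 0) (hB : (TB 1).im = 0) {z : ℂ}
    (hz : 0 ≤ z.im) (hzA : z ∉ Set.range TA) (hzB : z ∉ Set.range TB) :
    ContinuousAt (fun z => crosscutIndex TA TB z - segArg (TA 0) (TB 0) z / (2 * Real.pi)) z := by
  have h1 : ∀ T : C(I, ℂ), (T 1).im = 0 → z ∉ Set.range T →
      ContinuousAt (fun z => (Complex.I * (T 1 - z)).arg) z := fun T hT hzT =>
    ContinuousAt.comp (g := Complex.arg) (Complex.continuousAt_arg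
      (I_mul_sub_mem_slitPlane hT hz fun e => hzT ⟨1, e.symm⟩)) (by fun_prop)
  have h2 := ((((continuousAt_argChange hzB).sub (continuousAt_argChange hzA)).add
    (h1 TA hA hzA)).sub (h1 TB hB hzB)).div_const (2 * Real.pi)
  refine h2.congr (Filter.Eventually.of_forall fun w => ?_)
  simp only [crosscutIndex, Pi.add_apply, Pi.sub_apply]
  ring

theorem continuousAt_crosscutIndex (hA : (TA 1).im = 0) (hB : (TB 1).im = 0) {z : ℂ}
    (hz : 0 ≤ z.im) (hzA : z ∉ Set.range TA) (hzB : z ∉ Set.range TB)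
    (hs : z ∉ segment ℝ (TA 0) (TB 0)) : ContinuousAt (crosscutIndex TA TB) z := by
  have h1 : ContinuousAt (fun z => segArg (TA 0) (TB 0) z / (2 * Real.pi)) z := by
    refine ContinuousAt.div_const ?_ _
    refine ContinuousAt.comp (g := Complex.arg)
      (Complex.continuousAt_arg (mem_slitPlane_of_notMem_segment hs)) ?_
    exact ContinuousAt.div (by fun_prop) (by fun_prop) (sub_ne_zero.mpr fun e => hzA ⟨0, e⟩)
  have := (continuousAt_crosscutIndex_sub hA hB hz hzA hzB).add h1
  refine this.congr (Filter.Eventually.of_forall fun w => ?_)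
  simp only [Pi.add_apply, sub_add_cancel]

/-- Seen from a real point, everything lies in a closed half-plane. The angles along the two paths
and the segment telescope, and only the directions ±π/2 of the real endpoints remain. -/
theorem crosscutIndex_ofReal (hTA : ∀ x, 0 ≤ (TA x).im) (hTB : ∀ x, 0 ≤ (TB x).im)
    (hA0 : 0 < (TA 0).im) (hB0 : 0 < (TB 0).im) {a b p : ℝ}
    (ha : TA 1 = a) (hb : TB 1 = b) (hpA : (p : ℂ) ∉ Set.range TA) (hpB : (p : ℂ) ∉ Set.range TB) :
    crosscutIndex TA TB p = (SignType.sign (a - p) - SignType.sign (b - p) : ℝ) / 2 := by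
  have hpa : a - p ≠ 0 := fun e => hpA ⟨1, by rw [ha, sub_eq_zero.mp e]⟩
  have hpb : b - p ≠ 0 := fun e => hpB ⟨1, by rw [hb, sub_eq_zero.mp e]⟩
  have hs : segArg (TA 0) (TB 0) p =
      (-Complex.I * (TB 0 - p)).arg - (-Complex.I * (TA 0 - p)).arg := by
    have hre : ∀ w : ℂ, 0 < w.im → |(-Complex.I * (w - p)).arg| < Real.pi / 2 := fun w hw =>
      Complex.abs_arg_lt_pi_div_two_iff.mpr (Or.inl (by simpa using hw))
    have hA := abs_lt.mp (hre _ hA0)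
    have hB := abs_lt.mp (hre _ hB0)
    have hne : ∀ w : ℂ, 0 < w.im → -Complex.I * (w - p) ≠ 0 := fun w hw h => by
      have := congrArg Complex.re h
      simp at this
      linarith
    have e : (TB 0 - p) / (TA 0 - p) =
        (-Complex.I * (TB 0 - p)) * (-Complex.I * (TA 0 - p))⁻¹ := by
      rw [mul_inv, mul_mul_mul_comm, mul_inv_cancel₀ (neg_ne_zero.mpr Complex.I_ne_zero), one_mul,
        div_eq_mul_inv]
    have hinv : (-Complex.I * (TA 0 - p))⁻¹.arg = -(-Complex.I * (TA 0 - p)).arg := by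
      rw [Complex.arg_inv, if_neg]
      intro h
      linarith [Real.pi_pos]
    rw [segArg, e, Complex.arg_mul (hne _ hB0) (inv_ne_zero (hne _ hA0)) ?_, hinv, ← sub_eq_add_neg]
    rw [hinv]
    constructor <;> linarith
  have h1 : ∀ x : ℝ, x ≠ 0 → (-Complex.I * (x : ℂ)).arg = -(SignType.sign x : ℝ) * (Real.pi / 2) ∧
      (Complex.I * (x : ℂ)).arg = (SignType.sign x : ℝ) * (Real.pi / 2) := by
    intro x hx
    rcases hx.lt_or_gt with h | h
    · have e1 : -Complex.I * (x : ℂ) = ((-x : ℝ) : ℂ) * Complex.I := by push_cast; ring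
      have e2 : Complex.I * (x : ℂ) = ((-x : ℝ) : ℂ) * (-Complex.I) := by push_cast; ring
      rw [e1, e2, Complex.arg_real_mul _ (neg_pos.mpr h), Complex.arg_real_mul _ (neg_pos.mpr h),
        Complex.arg_I, Complex.arg_neg_I, sign_neg h]
      simp
    · rw [mul_comm (-Complex.I), mul_comm Complex.I, Complex.arg_real_mul _ h,
        Complex.arg_real_mul _ h, Complex.arg_I, Complex.arg_neg_I, sign_pos h]
      simp
  rw [crosscutIndex, argChange_ofReal hTA hpA, argChange_ofReal hTB hpB, hs, ha, hb]
  have h2 := h1 _ hpa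
  have h3 := h1 _ hpb
  push_cast at h2 h3
  rw [h2.1, h2.2, h3.1, h3.2]
  field_simp
  ring


theorem IsPreconnected.eq_of_int_valued {X : Type*} [TopologicalSpace X] {s : Set X}
    (hs : IsPreconnected s) {f : X → ℝ} (hf : ContinuousOn f s) (hi : ∀ x ∈ s, ∃ n : ℤ, f x = n)
    {x y : X} (hx : x ∈ s) (hy : y ∈ s) : f x = f y := by
  by_contra hne
  wlog h : f x < f y generalizing x y
  · exact this hy hx (Ne.symm hne) (lt_of_le_of_ne (not_lt.mp h) (Ne.symm hne))
  have h1 := (hs.image f hf).Icc_subset ⟨x, hx, rfl⟩ ⟨y, hy, rfl⟩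
  obtain ⟨m, hm⟩ := hi x hx
  obtain ⟨n, hn⟩ := hi y hy
  have hmn : m + 1 ≤ n := by
    have : (m : ℝ) < n := by rw [← hm, ← hn]; exact h
    exact_mod_cast this
  have hmn' : (m : ℝ) + 1 ≤ n := by exact_mod_cast hmn
  obtain ⟨z, hz, hzf⟩ := h1 (show f x + 1 / 2 ∈ Set.Icc (f x) (f y) from
    ⟨by linarith, by rw [hm, hn]; linarith⟩)
  obtain ⟨k, hk⟩ := hi z hz
  rw [hk, hm] at hzf
  have h2 : ((2 * (k - m) : ℤ) : ℝ) = 1 := by push_cast; linarith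
  have h3 : 2 * (k - m) = 1 := by exact_mod_cast h2
  omega

/-- The index is constant along the paths which avoid the crosscut. -/
theorem crosscutIndex_eq_of_isPreconnected (hA : (TA 1).im = 0) (hB : (TB 1).im = 0) {s : Set ℂ}
    (hs : IsPreconnected s) (him : ∀ z ∈ s, 0 ≤ z.im) (hsA : ∀ z ∈ s, z ∉ Set.range TA)
    (hsB : ∀ z ∈ s, z ∉ Set.range TB) (hsg : ∀ z ∈ s, z ∉ segment ℝ (TA 0) (TB 0)) {x y : ℂ}
    (hx : x ∈ s) (hy : y ∈ s) : crosscutIndex TA TB x = crosscutIndex TA TB y :=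
  hs.eq_of_int_valued (fun z hz => (continuousAt_crosscutIndex hA hB (him z hz) (hsA z hz)
    (hsB z hz) (hsg z hz)).continuousWithinAt)
    (fun z hz => exists_int_crosscutIndex (hsA z hz) (hsB z hz)) hx hy

/-- The index decreases by one when the segment is crossed from left to right. -/
theorem crosscutIndex_jump (hA : (TA 1).im = 0) (hB : (TB 1).im = 0) {f : ℝ → ℂ} {t₀ : ℝ}
    (hf : ContinuousAt f t₀) (him : 0 ≤ (f t₀).im) (hfA : f t₀ ∉ Set.range TA)
    (hfB : f t₀ ∉ Set.range TB) (hre : ((TB 0 - f t₀) / (TA 0 - f t₀)).re < 0)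
    (him0 : ((TB 0 - f t₀) / (TA 0 - f t₀)).im = 0)
    (hl : ∀ᶠ t in 𝓝[<] t₀, 0 ≤ ((TB 0 - f t) / (TA 0 - f t)).im)
    (hr : ∀ᶠ t in 𝓝[>] t₀, ((TB 0 - f t) / (TA 0 - f t)).im < 0) :
    ∃ ε > 0, ∀ t ∈ Set.Ioo (t₀ - ε) t₀, ∀ t' ∈ Set.Ioo t₀ (t₀ + ε),
      crosscutIndex TA TB (f t) = crosscutIndex TA TB (f t') + 1 := by
  set g : ℂ → ℝ := fun z => crosscutIndex TA TB z - segArg (TA 0) (TB 0) z / (2 * Real.pi) with hg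
  have hgc : ContinuousAt (fun t => g (f t)) t₀ :=
    ContinuousAt.comp (g := g) (continuousAt_crosscutIndex_sub hA hB him hfA hfB) hf
  have hq : ContinuousAt (fun t => (TB 0 - f t) / (TA 0 - f t)) t₀ :=
    ContinuousAt.div (continuousAt_const.sub hf) (continuousAt_const.sub hf)
      (sub_ne_zero.mpr fun e => hfA ⟨0, e⟩)
  have hpi := Real.pi_pos
  have hL : Filter.Tendsto (fun t => crosscutIndex TA TB (f t))
      (𝓝[<] t₀) (𝓝 (g (f t₀) + 1 / 2)) := by
    have h1 := (Complex.tendsto_arg_nhdsWithin_im_nonneg_of_re_neg_of_im_zero hre him0).comp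
      (tendsto_nhdsWithin_iff.mpr ⟨hq.tendsto.mono_left nhdsWithin_le_nhds, hl⟩)
    have h2 := (hgc.tendsto.mono_left (nhdsWithin_le_nhds (s := Set.Iio t₀))).add
      (h1.div_const (2 * Real.pi))
    refine (h2.congr fun t => ?_).trans_eq ?_
    · simp [hg, segArg]
    · congr 2
      field_simp
  have hR : Filter.Tendsto (fun t => crosscutIndex TA TB (f t))
      (𝓝[>] t₀) (𝓝 (g (f t₀) - 1 / 2)) := by
    have h1 := (Complex.tendsto_arg_nhdsWithin_im_neg_of_re_neg_of_im_zero hre him0).comp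
      (tendsto_nhdsWithin_iff.mpr ⟨hq.tendsto.mono_left nhdsWithin_le_nhds, hr⟩)
    have h2 := (hgc.tendsto.mono_left (nhdsWithin_le_nhds (s := Set.Ioi t₀))).add
      (h1.div_const (2 * Real.pi))
    refine (h2.congr fun t => ?_).trans_eq ?_
    · simp [hg, segArg]
    · congr 2
      field_simp
  have hint : ∀ᶠ t in 𝓝 t₀, ∃ n : ℤ, crosscutIndex TA TB (f t) = n := by
    have hcl : ∀ T : C(I, ℂ), f t₀ ∉ Set.range T → ∀ᶠ t in 𝓝 t₀, f t ∉ Set.range T := fun T hT =>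
      hf.eventually ((isCompact_range T.continuous).isClosed.isOpen_compl.mem_nhds hT)
    filter_upwards [hcl TA hfA, hcl TB hfB] with t h1 h2
    exact exists_int_crosscutIndex h1 h2
  -- The principal argument passes from π to -π, so the one-sided limits differ by 1. Values within
  -- 1/4 of these limits differ by an amount strictly between 0 and 2, hence by 1 since they are
  -- integers.
  have hL' := (hL.eventually (Metric.ball_mem_nhds _ (show (0 : ℝ) < 1 / 4 by norm_num))).and
    (hint.filter_mono nhdsWithin_le_nhds)
  have hR' := (hR.eventually (Metric.ball_mem_nhds _ (show (0 : ℝ) < 1 / 4 by norm_num))).and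
    (hint.filter_mono nhdsWithin_le_nhds)
  obtain ⟨a, ha, hLa⟩ := mem_nhdsLT_iff_exists_Ioo_subset.mp hL'
  obtain ⟨b, hb, hRb⟩ := mem_nhdsGT_iff_exists_Ioo_subset.mp hR'
  have ha' : a < t₀ := ha
  have hb' : t₀ < b := hb
  refine ⟨min (t₀ - a) (b - t₀), lt_min (sub_pos.mpr ha') (sub_pos.mpr hb'), ?_⟩
  intro t ht t' ht'
  have h1 := min_le_left (t₀ - a) (b - t₀)
  have h2 := min_le_right (t₀ - a) (b - t₀)
  obtain ⟨hd, m, hm⟩ := hLa (show t ∈ Set.Ioo a t₀ from ⟨by linarith [ht.1], ht.2⟩)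
  obtain ⟨hd', n, hn⟩ := hRb (show t' ∈ Set.Ioo t₀ b from ⟨ht'.1, by linarith [ht'.2]⟩)
  rw [Real.dist_eq, hm, abs_lt] at hd
  rw [Real.dist_eq, hn, abs_lt] at hd'
  rw [hm, hn]
  have h3 : ((m - n : ℤ) : ℝ) < ((2 : ℤ) : ℝ) := by push_cast; linarith
  have h4 : ((0 : ℤ) : ℝ) < ((m - n : ℤ) : ℝ) := by push_cast; linarith
  have h5 : m - n < 2 := by exact_mod_cast h3
  have h6 : 0 < m - n := by exact_mod_cast h4
  have : m = n + 1 := by omega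
  rw [this]
  push_cast
  ring

/-! ### Cyclic order of the ends of a planar graph -/

/-- The real point `p` is a limit of points which can be reached from `e` within `H`. -/
def ReachesEnd (H : Set ℂ) (e : ℂ) (p : ℝ) : Prop :=
  ∃ V : ℕ → ℂ, Filter.Tendsto V Filter.atTop (𝓝 (p : ℂ)) ∧ ∀ n, JoinedIn H e (V n)

theorem ReachesEnd.mono {H H' : Set ℂ} {e : ℂ} {p : ℝ} (h : ReachesEnd H e p) (hH : H ⊆ H') :
    ReachesEnd H' e p := by
  obtain ⟨V, hV, hj⟩ := h
  exact ⟨V, hV, fun n => (hj n).mono hH⟩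

section

variable {G : Set ℂ} {TA TB : C(I, ℂ)}

/-- The tails avoid G and the segment meets G at most at m, so the index is constant along paths in
G minus m; it is continuous at the real limit. -/
theorem ReachesEnd.crosscutIndex_eq (hG : ∀ z ∈ G, 0 < z.im) (hA : (TA 1).im = 0)
    (hB : (TB 1).im = 0) (hTA : ∀ x, TA x ∉ G) (hTB : ∀ x, TB x ∉ G) {m : ℂ}
    (hm : ∀ z ∈ G, z ∈ segment ℝ (TA 0) (TB 0) → z = m) {e : ℂ} {p : ℝ}
    (h : ReachesEnd (G \ {m}) e p) (hA0 : 0 < (TA 0).im) (hB0 : 0 < (TB 0).im)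
    (hpA : (p : ℂ) ∉ Set.range TA) (hpB : (p : ℂ) ∉ Set.range TB) :
    crosscutIndex TA TB p = crosscutIndex TA TB e := by
  obtain ⟨V, hV, hj⟩ := h
  have h1 : ∀ n, crosscutIndex TA TB e = crosscutIndex TA TB (V n) := by
    intro n
    obtain ⟨γ, hγ⟩ := hj n
    refine crosscutIndex_eq_of_isPreconnected hA hB (s := Set.range γ)
      (isPreconnected_range γ.continuous) ?_ ?_ ?_ ?_ ⟨0, γ.source⟩ ⟨1, γ.target⟩
    · rintro _ ⟨t, rfl⟩
      exact (hG _ (hγ t).1).le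
    · rintro _ ⟨t, rfl⟩ ⟨x, hx⟩
      exact hTA x (hx ▸ (hγ t).1)
    · rintro _ ⟨t, rfl⟩ ⟨x, hx⟩
      exact hTB x (hx ▸ (hγ t).1)
    · rintro _ ⟨t, rfl⟩ hs
      exact (hγ t).2 (hm _ (hγ t).1 hs)
  have hps : (p : ℂ) ∉ segment ℝ (TA 0) (TB 0) := by
    intro hp
    have hc : Convex ℝ {z : ℂ | 0 < z.im} := convex_halfSpace_im_gt 0
    have : 0 < (p : ℂ).im := hc.segment_subset hA0 hB0 hp
    simp at this
  have h2 := (continuousAt_crosscutIndex hA hB (by simp) hpA hpB hps).tendsto.comp hV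
  have h3 : crosscutIndex TA TB ∘ V = fun _ => crosscutIndex TA TB e := by
    funext n
    exact (h1 n).symm
  rw [h3] at h2
  exact tendsto_nhds_unique h2 tendsto_const_nhds |>.symm ▸ rfl

/-- A crosscut which meets `G` at one point, through which one goes from its left to its right. -/
theorem crosscutIndex_step (hG : ∀ z ∈ G, 0 < z.im) (hA : (TA 1).im = 0)
    (hB : (TB 1).im = 0) (hTA : ∀ x, TA x ∉ G) (hTB : ∀ x, TB x ∉ G)
    (hA0 : 0 < (TA 0).im) (hB0 : 0 < (TB 0).im) {f : ℝ → ℂ} {t₁ t₂ τ : ℝ}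
    (hf : ContinuousOn f (Set.Icc t₁ t₂)) (hfG : ∀ t ∈ Set.Icc t₁ t₂, f t ∈ G)
    (hτ : τ ∈ Set.Ioo t₁ t₂) (hinj : ∀ t ∈ Set.Icc t₁ t₂, f t = f τ → t = τ)
    (hm : ∀ z ∈ G, z ∈ segment ℝ (TA 0) (TB 0) → z = f τ)
    (hre : ((TB 0 - f τ) / (TA 0 - f τ)).re < 0)
    (him0 : ((TB 0 - f τ) / (TA 0 - f τ)).im = 0)
    (hl : ∀ᶠ t in 𝓝[<] τ, 0 ≤ ((TB 0 - f t) / (TA 0 - f t)).im)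
    (hr : ∀ᶠ t in 𝓝[>] τ, ((TB 0 - f t) / (TA 0 - f t)).im < 0) {p₁ p₃ : ℝ}
    (h₁ : ReachesEnd (G \ {f τ}) (f t₂) p₁) (h₃ : ReachesEnd (G \ {f τ}) (f t₁) p₃)
    (h₁A : (p₁ : ℂ) ∉ Set.range TA) (h₁B : (p₁ : ℂ) ∉ Set.range TB)
    (h₃A : (p₃ : ℂ) ∉ Set.range TA) (h₃B : (p₃ : ℂ) ∉ Set.range TB) :
    crosscutIndex TA TB p₃ = crosscutIndex TA TB p₁ + 1 := by
  rw [h₁.crosscutIndex_eq hG hA hB hTA hTB hm hA0 hB0 h₁A h₁B,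
    h₃.crosscutIndex_eq hG hA hB hTA hTB hm hA0 hB0 h₃A h₃B]
  have hτG := hfG τ ⟨hτ.1.le, hτ.2.le⟩
  obtain ⟨ε, hε, hjump⟩ := crosscutIndex_jump hA hB (hf.continuousAt (Icc_mem_nhds hτ.1 hτ.2))
    (hG _ hτG).le (fun ⟨x, hx⟩ => hTA x (hx ▸ hτG)) (fun ⟨x, hx⟩ => hTB x (hx ▸ hτG)) hre him0 hl hr
  have hconst : ∀ a b, t₁ ≤ a → a ≤ b → b ≤ t₂ → τ ∉ Set.Icc a b →
      crosscutIndex TA TB (f a) = crosscutIndex TA TB (f b) := by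
    intro a b ha hab hb hτab
    have hsub : Set.Icc a b ⊆ Set.Icc t₁ t₂ := Set.Icc_subset_Icc ha hb
    refine crosscutIndex_eq_of_isPreconnected hA hB (s := f '' Set.Icc a b)
      (isPreconnected_Icc.image f (hf.mono hsub)) ?_ ?_ ?_ ?_
      ⟨a, ⟨le_rfl, hab⟩, rfl⟩ ⟨b, ⟨hab, le_rfl⟩, rfl⟩
    · rintro _ ⟨t, ht, rfl⟩
      exact (hG _ (hfG t (hsub ht))).le
    · rintro _ ⟨t, ht, rfl⟩ ⟨x, hx⟩
      exact hTA x (hx ▸ hfG t (hsub ht))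
    · rintro _ ⟨t, ht, rfl⟩ ⟨x, hx⟩
      exact hTB x (hx ▸ hfG t (hsub ht))
    · rintro _ ⟨t, ht, rfl⟩ hs
      have := hinj t (hsub ht) (hm _ (hfG t (hsub ht)) hs)
      exact hτab (this ▸ ht)
  obtain ⟨a, ha1, ha2⟩ := exists_between (max_lt hτ.1 (show τ - ε < τ by linarith))
  obtain ⟨b, hb1, hb2⟩ := exists_between (lt_min hτ.2 (show τ < τ + ε by linarith))
  rw [hconst t₁ a le_rfl ((le_max_left _ _).trans ha1.le) (ha2.le.trans hτ.2.le)
    (fun h => absurd h.2 (not_le.mpr ha2)),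
    ← hconst b t₂ (hτ.1.le.trans hb1.le) (hb2.le.trans (min_le_left _ _)) le_rfl
    (fun h => absurd h.1 (not_le.mpr hb1))]
  exact hjump a ⟨(le_max_right _ _).trans_lt ha1, ha2⟩ b ⟨hb1, hb2.trans_le (min_le_right _ _)⟩

end

/-- Strict differentiability traps the strand in a thin cone around its tangent and makes it
monotone in the tangent coordinate. -/
theorem exists_strand_control {f : ℝ → ℂ} {v : ℂ} {t₀ : ℝ} (hf : HasStrictDerivAt f v t₀)
    (X Z : ℂ →L[ℝ] ℝ) (hX : X v = 1) (hZ : Z v = 0) :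
    ∃ δ > 0, (∀ s t, |s - t₀| < δ → |t - t₀| < δ → s < t → (t - s) / 2 ≤ X (f t) - X (f s)) ∧
      ∀ t, |t - t₀| < δ → |Z (f t) - Z (f t₀)| ≤ |X (f t) - X (f t₀)| / 3 := by
  have h1 : ∀ W : ℂ →L[ℝ] ℝ, ∃ δ > 0, ∀ s t, |s - t₀| < δ → |t - t₀| < δ →
      |W (f t) - W (f s) - (t - s) * W v| ≤ 1 / 4 * |t - s| := by
    intro W
    have hW : HasStrictDerivAt (fun t => W (f t)) (W v) t₀ := 
      W.hasStrictFDerivAt.comp_hasStrictDerivAt t₀ hf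
    -- With relative error 1/4, the speed of X is at least 3/4 ≥ 1/2, and the slope of Z against X
    -- is at most (1/4)/(3/4) = 1/3.
    have h2 := hW.hasStrictFDerivAt.isLittleO.bound (show (0 : ℝ) < 1 / 4 by norm_num)
    obtain ⟨δ, hδ, hb⟩ := Metric.eventually_nhds_iff_ball.mp h2
    refine ⟨δ, hδ, fun s t hs ht => ?_⟩
    have := hb (t, s) (by
      rw [← ball_prod_same]
      exact ⟨by simpa [Real.dist_eq] using ht, by simpa [Real.dist_eq] using hs⟩)
    simpa [Real.norm_eq_abs] using this
  obtain ⟨δ, hδ, h2⟩ := h1 X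
  obtain ⟨δ', hδ', h3⟩ := h1 Z
  refine ⟨min δ δ', lt_min hδ hδ', fun s t hs ht hst => ?_, fun t ht => ?_⟩
  · have := h2 s t (hs.trans_le (min_le_left _ _)) (ht.trans_le (min_le_left _ _))
    rw [hX, abs_of_pos (sub_pos.mpr hst), abs_le] at this
    linarith [this.1]
  · have h4 := h2 t₀ t (by simpa using hδ) (ht.trans_le (min_le_left _ _))
    have h5 := h3 t₀ t (by simpa using hδ') (ht.trans_le (min_le_right _ _))
    rw [hX, mul_one] at h4
    rw [hZ, mul_zero, sub_zero] at h5
    have h6 : |t - t₀| ≤ |X (f t) - X (f t₀)| + |X (f t) - X (f t₀) - (t - t₀)| := by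
      have := abs_sub_abs_le_abs_sub (t - t₀) (X (f t) - X (f t₀))
      rw [abs_sub_comm (t - t₀) (X (f t) - X (f t₀))] at this
      linarith
    linarith


/-- Here r, s, l are the real ends of three successive tails. The hypotheses say how the crosscuts
(r, s) and (s, l) separate p₃ from p₁ and from p₂, with orientation. A finite check on the signs
concludes. -/
theorem cyclic_order_of_sign {r s l p₁ p₂ p₃ : ℝ} (hs1 : s ≠ p₁) (hs2 : s ≠ p₂) (hs3 : s ≠ p₃) (hr1 : r ≠ p₁) (hr3 : r ≠ p₃) (hl2 : l ≠ p₂) (hl3 : l ≠ p₃)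
    (h1 : (SignType.sign (r - p₃) - SignType.sign (s - p₃) : ℝ) / 2 =
      (SignType.sign (r - p₁) - SignType.sign (s - p₁) : ℝ) / 2 + 1)
    (h2 : (SignType.sign (s - p₃) - SignType.sign (l - p₃) : ℝ) / 2 =
      (SignType.sign (s - p₂) - SignType.sign (l - p₂) : ℝ) / 2 + 1) :
    0 < (p₁ - p₂) * (p₂ - p₃) * (p₃ - p₁) := by
  have hsgn : ∀ x p : ℝ, x ≠ p → (p < x ∧ (SignType.sign (x - p) : ℝ) = 1) ∨
      (x < p ∧ (SignType.sign (x - p) : ℝ) = -1) := by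
    intro x p h
    rcases h.lt_or_gt with h | h
    · exact Or.inr ⟨h, by rw [sign_neg (sub_neg.mpr h)]; simp⟩
    · exact Or.inl ⟨h, by rw [sign_pos (sub_pos.mpr h)]; simp⟩
  have key : (p₁ < p₂ ∧ p₂ < p₃) ∨ (p₂ < p₃ ∧ p₃ < p₁) ∨ (p₃ < p₁ ∧ p₁ < p₂) := by
    rcases hsgn s p₁ hs1 with ⟨a1, e1⟩ | ⟨a1, e1⟩ <;> rcases hsgn s p₂ hs2 with ⟨a2, e2⟩ | ⟨a2, e2⟩ <;>
    rcases hsgn s p₃ hs3 with ⟨a3, e3⟩ | ⟨a3, e3⟩ <;> rw [e1, e3] at h1 <;> rw [e2, e3] at h2 <;>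
    rcases hsgn r p₁ hr1 with ⟨b1, e4⟩ | ⟨b1, e4⟩ <;> rcases hsgn r p₃ hr3 with ⟨b3, e5⟩ | ⟨b3, e5⟩ <;>
    rw [e4, e5] at h1 <;> norm_num at h1 <;>
    rcases hsgn l p₂ hl2 with ⟨b2, e6⟩ | ⟨b2, e6⟩ <;> rcases hsgn l p₃ hl3 with ⟨c3, e7⟩ | ⟨c3, e7⟩ <;>
    rw [e6, e7] at h2 <;> norm_num at h2 <;>
    first
      | exact Or.inl ⟨by linarith, by linarith⟩
      | exact Or.inr (Or.inl ⟨by linarith, by linarith⟩)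
      | exact Or.inr (Or.inr ⟨by linarith, by linarith⟩)
  rcases key with ⟨h, h'⟩ | ⟨h, h'⟩ | ⟨h, h'⟩
  · exact mul_pos (mul_pos_of_neg_of_neg (by linarith) (by linarith)) (by linarith)
  · exact mul_pos_of_neg_of_neg (mul_neg_of_pos_of_neg (by linarith) (by linarith)) (by linarith)
  · exact mul_pos_of_neg_of_neg (mul_neg_of_neg_of_pos (by linarith) (by linarith)) (by linarith)

set_option maxHeartbeats 1000000 in
/-- Two strands of `G` cross at `o`, the second one from the right of the first one to its left. If
the points of the complement of `G` can be joined to the real axis, then an end reached through the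
first outgoing edge, an end reached through the second one, and an end reached through none of
these are in the cyclic order of the boundary of the upper half-plane. -/
theorem cyclic_order_of_strands {G : Set ℂ} (hG : ∀ z ∈ G, 0 < z.im) {o v₁ v₂ : ℂ}
    (hv : 0 < (conj v₁ * v₂).im) {f₁ f₂ : ℝ → ℂ} {t₁ t₂ T₁ T₂ : ℝ} (ht₁ : t₁ < T₁) (ht₂ : t₂ < T₂)
    (ho₁ : f₁ t₁ = o) (ho₂ : f₂ t₂ = o) (hd₁ : HasStrictDerivAt f₁ v₁ t₁)
    (hd₂ : HasStrictDerivAt f₂ v₂ t₂)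
    (hloc : ∀ δ > 0, ∀ᶠ z in 𝓝 o, z ∈ G →
      (∃ t, |t - t₁| < δ ∧ f₁ t = z) ∨ ∃ t, |t - t₂| < δ ∧ f₂ t = z)
    (hc₁ : Continuous f₁) (hc₂ : Continuous f₂) (hG₁ : ∀ t, f₁ t ∈ G) (hG₂ : ∀ t, f₂ t ∈ G)
    (hi₁ : ∀ t ∈ Set.Ioo t₁ T₁, ∀ t' ∈ Set.Icc t₁ T₁, f₁ t' = f₁ t → t' = t)
    (hi₂ : ∀ t ∈ Set.Ioo t₂ T₂, ∀ t' ∈ Set.Icc t₂ T₂, f₂ t' = f₂ t → t' = t)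
    (htail : ∀ᶠ z in 𝓝 o, z ∉ G → ∀ F : Finset ℝ, ∃ T : C(I, ℂ), T 0 = z ∧ (T 1).im = 0 ∧
      ∀ x, 0 ≤ (T x).im ∧ T x ∉ G ∧ ∀ p ∈ F, T x ≠ p)
    {p₁ p₂ p₃ : ℝ}
    (h₁ : ReachesEnd (G \ f₁ '' Set.Ioo t₁ T₁) (f₁ T₁) p₁)
    (h₂ : ReachesEnd (G \ f₂ '' Set.Ioo t₂ T₂) (f₂ T₂) p₂)
    (h₃ : ReachesEnd (G \ (f₁ '' Set.Ioo t₁ T₁ ∪ f₂ '' Set.Ioo t₂ T₂)) o p₃) :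
    0 < (p₁ - p₂) * (p₂ - p₃) * (p₃ - p₁) := by
  set D := (conj v₁ * v₂).im with hD
  have hD' : D = v₁.re * v₂.im - v₁.im * v₂.re := by
    rw [hD]; simp; ring
  -- X and Z are the coordinates in the basis (v₁, v₂), so the strands are nearly the coordinate
  -- axes at o.
  obtain ⟨X, hX⟩ : ∃ X : ℂ →L[ℝ] ℝ, ∀ z, X z = (z.re * v₂.im - z.im * v₂.re) / D :=
    ⟨(-1 / D) • Complex.imCLM.comp (ContinuousLinearMap.mul ℝ ℂ (conj v₂)), fun z => by
      simp; ring⟩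
  obtain ⟨Z, hZ⟩ : ∃ Z : ℂ →L[ℝ] ℝ, ∀ z, Z z = (v₁.re * z.im - v₁.im * z.re) / D :=
    ⟨(1 / D) • Complex.imCLM.comp (ContinuousLinearMap.mul ℝ ℂ (conj v₁)), fun z => by
      simp; ring⟩
  have hX1 : X v₁ = 1 := by rw [hX, ← hD', div_self hv.ne']
  have hX2 : X v₂ = 0 := by rw [hX]; ring
  have hZ1 : Z v₁ = 0 := by rw [hZ]; ring
  have hZ2 : Z v₂ = 1 := by rw [hZ, ← hD', div_self hv.ne']
  have hdec : ∀ z : ℂ, z = X z * v₁ + Z z * v₂ := by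
    intro z
    rw [hX, hZ]
    apply Complex.ext
    · simp
      field_simp
      rw [hD']
      ring
    · simp
      field_simp
      rw [hD']
      ring
  have hext : ∀ z w : ℂ, X z = X w → Z z = Z w → z = w := fun z w h h' => by
    rw [hdec z, hdec w, h, h']
  have him : ∀ a b : ℂ, (b / a).im = D * (X a * Z b - Z a * X b) / Complex.normSq a := by
    intro a b
    rw [hX, hX, hZ, hZ, Complex.div_im]
    have : D ≠ 0 := hv.ne'
    field_simp
    rw [hD']
    ring
  obtain ⟨δ₁, hδ₁, mono₁, cone₁⟩ := exists_strand_control hd₁ X Z hX1 hZ1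
  obtain ⟨δ₂, hδ₂, mono₂, cone₂⟩ := exists_strand_control hd₂ Z X hZ2 hX2
  rw [ho₁] at cone₁
  rw [ho₂] at cone₂
  set δ := min (min δ₁ δ₂) (min (T₁ - t₁) (T₂ - t₂)) with hδ
  have hδ0 : 0 < δ := lt_min (lt_min hδ₁ hδ₂) (lt_min (sub_pos.mpr ht₁) (sub_pos.mpr ht₂))
  have hδ1 : δ ≤ δ₁ := (min_le_left _ _).trans (min_le_left _ _)
  have hδ2 : δ ≤ δ₂ := (min_le_left _ _).trans (min_le_right _ _)
  have hδ3 : δ ≤ T₁ - t₁ := (min_le_right _ _).trans (min_le_left _ _)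
  have hδ4 : δ ≤ T₂ - t₂ := (min_le_right _ _).trans (min_le_right _ _)
  have hoim : 0 < o.im := hG o (ho₁ ▸ hG₁ t₁)
  obtain ⟨ε, hε, hball⟩ := Metric.eventually_nhds_iff_ball.mp (((hloc δ hδ0).and htail).and
    (Complex.continuous_im.continuousAt.eventually (lt_mem_nhds hoim)))
  -- The box of half-size ρ lies in the good ball. At speed at least 1/2, each strand reaches level
  -- ρ before time δ/2, whence δ/4.
  obtain ⟨ρ, hρ0, hρε, hρδ⟩ : ∃ ρ : ℝ, 0 < ρ ∧ ρ * (‖v₁‖ + ‖v₂‖) < ε ∧ ρ < δ / 4 := by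
    have hn : 0 ≤ ‖v₁‖ + ‖v₂‖ := by positivity
    refine ⟨min (ε / (‖v₁‖ + ‖v₂‖ + 1)) (δ / 4) / 2, by positivity, ?_, ?_⟩
    · have h1 : min (ε / (‖v₁‖ + ‖v₂‖ + 1)) (δ / 4) / 2 ≤ ε / (‖v₁‖ + ‖v₂‖ + 1) / 2 := by
        have := min_le_left (ε / (‖v₁‖ + ‖v₂‖ + 1)) (δ / 4)
        linarith
      refine (mul_le_mul_of_nonneg_right h1 hn).trans_lt ?_
      rw [div_div, div_mul_eq_mul_div, div_lt_iff₀ (by positivity)]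
      nlinarith
    · have h1 := min_le_right (ε / (‖v₁‖ + ‖v₂‖ + 1)) (δ / 4)
      have h2 : 0 < min (ε / (‖v₁‖ + ‖v₂‖ + 1)) (δ / 4) := by positivity
      linarith
  have hbox : ∀ z, |X z - X o| ≤ ρ → |Z z - Z o| ≤ ρ → z ∈ Metric.ball o ε := by
    intro z h h'
    rw [Metric.mem_ball, dist_eq_norm, hdec (z - o), map_sub, map_sub]
    refine (norm_add_le _ _).trans_lt ?_
    rw [norm_mul, norm_mul, Complex.norm_real, Complex.norm_real, Real.norm_eq_abs,
      Real.norm_eq_abs]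
    nlinarith [norm_nonneg v₁, norm_nonneg v₂]
  have hexτ : ∀ (W : ℂ →L[ℝ] ℝ) (f : ℝ → ℂ) (t T : ℝ), Continuous f → f t = o →
      (∀ s s', |s - t| < δ → |s' - t| < δ → s < s' → (s' - s) / 2 ≤ W (f s') - W (f s)) →
      δ ≤ T - t → ∃ τ ∈ Set.Ioo t T, |τ - t| < δ ∧ W (f τ) = W o + ρ := by
    intro W f t T hf ht hm hT
    have h1 := hm t (t + δ / 2) (by simpa using hδ0) (by rw [add_sub_cancel_left, abs_of_pos] <;> linarith)
      (by linarith)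
    rw [ht] at h1
    have h2 := intermediate_value_Icc (show t ≤ t + δ / 2 by linarith)
      ((W.continuous.comp hf).continuousOn (s := Set.Icc t (t + δ / 2)))
    obtain ⟨τ, hτ, he⟩ := h2 (show W o + ρ ∈ Set.Icc ((W ∘ f) t) ((W ∘ f) (t + δ / 2)) from
      ⟨by simp [ht]; linarith, by simp only [Function.comp_apply]; linarith⟩)
    have hne : τ ≠ t := by
      rintro rfl
      simp [ht] at he
      linarith
    have hlt : t < τ := lt_of_le_of_ne hτ.1 (Ne.symm hne)
    exact ⟨τ, ⟨hlt, by linarith [hτ.2]⟩, by rw [abs_of_pos] <;> linarith [hτ.2], he⟩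
  obtain ⟨τ₁, hτ₁, hτδ₁, hXτ₁⟩ := hexτ X f₁ t₁ T₁ hc₁ ho₁
    (fun s s' h h' => mono₁ s s' (h.trans_le hδ1) (h'.trans_le hδ1)) hδ3
  obtain ⟨τ₂, hτ₂, hτδ₂, hZτ₂⟩ := hexτ Z f₂ t₂ T₂ hc₂ ho₂
    (fun s s' h h' => mono₂ s s' (h.trans_le hδ2) (h'.trans_le hδ2)) hδ4
  have hZτ₁ : |Z (f₁ τ₁) - Z o| ≤ ρ / 3 := by
    have := cone₁ τ₁ (hτδ₁.trans_le hδ1)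
    rwa [hXτ₁, add_sub_cancel_left, abs_of_pos hρ0] at this
  have hXτ₂ : |X (f₂ τ₂) - X o| ≤ ρ / 3 := by
    have := cone₂ τ₂ (hτδ₂.trans_le hδ2)
    rwa [hZτ₂, add_sub_cancel_left, abs_of_pos hρ0] at this
  -- On this side of the box the first strand passes once by monotonicity; the second one satisfies
  -- |X - X o| ≤ |Z - Z o|/3 ≤ ρ/3 and cannot reach it.
  have hK₁ : ∀ z ∈ G, X z = X o + ρ → |Z z - Z o| ≤ ρ → z = f₁ τ₁ := by
    intro z hz hXz hZz
    have hzb := hbox z (by rw [hXz, add_sub_cancel_left, abs_of_pos hρ0]) hZz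
    rcases (hball z hzb).1.1 hz with ⟨t, ht, rfl⟩ | ⟨t, ht, rfl⟩
    · rcases lt_trichotomy t τ₁ with h | h | h
      · have := mono₁ t τ₁ (ht.trans_le hδ1) (hτδ₁.trans_le hδ1) h
        linarith
      · rw [h]
      · have := mono₁ τ₁ t (hτδ₁.trans_le hδ1) (ht.trans_le hδ1) h
        linarith
    · have := cone₂ t (ht.trans_le hδ2)
      rw [hXz, add_sub_cancel_left, abs_of_pos hρ0] at this
      linarith
  have hK₂ : ∀ z ∈ G, Z z = Z o + ρ → |X z - X o| ≤ ρ → z = f₂ τ₂ := by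
    intro z hz hZz hXz
    have hzb := hbox z hXz (by rw [hZz, add_sub_cancel_left, abs_of_pos hρ0])
    rcases (hball z hzb).1.1 hz with ⟨t, ht, rfl⟩ | ⟨t, ht, rfl⟩
    · have := cone₁ t (ht.trans_le hδ1)
      rw [hZz, add_sub_cancel_left, abs_of_pos hρ0] at this
      linarith
    · rcases lt_trichotomy t τ₂ with h | h | h
      · have := mono₂ t τ₂ (ht.trans_le hδ2) (hτδ₂.trans_le hδ2) h
        linarith
      · rw [h]
      · have := mono₂ τ₂ t (hτδ₂.trans_le hδ2) (ht.trans_le hδ2) h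
        linarith
  have hpt : ∀ a b : ℝ, ∃ z : ℂ, X z = X o + a ∧ Z z = Z o + b := fun a b =>
    ⟨o + (a : ℝ) • v₁ + (b : ℝ) • v₂, by
      simp only [map_add, map_smul, hX1, hX2, smul_eq_mul]; ring, by
      simp only [map_add, map_smul, hZ1, hZ2, smul_eq_mul]; ring⟩
  have hcorner : ∀ z, |X z - X o| = ρ → |Z z - Z o| = ρ → (X z = X o + ρ ∨ Z z = Z o + ρ) →
      z ∉ G ∧ 0 < z.im ∧ ∃ T : C(I, ℂ), T 0 = z ∧ (T 1).im = 0 ∧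
        ∀ x, 0 ≤ (T x).im ∧ T x ∉ G ∧ ∀ p ∈ ({p₁, p₂, p₃} : Finset ℝ), T x ≠ p := by
    intro z h h' h''
    have hzG : z ∉ G := by
      intro hz
      rcases h'' with h'' | h''
      · have := hK₁ z hz h'' h'.le
        rw [← this, h'] at hZτ₁
        linarith
      · have := hK₂ z hz h'' h.le
        rw [← this, h] at hXτ₂
        linarith
    have hzb := hball z (hbox z h.le h'.le)
    exact ⟨hzG, hzb.2, hzb.1.2 hzG _⟩
  have habs : |ρ| = ρ := abs_of_pos hρ0
  -- In counterclockwise order around o: the corner R, the first outgoing edge, the corner Q, the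
  -- second outgoing edge, the corner A.
  obtain ⟨R, hXR, hZR⟩ := hpt ρ (-ρ)
  obtain ⟨Q, hXQ, hZQ⟩ := hpt ρ ρ
  obtain ⟨A, hXA, hZA⟩ := hpt (-ρ) ρ
  obtain ⟨hRG, hRi, TR, hTR0, hTR1, hTR⟩ := hcorner R (by rw [hXR, add_sub_cancel_left, habs])
    (by rw [hZR, add_sub_cancel_left, abs_neg, habs]) (Or.inl hXR)
  obtain ⟨hQG, hQi, TQ, hTQ0, hTQ1, hTQ⟩ := hcorner Q (by rw [hXQ, add_sub_cancel_left, habs])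
    (by rw [hZQ, add_sub_cancel_left, habs]) (Or.inl hXQ)
  obtain ⟨hAG, hAi, TA, hTA0, hTA1, hTA⟩ := hcorner A
    (by rw [hXA, add_sub_cancel_left, abs_neg, habs])
    (by rw [hZA, add_sub_cancel_left, habs]) (Or.inr hZA)
  have hneg : ∀ (w v m z : ℂ) (a b : ℝ), v ≠ 0 → w - m = a * v → z - m = b * v → a * b < 0 →
      ((z - m) / (w - m)).re < 0 ∧ ((z - m) / (w - m)).im = 0 := by
    intro w v m z a b hv0 hw hz hab
    have ha : a ≠ 0 := by rintro rfl; simp at hab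
    have e : (z - m) / (w - m) = ((b / a : ℝ) : ℂ) := by
      rw [hw, hz, mul_div_mul_right _ _ hv0]
      push_cast
      rfl
    rw [e, Complex.ofReal_re, Complex.ofReal_im]
    refine ⟨?_, rfl⟩
    have : b / a = a * b / a ^ 2 := by field_simp
    rw [this]
    exact div_neg_of_neg_of_pos hab (by positivity)
  have hv₁ : v₁ ≠ 0 := by rintro rfl; simp at hX1
  have hv₂ : v₂ ≠ 0 := by rintro rfl; simp at hZ2
  have hnot : ∀ (T : C(I, ℂ)) (p : ℝ), p ∈ ({p₁, p₂, p₃} : Finset ℝ) →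
      (∀ x, 0 ≤ (T x).im ∧ T x ∉ G ∧ ∀ p ∈ ({p₁, p₂, p₃} : Finset ℝ), T x ≠ p) →
      (p : ℂ) ∉ Set.range T := fun T p hp hT ⟨x, hx⟩ => (hT x).2.2 p hp hx
  have m1 : p₁ ∈ ({p₁, p₂, p₃} : Finset ℝ) := by simp
  have m2 : p₂ ∈ ({p₁, p₂, p₃} : Finset ℝ) := by simp
  have m3 : p₃ ∈ ({p₁, p₂, p₃} : Finset ℝ) := by simp
  -- The first strand crosses RQ from left to right at f₁ τ₁, the only point of G on this segment.
  -- The end p₁ is reached beyond the crossing and p₃ from before it.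
  have step₁ : crosscutIndex TR TQ p₃ = crosscutIndex TR TQ p₁ + 1 := by
    obtain ⟨hre, him0⟩ := hneg R v₂ (f₁ τ₁) Q (-ρ - (Z (f₁ τ₁) - Z o)) (ρ - (Z (f₁ τ₁) - Z o)) hv₂
      (by rw [hdec (R - f₁ τ₁), map_sub, map_sub, hXR, hZR, hXτ₁]; push_cast; ring)
      (by rw [hdec (Q - f₁ τ₁), map_sub, map_sub, hXQ, hZQ, hXτ₁]; push_cast; ring)
      (by have := abs_le.mp hZτ₁; exact mul_neg_of_neg_of_pos (by linarith) (by linarith))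
    have him1 : ∀ t, ((Q - f₁ t) / (R - f₁ t)).im =
        D * ((X (f₁ τ₁) - X (f₁ t)) * (2 * ρ)) / Complex.normSq (R - f₁ t) := by
      intro t
      rw [him, map_sub, map_sub, map_sub, map_sub, hXR, hZR, hXQ, hZQ, hXτ₁]
      ring
    have hnear : ∀ᶠ t in 𝓝 τ₁, |t - t₁| < δ :=
      (continuous_abs.comp (continuous_sub_right t₁)).continuousAt.eventually (gt_mem_nhds hτδ₁)
    refine crosscutIndex_step hG hTR1 hTQ1 (fun x => (hTR x).2.1) (fun x => (hTQ x).2.1)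
      (hTR0 ▸ hRi) (hTQ0 ▸ hQi) (f := f₁) (t₁ := t₁) (t₂ := T₁) (τ := τ₁) hc₁.continuousOn
      (fun t _ => hG₁ t) hτ₁ (hi₁ τ₁ hτ₁) ?_ ?_ ?_ ?_ ?_ (h₁.mono ?_) (ho₁ ▸ h₃.mono ?_)
      (hnot TR p₁ m1 hTR) (hnot TQ p₁ m1 hTQ) (hnot TR p₃ m3 hTR) (hnot TQ p₃ m3 hTQ)
    · rw [hTR0, hTQ0]
      rintro z hz ⟨a, b, ha, hb, hab, rfl⟩
      refine hK₁ _ hz ?_ ?_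
      · rw [map_add, map_smul, map_smul, hXR, hXQ, ← add_smul, hab, one_smul]
      · have e : Z (a • R + b • Q) - Z o = (b - a) * ρ := by
          simp only [map_add, map_smul, hZR, hZQ, smul_eq_mul]
          linear_combination (Z o) * hab
        rw [e, abs_mul, habs]
        exact mul_le_of_le_one_left hρ0.le (abs_le.mpr ⟨by linarith, by linarith⟩)
    · rw [hTR0, hTQ0]; exact hre
    · rw [hTR0, hTQ0]; exact him0
    · rw [hTR0, hTQ0]
      filter_upwards [hnear.filter_mono nhdsWithin_le_nhds, self_mem_nhdsWithin] with t ht ht'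
      rw [him1]
      have := mono₁ t τ₁ (ht.trans_le hδ1) (hτδ₁.trans_le hδ1) ht'
      have h5 : t < τ₁ := ht'
      exact div_nonneg (mul_nonneg hv.le (mul_nonneg (by linarith) (by linarith)))
        (Complex.normSq_nonneg _)
    · rw [hTR0, hTQ0]
      filter_upwards [hnear.filter_mono nhdsWithin_le_nhds, self_mem_nhdsWithin] with t ht ht'
      rw [him1]
      have := mono₁ τ₁ t (hτδ₁.trans_le hδ1) (ht.trans_le hδ1) ht'
      have h5 : τ₁ < t := ht'
      exact div_neg_of_neg_of_pos
        (mul_neg_of_pos_of_neg hv (mul_neg_of_neg_of_pos (by linarith) (by linarith)))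
        (Complex.normSq_pos.mpr (sub_ne_zero.mpr fun e => hRG (e ▸ hG₁ t)))
    · exact Set.sdiff_subset_sdiff_right (Set.singleton_subset_iff.mpr ⟨τ₁, hτ₁, rfl⟩)
    · exact Set.sdiff_subset_sdiff_right (Set.singleton_subset_iff.mpr (Or.inl ⟨τ₁, hτ₁, rfl⟩))
  have step₂ : crosscutIndex TQ TA p₃ = crosscutIndex TQ TA p₂ + 1 := by
    obtain ⟨hre, him0⟩ := hneg Q v₁ (f₂ τ₂) A (ρ - (X (f₂ τ₂) - X o)) (-ρ - (X (f₂ τ₂) - X o)) hv₁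
      (by rw [hdec (Q - f₂ τ₂), map_sub, map_sub, hXQ, hZQ, hZτ₂]; push_cast; ring)
      (by rw [hdec (A - f₂ τ₂), map_sub, map_sub, hXA, hZA, hZτ₂]; push_cast; ring)
      (by have := abs_le.mp hXτ₂; exact mul_neg_of_pos_of_neg (by linarith) (by linarith))
    have him1 : ∀ t, ((A - f₂ t) / (Q - f₂ t)).im =
        D * ((Z (f₂ τ₂) - Z (f₂ t)) * (2 * ρ)) / Complex.normSq (Q - f₂ t) := by
      intro t
      rw [him, map_sub, map_sub, map_sub, map_sub, hXA, hZA, hXQ, hZQ, hZτ₂]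
      ring
    have hnear : ∀ᶠ t in 𝓝 τ₂, |t - t₂| < δ :=
      (continuous_abs.comp (continuous_sub_right t₂)).continuousAt.eventually (gt_mem_nhds hτδ₂)
    refine crosscutIndex_step hG hTQ1 hTA1 (fun x => (hTQ x).2.1) (fun x => (hTA x).2.1)
      (hTQ0 ▸ hQi) (hTA0 ▸ hAi) (f := f₂) (t₁ := t₂) (t₂ := T₂) (τ := τ₂) hc₂.continuousOn
      (fun t _ => hG₂ t) hτ₂ (hi₂ τ₂ hτ₂) ?_ ?_ ?_ ?_ ?_ (h₂.mono ?_) (ho₂ ▸ h₃.mono ?_)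
      (hnot TQ p₂ m2 hTQ) (hnot TA p₂ m2 hTA) (hnot TQ p₃ m3 hTQ) (hnot TA p₃ m3 hTA)
    · rw [hTQ0, hTA0]
      rintro z hz ⟨a, b, ha, hb, hab, rfl⟩
      refine hK₂ _ hz ?_ ?_
      · rw [map_add, map_smul, map_smul, hZQ, hZA, ← add_smul, hab, one_smul]
      · have e : X (a • Q + b • A) - X o = (a - b) * ρ := by
          simp only [map_add, map_smul, hXQ, hXA, smul_eq_mul]
          linear_combination (X o) * hab
        rw [e, abs_mul, habs]
        exact mul_le_of_le_one_left hρ0.le (abs_le.mpr ⟨by linarith, by linarith⟩)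
    · rw [hTQ0, hTA0]; exact hre
    · rw [hTQ0, hTA0]; exact him0
    · rw [hTQ0, hTA0]
      filter_upwards [hnear.filter_mono nhdsWithin_le_nhds, self_mem_nhdsWithin] with t ht ht'
      rw [him1]
      have := mono₂ t τ₂ (ht.trans_le hδ2) (hτδ₂.trans_le hδ2) ht'
      have h5 : t < τ₂ := ht'
      exact div_nonneg (mul_nonneg hv.le (mul_nonneg (by linarith) (by linarith)))
        (Complex.normSq_nonneg _)
    · rw [hTQ0, hTA0]
      filter_upwards [hnear.filter_mono nhdsWithin_le_nhds, self_mem_nhdsWithin] with t ht ht'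
      rw [him1]
      have := mono₂ τ₂ t (hτδ₂.trans_le hδ2) (ht.trans_le hδ2) ht'
      have h5 : τ₂ < t := ht'
      exact div_neg_of_neg_of_pos
        (mul_neg_of_pos_of_neg hv (mul_neg_of_neg_of_pos (by linarith) (by linarith)))
        (Complex.normSq_pos.mpr (sub_ne_zero.mpr fun e => hQG (e ▸ hG₂ t)))
    · exact Set.sdiff_subset_sdiff_right (Set.singleton_subset_iff.mpr ⟨τ₂, hτ₂, rfl⟩)
    · exact Set.sdiff_subset_sdiff_right (Set.singleton_subset_iff.mpr (Or.inr ⟨τ₂, hτ₂, rfl⟩))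
  have hreal : ∀ T : C(I, ℂ), (T 1).im = 0 → T 1 = ((T 1).re : ℝ) := fun T hT =>
    Complex.ext rfl (by simp [hT])
  have hne : ∀ (T : C(I, ℂ)) (p : ℝ), p ∈ ({p₁, p₂, p₃} : Finset ℝ) → (T 1).im = 0 →
      (∀ x, 0 ≤ (T x).im ∧ T x ∉ G ∧ ∀ p ∈ ({p₁, p₂, p₃} : Finset ℝ), T x ≠ p) →
      (T 1).re ≠ p := fun T p hp h1 hT e => hnot T p hp hT ⟨1, by rw [hreal T h1, e]⟩
  rw [crosscutIndex_ofReal (fun x => (hTR x).1) (fun x => (hTQ x).1) (hTR0 ▸ hRi) (hTQ0 ▸ hQi)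
      (hreal TR hTR1) (hreal TQ hTQ1) (hnot TR p₃ m3 hTR) (hnot TQ p₃ m3 hTQ),
    crosscutIndex_ofReal (fun x => (hTR x).1) (fun x => (hTQ x).1) (hTR0 ▸ hRi) (hTQ0 ▸ hQi)
      (hreal TR hTR1) (hreal TQ hTQ1) (hnot TR p₁ m1 hTR) (hnot TQ p₁ m1 hTQ)] at step₁
  rw [crosscutIndex_ofReal (fun x => (hTQ x).1) (fun x => (hTA x).1) (hTQ0 ▸ hQi) (hTA0 ▸ hAi)
      (hreal TQ hTQ1) (hreal TA hTA1) (hnot TQ p₃ m3 hTQ) (hnot TA p₃ m3 hTA),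
    crosscutIndex_ofReal (fun x => (hTQ x).1) (fun x => (hTA x).1) (hTQ0 ▸ hQi) (hTA0 ▸ hAi)
      (hreal TQ hTQ1) (hreal TA hTA1) (hnot TQ p₂ m2 hTQ) (hnot TA p₂ m2 hTA)] at step₂
  exact cyclic_order_of_sign (hne TQ p₁ m1 hTQ1 hTQ) (hne TQ p₂ m2 hTQ1 hTQ)
    (hne TQ p₃ m3 hTQ1 hTQ) (hne TR p₁ m1 hTR1 hTR) (hne TR p₃ m3 hTR1 hTR)
    (hne TA p₂ m2 hTA1 hTA) (hne TA p₃ m3 hTA1 hTA) step₁ step₂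

/-! ### Escape to infinity in the complement of the loop -/

/-- The product of a circle with a half-open interval is not locally modelled on the plane at its
boundary. -/
theorem snd_ne_zero_of_isOpenEmbedding {X : Type*} [TopologicalSpace X] {j : X → ℂ}
    (hj : Topology.IsOpenEmbedding j) {f : X → Circle × Set.Ico (0 : ℝ) 1}
    (hf : Topology.IsOpenEmbedding f) (x₀ : X) : ((f x₀).2 : ℝ) ≠ 0 := by
  intro h0
  set ζ := (f x₀).1 with hζ
  have hf₀ : f x₀ = (ζ, ⟨0, by norm_num⟩) := Prod.ext rfl (Subtype.ext h0)
  -- the image contains a box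
  let E : ℝ × Set.Ico (0 : ℝ) 1 → Circle × Set.Ico (0 : ℝ) 1 := fun p => (Circle.exp p.1 * ζ, p.2)
  have hE : Continuous E := by fun_prop
  have hrange : E ⁻¹' Set.range f ∈ 𝓝 ((0 : ℝ), (⟨0, by norm_num⟩ : Set.Ico (0 : ℝ) 1)) :=
    hE.continuousAt.preimage_mem_nhds (hf.isOpen_range.mem_nhds ⟨x₀, by simp [E, hf₀]⟩)
  obtain ⟨ε', hε', hball⟩ := Metric.mem_nhds_iff.mp hrange
  obtain ⟨ε, hε, hεε', hε1⟩ : ∃ ε : ℝ, 0 < ε ∧ ε ≤ ε' ∧ ε ≤ 1 :=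
    ⟨min ε' 1, lt_min hε' one_pos, min_le_left _ _, min_le_right _ _⟩
  -- A punctured half-box around a boundary point, which is contractible, whereas a small circle
  -- around an interior point of the plane winds once.
  let W : Set (ℝ × Set.Ico (0 : ℝ) 1) :=
    {p | |p.1| < ε ∧ (p.2 : ℝ) < ε ∧ (p.1 ≠ 0 ∨ (p.2 : ℝ) ≠ 0)}
  have hW : ∀ p : W, E p.1 ∈ Set.range f := by
    rintro ⟨⟨a, s⟩, ha, hs, -⟩
    refine hball ?_
    rw [← ball_prod_same]
    refine ⟨?_, ?_⟩
    · simpa using ha.trans_le hεε'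
    · rw [Metric.mem_ball, Subtype.dist_eq, Real.dist_eq, sub_zero, abs_of_nonneg s.2.1]
      exact hs.trans_le hεε'
  let finv := hf.isEmbedding.toHomeomorph.symm
  have hfinv : ∀ y, f (finv y) = y := fun y =>
    congrArg Subtype.val (hf.isEmbedding.toHomeomorph.apply_symm_apply y)
  have hfinv' : ∀ x, finv ⟨f x, ⟨x, rfl⟩⟩ = x := fun x =>
    hf.isEmbedding.toHomeomorph.symm_apply_apply x
  let g : W → ℂ := fun p => j (finv ⟨E p.1, hW p⟩) - j x₀
  have hg : Continuous g := by
    refine (hj.continuous.comp (finv.continuous.comp ?_)).sub continuous_const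
    exact (hE.comp continuous_subtype_val).subtype_mk hW
  have hg0 : ∀ p, g p ≠ 0 := by
    intro p hp
    have h1 : finv ⟨E p.1, hW p⟩ = x₀ := hj.injective (sub_eq_zero.mp hp)
    have h2 := hfinv ⟨E p.1, hW p⟩
    rw [h1, hf₀] at h2
    have h3 : Circle.exp p.1.1 = 1 := by
      have := congrArg Prod.fst h2
      simpa [E] using this.symm
    have h4 : p.1.2 = ⟨0, by norm_num⟩ := (congrArg Prod.snd h2).symm
    obtain ⟨m, hm⟩ := Circle.exp_eq_one.mp h3
    have h5 : p.1.1 = 0 := by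
      have h6 := p.2.1.trans_le hε1
      rw [hm, abs_lt] at h6
      have hpi := Real.pi_gt_three
      have : m = 0 := by
        have h7 : (m : ℝ) < 1 := by nlinarith
        have h8 : (-1 : ℝ) < m := by nlinarith
        have h9 : m < 1 := by exact_mod_cast h7
        have h10 : -1 < m := by exact_mod_cast h8
        omega
      rw [hm, this]; simp
    rcases p.2.2.2 with h | h
    · exact h h5
    · exact h (by rw [h4])
  -- the punctured box is contractible
  let h : I × W → W := fun q => ⟨((q.1 : ℝ) * q.2.1.1,
      ⟨(1 - (q.1 : ℝ)) * (ε / 2) + q.1 * (q.2.1.2 : ℝ), by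
        have h1 := q.1.2.1
        have h2 := q.1.2.2
        have h3 := q.2.1.2.2.1
        have h4 := q.2.2.2.1
        constructor
        · have : 0 ≤ 1 - (q.1 : ℝ) := by linarith
          positivity
        · nlinarith⟩), by
      have h1 := q.1.2.1
      have h2 := q.1.2.2
      have h3 := q.2.1.2.2.1
      have h4 := q.2.2.2.1
      refine ⟨?_, ?_, ?_⟩
      · rw [abs_mul, abs_of_nonneg h1]
        exact (mul_le_of_le_one_left (abs_nonneg _) h2).trans_lt q.2.2.1
      · change (1 - (q.1 : ℝ)) * (ε / 2) + q.1 * (q.2.1.2 : ℝ) < ε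
        nlinarith
      · change (q.1 : ℝ) * q.2.1.1 ≠ 0 ∨ (1 - (q.1 : ℝ)) * (ε / 2) + q.1 * (q.2.1.2 : ℝ) ≠ 0
        rcases h2.lt_or_eq with h2 | h2
        · right
          have : 0 < 1 - (q.1 : ℝ) := by linarith
          positivity
        · rw [h2]
          simpa using q.2.2.2.2⟩
  have hh : Continuous h := by
    refine Continuous.subtype_mk (Continuous.prodMk ?_ (Continuous.subtype_mk ?_ _)) _
    · fun_prop
    · fun_prop
  obtain ⟨Lg, hLg, hLge⟩ := exists_log_homotopy (A := W) (h := fun q => g (h q))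
    (w := j (finv ⟨E (0, ⟨ε / 2, by constructor <;> linarith⟩),
      hW ⟨(0, ⟨ε / 2, by constructor <;> linarith⟩), by
        refine ⟨by simpa using hε, ?_, Or.inr ?_⟩
        · change ε / 2 < ε
          linarith
        · change ε / 2 ≠ 0
          positivity⟩⟩) - j x₀) (hg.comp hh) (fun q => hg0 _) (fun a => by
      simp only [g, h]
      congr 5 <;> simp)
  -- a small circle around the point
  have hcont : Filter.Tendsto (fun x => ((((f x).1 * ζ⁻¹ : Circle) : ℂ), ((f x).2 : ℝ))) (𝓝 x₀)
      (𝓝 (1, 0)) := by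
    have : Continuous fun x => ((((f x).1 * ζ⁻¹ : Circle) : ℂ), ((f x).2 : ℝ)) := by
      have := hf.continuous
      fun_prop
    refine this.tendsto' _ _ ?_
    rw [hf₀]
    simp
  have hN : ∀ᶠ x in 𝓝 x₀, (((f x).1 * ζ⁻¹ : Circle) : ℂ) ∈ Complex.slitPlane ∧
      |(((f x).1 * ζ⁻¹ : Circle) : ℂ).arg| < ε ∧ ((f x).2 : ℝ) < ε := by
    refine ((hcont.fst_nhds).eventually
      (Complex.isOpen_slitPlane.mem_nhds Complex.one_mem_slitPlane)).and (Filter.Eventually.and ?_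
      (hcont.snd_nhds.eventually (gt_mem_nhds hε)))
    have h1 := ((Complex.continuousAt_arg Complex.one_mem_slitPlane).abs.tendsto).comp
      hcont.fst_nhds
    rw [Complex.arg_one, abs_zero] at h1
    exact h1.eventually (gt_mem_nhds hε)
  obtain ⟨δ', hδ', hδball⟩ := Metric.mem_nhds_iff.mp (hj.isOpenMap.image_mem_nhds hN)
  set δ := δ' / 2 with hδ
  have hδ0 : 0 < δ := half_pos hδ'
  let w : ℝ → ℂ := fun t => j x₀ + δ * Complex.exp (t * Complex.I)
  have hwball : ∀ t, w t ∈ Metric.ball (j x₀) δ' := fun t => by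
    rw [Metric.mem_ball, dist_eq_norm]
    simp only [w, add_sub_cancel_left, norm_mul, Complex.norm_exp_ofReal_mul_I, mul_one,
      Complex.norm_real, Real.norm_eq_abs, abs_of_pos hδ0]
    linarith
  let jinv := hj.isEmbedding.toHomeomorph.symm
  have hwr : ∀ t, w t ∈ Set.range j := fun t => by
    obtain ⟨x, -, hx⟩ := hδball (hwball t)
    exact ⟨x, hx⟩
  let x : ℝ → X := fun t => jinv ⟨w t, hwr t⟩
  have hx : Continuous x := by
    refine jinv.continuous.comp (Continuous.subtype_mk ?_ _)
    fun_prop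
  have hjx : ∀ t, j (x t) = w t := fun t =>
    congrArg Subtype.val (hj.isEmbedding.toHomeomorph.apply_symm_apply ⟨w t, hwr t⟩)
  have hxN : ∀ t, (((f (x t)).1 * ζ⁻¹ : Circle) : ℂ) ∈ Complex.slitPlane ∧
      |(((f (x t)).1 * ζ⁻¹ : Circle) : ℂ).arg| < ε ∧ ((f (x t)).2 : ℝ) < ε := fun t => by
    obtain ⟨y, hy, hyw⟩ := hδball (hwball t)
    rwa [← hj.injective (hyw.trans (hjx t).symm)]
  have hexp : ∀ t, Circle.exp (((f (x t)).1 * ζ⁻¹ : Circle) : ℂ).arg * ζ = (f (x t)).1 := fun t => by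
    rw [Circle.exp_arg, inv_mul_cancel_right]
  let p : ℝ → W := fun t => ⟨((((f (x t)).1 * ζ⁻¹ : Circle) : ℂ).arg, (f (x t)).2), (hxN t).2.1,
    (hxN t).2.2, by
      by_contra! hcon
      have h1 : (f (x t)).1 = ζ := by
        rw [← hexp t]
        have : (((f (x t)).1 * ζ⁻¹ : Circle) : ℂ).arg = 0 := hcon.1
        rw [this]
        simp
      have h2 : f (x t) = f x₀ := by
        rw [hf₀]
        exact Prod.ext h1 (Subtype.ext hcon.2)
      have h3 := hjx t
      rw [hf.injective h2] at h3
      have h4 : (δ : ℂ) * Complex.exp (t * Complex.I) = 0 := by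
        simp only [w] at h3
        linear_combination -h3
      rcases mul_eq_zero.mp h4 with h5 | h5
      · exact hδ0.ne' (by exact_mod_cast h5)
      · exact Complex.exp_ne_zero _ h5⟩
  have hp : Continuous p := by
    refine Continuous.subtype_mk (Continuous.prodMk ?_ ?_) _
    · refine continuous_iff_continuousAt.mpr fun t => ?_
      refine ContinuousAt.comp (g := Complex.arg) (Complex.continuousAt_arg (hxN t).1) ?_
      have : Continuous fun t => (((f (x t)).1 * ζ⁻¹ : Circle) : ℂ) := by
        have := hf.continuous
        fun_prop
      exact this.continuousAt
    · exact continuous_snd.comp (hf.continuous.comp hx)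
  have hgp : ∀ t, g (p t) = δ * Complex.exp (t * Complex.I) := by
    intro t
    have h1 : finv ⟨E (p t).1, hW (p t)⟩ = x t := by
      rw [← hfinv' (x t)]
      congr 2
      exact Prod.ext (hexp t) rfl
    simp only [g]
    rw [h1, hjx]
    simp [w]
  have hperiod : p (2 * Real.pi) = p 0 := by
    have : w (2 * Real.pi) = w 0 := by simp [w]
    have h2 : x (2 * Real.pi) = x 0 := hj.injective (by rw [hjx, hjx, this])
    simp only [p, h2]
  have hone : ∀ q : W, h (1, q) = q := fun q => by
    apply Subtype.ext
    apply Prod.ext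
    · simp [h]
    · apply Subtype.ext
      simp [h]
  let L₁ : C(I, ℂ) := ⟨fun y => Lg (1, p (2 * Real.pi * y)), by fun_prop⟩
  let L₂ : C(I, ℂ) := ⟨fun y => Complex.log δ + (2 * Real.pi * y : ℝ) * Complex.I, by fun_prop⟩
  -- Along the circle, the logarithm on W returns to its value, while the explicit one increases by
  -- 2πi.
  have key := sub_eq_of_exp_eq (L := L₁) (L' := L₂) fun y => by
    change Complex.exp (Lg (1, p (2 * Real.pi * y))) =
      Complex.exp (Complex.log δ + (2 * Real.pi * y : ℝ) * Complex.I)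
    rw [hLge, hone, hgp, Complex.exp_add, Complex.exp_log (by exact_mod_cast hδ0.ne')]
  have h1 : L₁ 1 - L₁ 0 = 0 := by
    change Lg (1, p (2 * Real.pi * (1 : I))) - Lg (1, p (2 * Real.pi * (0 : I))) = 0
    rw [Set.Icc.coe_one, Set.Icc.coe_zero, mul_one, mul_zero, hperiod, sub_self]
  rw [h1] at key
  have h2 : L₂ 1 - L₂ 0 = 2 * Real.pi * Complex.I := by
    simp [L₂]
  rw [h2] at key
  have := congrArg Complex.im key
  simp at this

namespace GeneralPosition

variable {S : Type*} [TopologicalSpace S] {Y : HyperbolicStructure S} {c : ℝ → S} {r : ℕ}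
  (P : GeneralPosition Y c r)

/-- The full preimage of the loop in the universal cover. -/
def orbit : Set ℍ := {z | ∃ g ∈ Y.group, ∃ t, g • P.lift t = z}

variable {P}

theorem orbit_subset_interior : P.orbit ⊆ interior Y.region := by
  rintro _ ⟨g, hg, t, rfl⟩
  have h1 : (fun z : ℍ => g • z) '' interior Y.region ⊆ interior Y.region := by
    refine interior_maximal ?_ ((isOpenMap_smul g) _ isOpen_interior)
    rintro _ ⟨z, hz, rfl⟩
    exact Y.smul_mem g hg z (interior_subset hz)
  exact h1 ⟨_, P.lift_mem t, rfl⟩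

theorem proj_mem_range_iff {z : ℍ} (hz : z ∈ Y.region) :
    Y.proj z ∈ Set.range c ↔ z ∈ P.orbit := by
  constructor
  · rintro ⟨t, ht⟩
    rw [← P.proj_lift] at ht
    obtain ⟨g, hg, e⟩ := (Y.proj_eq_iff _ (P.lift_mem_region t) _ hz).mp ht
    exact ⟨g, hg, t, e⟩
  · rintro ⟨g, hg, t, rfl⟩
    refine ⟨t, ?_⟩
    rw [← P.proj_lift]
    exact (Y.proj_eq_iff _ (P.lift_mem_region t) _ hz).mpr ⟨g, hg, rfl⟩

variable (P) in
theorem exists_deck_zpow (n : ℤ) : ∃ g ∈ Y.group, ∀ t, g • P.lift t = P.lift (t + n) := by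
  refine Y.exists_smul_eq_of_proj_eq P.continuous_lift
    (P.continuous_lift.comp (continuous_add_const (n : ℝ))) P.lift_mem_region
    (fun t => P.lift_mem_region (t + n)) fun t => ?_
  rw [P.proj_lift, P.proj_lift]
  have := P.periodic.int_mul n t
  rw [mul_one] at this
  exact this.symm

/-- A sequence of points of the preimage of the loop, converging in the upper half-plane, is
eventually on finitely many strands. -/
theorem exists_of_tendsto {g : ℕ → SL2} (hg : ∀ n, g n ∈ Y.group) {t : ℕ → ℝ} {z : ℍ}
    (h : Filter.Tendsto (fun n => g n • P.lift (t n)) Filter.atTop (𝓝 z)) :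
    ∃ g₀ ∈ Y.group, ∃ t₀, g₀ • P.lift t₀ = z ∧
      ∀ δ > 0, ∃ n t', |t' - t₀| < δ ∧ g n • P.lift (t n) = g₀ • P.lift t' := by
  choose d hd hdl using P.exists_deck_zpow
  -- Periodicity brings the times back to [0, 1], where a subsequence converges.
  let g' : ℕ → SL2 := fun n => g n * d ⌊t n⌋
  let s : ℕ → ℝ := fun n => Int.fract (t n)
  have hg' : ∀ n, g' n ∈ Y.group := fun n => mul_mem (hg n) (hd _)
  have hgs : ∀ n, g' n • P.lift (s n) = g n • P.lift (t n) := fun n => by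
    simp only [g', s]
    rw [mul_smul, hdl, Int.fract_add_floor]
  obtain ⟨t₀, -, φ, hφ, hlim⟩ := isCompact_Icc.tendsto_subseq (x := s) (s := Set.Icc 0 1)
    fun n => ⟨Int.fract_nonneg _, (Int.fract_lt_one _).le⟩
  have h1 : Filter.Tendsto (fun n => g' (φ n) • P.lift (s (φ n))) Filter.atTop (𝓝 z) := by
    simp only [hgs]
    exact h.comp hφ.tendsto_atTop
  have h2 : Filter.Tendsto (fun n => dist (P.lift (s (φ n))) (P.lift t₀)) Filter.atTop (𝓝 0) :=
    tendsto_iff_dist_tendsto_zero.mp ((P.continuous_lift.tendsto t₀).comp hlim)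
  have h3 : Filter.Tendsto (fun n => g' (φ n) • P.lift t₀) Filter.atTop (𝓝 z) := by
    rw [tendsto_iff_dist_tendsto_zero]
    refine squeeze_zero (fun _ => dist_nonneg) (fun n => ?_)
      (by simpa using h2.add (tendsto_iff_dist_tendsto_zero.mp h1))
    calc dist (g' (φ n) • P.lift t₀) z ≤ dist (g' (φ n) • P.lift t₀) (g' (φ n) • P.lift (s (φ n)))
          + dist (g' (φ n) • P.lift (s (φ n))) z := dist_triangle _ _ _
      _ = _ := by rw [dist_smul, dist_comm (P.lift t₀)]
  obtain ⟨ε, hε, H⟩ := Y.discrete (P.lift t₀) (P.lift_mem_region t₀)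
  obtain ⟨N, hN⟩ := Metric.tendsto_atTop.mp h3 (ε / 2) (half_pos hε)
  -- Two translates of the point at time t₀ within ε of each other coincide by discreteness, so the
  -- group elements eventually act in the same way.
  have h4 : ∀ n ≥ N, ∀ w : ℍ, g' (φ n) • w = g' (φ N) • w := by
    intro n hn w
    have h5 := H ((g' (φ N))⁻¹ * g' (φ n)) (mul_mem (inv_mem (hg' _)) (hg' _)) (by
      rw [mul_smul, ← dist_smul (g' (φ N)), smul_inv_smul]
      calc dist (g' (φ N) • P.lift t₀) (g' (φ n) • P.lift t₀)
          ≤ dist (g' (φ N) • P.lift t₀) z + dist (g' (φ n) • P.lift t₀) z :=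
            dist_triangle_right _ _ _
        _ < ε := by linarith [hN N le_rfl, hN n hn]) w
    rwa [mul_smul, inv_smul_eq_iff] at h5
  refine ⟨g' (φ N), hg' _, t₀, ?_, fun δ hδ => ?_⟩
  · refine tendsto_nhds_unique (tendsto_const_nhds (x := g' (φ N) • P.lift t₀)
      (f := Filter.atTop (α := ℕ))) (h3.congr' ?_)
    filter_upwards [Filter.eventually_ge_atTop N] with n hn using h4 n hn _
  · obtain ⟨M, hM⟩ := Metric.tendsto_atTop.mp hlim δ hδ
    refine ⟨φ (max M N), s (φ (max M N)), ?_, ?_⟩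
    · exact hM _ (le_max_left _ _)
    · rw [← h4 _ (le_max_right M N), hgs]

theorem isClosed_orbit : IsClosed P.orbit := by
  refine isClosed_of_closure_subset fun z hz => ?_
  obtain ⟨x, hx, hlim⟩ := mem_closure_iff_seq_limit.mp hz
  choose g hg t hgt using hx
  obtain ⟨g₀, hg₀, t₀, h, -⟩ := exists_of_tendsto (P := P) hg (t := t) (z := z)
    (by simpa only [hgt] using hlim)
  exact ⟨g₀, hg₀, t₀, h⟩

/-- Near a point of the preimage of the loop, this preimage consists of the strands through that
point. -/
theorem eventually_mem_orbit (o : ℍ) {Q : ℍ → Prop}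
    (hQ : ∀ g ∈ Y.group, ∀ t, g • P.lift t = o → ∀ᶠ s in 𝓝 t, Q (g • P.lift s)) :
    ∀ᶠ z in 𝓝 o, z ∈ P.orbit → Q z := by
  by_contra hcon
  obtain ⟨x, hx, hx'⟩ := Filter.exists_seq_forall_of_frequently (Filter.not_eventually.mp hcon)
  simp only [Classical.not_imp] at hx'
  choose g hg t hgt using fun n => (hx' n).1
  obtain ⟨g₀, hg₀, t₀, h, h'⟩ := exists_of_tendsto (P := P) hg (t := t) (z := o)
    (by simpa only [hgt] using hx)
  obtain ⟨δ, hδ, hb⟩ := Metric.eventually_nhds_iff_ball.mp (hQ g₀ hg₀ t₀ h)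
  obtain ⟨n, t', ht', e⟩ := h' δ hδ
  refine (hx' n).2 ?_
  rw [← hgt n, e]
  exact hb t' ht'

/-- The component of the complement is a half-open annulus. Pushing a point radially to the boundary
circle and lifting the path ends on the frontier of the region, because an interior point would have
a plane neighborhood. -/
theorem exists_joinedIn_frontier (hfill : IsFilling c) (hEight : IsGeneralizedEight c) {z : ℍ}
    (hz : z ∈ Y.region) (hzo : z ∉ P.orbit) :
    ∃ z' ∈ frontier Y.region, JoinedIn P.orbitᶜ z z' := by
  have hpz : Y.proj z ∈ (Set.range c)ᶜ := fun h => hzo ((proj_mem_range_iff hz).mp h)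
  set U := connectedComponentIn (Set.range c)ᶜ (Y.proj z) with hU
  obtain ⟨e⟩ : Nonempty (U ≃ₜ Circle × Set.Ico (0 : ℝ) 1) := by
    -- A disc is contractible, which is what a generalized eight excludes.
    refine (hfill _ hpz).resolve_left fun ⟨e⟩ => hEight _ hpz ?_
    have : ContractibleSpace (Metric.ball (0 : ℂ) 1) :=
      (convex_ball (0 : ℂ) 1).contractibleSpace ⟨0, by simp⟩
    exact e.contractibleSpace
  have hzU : Y.proj z ∈ U := mem_connectedComponentIn hpz
  set y := e ⟨Y.proj z, hzU⟩ with hy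
  have hmem : ∀ x : I, (1 - (x : ℝ)) * (y.2 : ℝ) ∈ Set.Ico (0 : ℝ) 1 := fun x =>
    ⟨mul_nonneg (by linarith [x.2.2]) y.2.2.1,
      (mul_le_of_le_one_left y.2.2.1 (by linarith [x.2.1])).trans_lt y.2.2.2⟩
  let H : C(I × Unit, S) := ⟨fun x => (e.symm (y.1, ⟨(1 - (x.1 : ℝ)) * y.2, hmem x.1⟩) : S), by
    refine continuous_subtype_val.comp (e.symm.continuous.comp ?_)
    refine continuous_const.prodMk (Continuous.subtype_mk ?_ _)
    fun_prop⟩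
  obtain ⟨H', Hm, Hp, H0⟩ := Y.exists_lift_homotopy H (f := fun _ => z) continuous_const
    (fun _ => hz) (fun _ => by
      change ((e.symm (y.1, ⟨(1 - ((0 : I) : ℝ)) * y.2, _⟩) : U) : S) = _
      have : (y.1, (⟨(1 - ((0 : I) : ℝ)) * y.2, hmem 0⟩ : Set.Ico (0 : ℝ) 1)) = y :=
        Prod.ext rfl (Subtype.ext (by simp))
      rw [this, hy, e.symm_apply_apply])
  have Ho : ∀ p, H' p ∉ P.orbit := fun p h => by
    have h1 := (proj_mem_range_iff (P := P) (Hm p)).mpr h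
    rw [Hp] at h1
    exact connectedComponentIn_subset _ _ (e.symm (y.1, ⟨(1 - (p.1 : ℝ)) * y.2, hmem p.1⟩)).2 h1
  refine ⟨H' (1, ()), ?_, ⟨⟨⟨fun x => H' (x, ()), by fun_prop⟩, H0 (), rfl⟩, fun x => Ho _⟩⟩
  rw [Y.isClosed.frontier_eq]
  refine ⟨Hm _, fun hint => ?_⟩
  set z' := H' (1, ()) with hz'
  have hpU : Y.proj z' ∈ U := by
    rw [hz', Hp]
    exact (e.symm (y.1, ⟨(1 - ((1 : I) : ℝ)) * y.2, hmem 1⟩)).2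
  obtain ⟨ε, hε, hdisc⟩ := Y.discrete z' (Hm _)
  obtain ⟨r₁, hr₁, hb₁⟩ := Metric.mem_nhds_iff.mp (mem_interior_iff_mem_nhds.mp hint)
  obtain ⟨r₂, hr₂, hb₂⟩ := Metric.mem_nhds_iff.mp (isClosed_orbit.isOpen_compl.mem_nhds (Ho (1, ())))
  set ρ := min (ε / 2) (min r₁ r₂) with hρ
  have hρ0 : 0 < ρ := lt_min (half_pos hε) (lt_min hr₁ hr₂)
  let B := Metric.ball z' ρ
  have hBC : B ⊆ Y.region :=
    (Metric.ball_subset_ball ((min_le_right _ _).trans (min_le_left _ _))).trans hb₁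
  have hBo : B ⊆ P.orbitᶜ :=
    (Metric.ball_subset_ball ((min_le_right _ _).trans (min_le_right _ _))).trans hb₂
  have hz'B : z' ∈ B := Metric.mem_ball_self hρ0
  have hBconn : IsPreconnected B := by
    rw [← UpperHalfPlane.isEmbedding_coe.isInducing.isPreconnected_image]
    rw [UpperHalfPlane.image_coe_ball]
    exact (convex_ball _ _).isPreconnected
  let ι : B → Y.region := fun x => ⟨x, hBC x.2⟩
  have hι : Continuous ι := continuous_subtype_val.subtype_mk _
  let fS : B → S := fun x => Y.proj x
  have hfS : Continuous fS := Y.isQuotientMap.continuous.comp hι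
  have hfU : ∀ x, fS x ∈ U := by
    have h1 : IsPreconnected (Set.range fS) := by
      have : PreconnectedSpace B := isPreconnected_iff_preconnectedSpace.mp hBconn
      exact isPreconnected_range hfS
    have h2 : Set.range fS ⊆ (Set.range c)ᶜ := by
      rintro _ ⟨x, rfl⟩ h
      exact hBo x.2 ((proj_mem_range_iff (hBC x.2)).mp h)
    have h3 := h1.subset_connectedComponentIn (x := Y.proj z') ⟨⟨z', hz'B⟩, rfl⟩ h2
    rw [← connectedComponentIn_eq hpU] at h3
    exact fun x => h3 ⟨x, rfl⟩
  have hinj : Function.Injective fS := by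
    intro x x' h
    obtain ⟨g, hg, e'⟩ := (Y.proj_eq_iff _ (hBC x.2) _ (hBC x'.2)).mp h
    have h1 : dist (x : ℍ) z' < ε / 2 := lt_of_lt_of_le x.2 (min_le_left _ _)
    have h2 : dist (x' : ℍ) z' < ε / 2 := lt_of_lt_of_le x'.2 (min_le_left _ _)
    have h3 := hdisc g hg (by
      calc dist z' (g • z') ≤ dist z' x' + dist (x' : ℍ) (g • z') := dist_triangle _ _ _
        _ = dist (x' : ℍ) z' + dist (x : ℍ) z' := by rw [dist_comm, ← e', dist_smul]
        _ < ε := by linarith) x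
    exact Subtype.ext (h3.symm.trans e')
  have hopen : IsOpenMap fS := by
    refine Y.isCoveringMap.isLocalHomeomorph.isOpenMap.comp (f := ι) fun V hV => ?_
    have h1 : IsOpen ((↑) '' V : Set ℍ) := Metric.isOpen_ball.isOpenMap_subtype_val V hV
    have h2 : ι '' V = (↑) ⁻¹' ((↑) '' V : Set ℍ) := by
      ext x
      constructor
      · rintro ⟨v, hv, rfl⟩
        exact ⟨v, hv, rfl⟩
      · rintro ⟨v, hv, hvx⟩
        exact ⟨v, hv, Subtype.ext hvx⟩
    rw [h2]
    exact h1.preimage continuous_subtype_val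
  let fU : B → U := fun x => ⟨fS x, hfU x⟩
  have hfUe : Topology.IsOpenEmbedding fU := by
    refine Topology.IsOpenEmbedding.of_continuous_injective_isOpenMap (hfS.subtype_mk _)
      (fun x x' h => hinj (congrArg Subtype.val h)) fun V hV => ?_
    have h2 : fU '' V = (↑) ⁻¹' (fS '' V) := by
      ext x
      constructor
      · rintro ⟨v, hv, rfl⟩
        exact ⟨v, hv, rfl⟩
      · rintro ⟨v, hv, hvx⟩
        exact ⟨v, hv, Subtype.ext hvx⟩
    rw [h2]
    exact (hopen V hV).preimage continuous_subtype_val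
  have hj : Topology.IsOpenEmbedding fun x : B => ((x : ℍ) : ℂ) :=
    UpperHalfPlane.isOpenEmbedding_coe.comp Metric.isOpen_ball.isOpenEmbedding_subtypeVal
  -- A small ball around z' would embed as an open set of the annulus with z' at radial coordinate
  -- 0.
  refine snd_ne_zero_of_isOpenEmbedding hj (e.isOpenEmbedding.comp hfUe) ⟨z', hz'B⟩ ?_
  have h5 : fU ⟨z', hz'B⟩ = e.symm (y.1, ⟨(1 - ((1 : I) : ℝ)) * y.2, hmem 1⟩) :=
    Subtype.ext (Hp (1, ()))
  simp only [Function.comp_apply]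
  rw [h5, e.apply_symm_apply]
  simp

/-- The quotient of the first column is the endpoint of the rotated ray. Each forbidden endpoint,
infinity included, excludes at most one angle of (0, 1). -/
theorem exists_rot_generic (M : SL2) (F : Finset ℝ) {η : ℝ} (hη : 0 < η) :
    ∃ φ, 0 < φ ∧ φ < η ∧ (M * rot φ) 1 0 ≠ 0 ∧ ∀ p ∈ F, (M * rot φ) 0 0 ≠ p * (M * rot φ) 1 0 := by
  have hsub : ∀ A B : ℝ, (A ≠ 0 ∨ B ≠ 0) →
      ({φ | A * Real.cos φ - B * Real.sin φ = 0} ∩ Set.Ioo 0 1).Finite := by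
    intro A B hAB
    refine Set.Subsingleton.finite ?_
    rintro x ⟨hx, hx0, hx1⟩ y ⟨hy, hy0, hy1⟩
    have hx' : A * Real.cos x - B * Real.sin x = 0 := hx
    have hy' : A * Real.cos y - B * Real.sin y = 0 := hy
    have hs : Real.sin (x - y) = 0 := by
      rw [Real.sin_sub]
      rcases hAB with h | h
      · refine mul_left_cancel₀ h ?_
        linear_combination Real.sin x * hy' - Real.sin y * hx'
      · refine mul_left_cancel₀ h ?_
        linear_combination Real.cos x * hy' - Real.cos y * hx'
    have hpi := Real.pi_gt_three
    have := (Real.sin_eq_zero_iff_of_lt_of_lt (by linarith) (by linarith)).mp hs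
    linarith
  have hdet := sl_det M
  have hent : ∀ φ, (M * rot φ) 1 0 = M 1 0 * Real.cos φ - M 1 1 * Real.sin φ ∧
      (M * rot φ) 0 0 = M 0 0 * Real.cos φ - M 0 1 * Real.sin φ := by
    intro φ
    rw [Matrix.SpecialLinearGroup.coe_mul, mul_apply, mul_apply, Fin.sum_univ_two, Fin.sum_univ_two]
    simp [rot]
    constructor <;> ring
  have hfin : (({φ | M 1 0 * Real.cos φ - M 1 1 * Real.sin φ = 0} ∩ Set.Ioo 0 1) ∪
      ⋃ p ∈ F, ({φ | (M 0 0 - p * M 1 0) * Real.cos φ - (M 0 1 - p * M 1 1) * Real.sin φ = 0} ∩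
        Set.Ioo 0 1)).Finite := by
    refine (hsub _ _ ?_).union (F.finite_toSet.biUnion fun p _ => hsub _ _ ?_)
    · by_contra! h
      rw [h.1, h.2] at hdet
      simp at hdet
    · by_contra! h
      have h1 : (M 0 0 - p * M 1 0) * M 1 1 - (M 0 1 - p * M 1 1) * M 1 0 = 1 := by
        linear_combination hdet
      rw [h.1, h.2] at h1
      simp at h1
  obtain ⟨φ, ⟨h0, h1⟩, hφ⟩ := ((Set.Ioo_infinite (lt_min hη one_pos)).sdiff hfin).nonempty
  have h2 := h1.trans_le (min_le_left η 1)
  have h3 := h1.trans_le (min_le_right η 1)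
  refine ⟨φ, h0, h2, fun h => hφ (Or.inl ⟨?_, h0, h3⟩), fun p hp h => hφ (Or.inr ?_)⟩
  · rw [(hent φ).1] at h
    exact h
  · refine Set.mem_biUnion hp ⟨?_, h0, h3⟩
    rw [(hent φ).1, (hent φ).2] at h
    change _ = _
    linear_combination h

theorem continuous_rot : Continuous rot := by
  refine Continuous.subtype_mk (continuous_matrix fun i j => ?_) _
  fin_cases i <;> fin_cases j <;> simp <;> fun_prop

/-- The points of the complement of the preimage of the loop can be joined to the real axis. -/
theorem exists_joinedIn_real (hfill : IsFilling c) (hEight : IsGeneralizedEight c) (k : SL2) {z : ℍ}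
    (hz : z ∈ Y.region) (hzo : z ∉ P.orbit) (F : Finset ℝ) :
    ∃ q : ℂ, q.im = 0 ∧ JoinedIn {w : ℂ | 0 ≤ w.im ∧
      w ∉ (fun z : ℍ => ((k • z : ℍ) : ℂ)) '' P.orbit ∧ ∀ p ∈ F, w ≠ p} ((k • z : ℍ) : ℂ) q := by
  obtain ⟨z', hz', hj⟩ := exists_joinedIn_frontier hfill hEight hz hzo
  have hcoe : ∀ w : ℍ, w ∉ P.orbit → ((k • w : ℍ) : ℂ) ∈ {w : ℂ | 0 ≤ w.im ∧
      w ∉ (fun z : ℍ => ((k • z : ℍ) : ℂ)) '' P.orbit ∧ ∀ p ∈ F, w ≠ p} := by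
    intro w hw
    refine ⟨(k • w).im_pos.le, ?_, fun p _ h => ?_⟩
    · rintro ⟨v, hv, e⟩
      have : v = w := smul_left_cancel k (UpperHalfPlane.ext e)
      exact hw (this ▸ hv)
    · have := congrArg Complex.im h
      exact (k • w).im_pos.ne' this
  have hz'o : z' ∉ P.orbit := fun h => by
    rw [Y.isClosed.frontier_eq] at hz'
    exact hz'.2 (orbit_subset_interior h)
  have hz'C : z' ∈ Y.region := Y.isClosed.frontier_subset hz'
  obtain ⟨ε, hε, hball⟩ := Metric.mem_nhds_iff.mp (isClosed_orbit.isOpen_compl.mem_nhds hz'o)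
  obtain ⟨w₀, hw₀, hw₀C⟩ : ∃ w₀ ∈ Metric.ball z' ε, w₀ ∉ Y.region := by
    rw [frontier_eq_closure_inter_closure] at hz'
    obtain ⟨w₀, h1, h2⟩ := mem_closure_iff_nhds.mp hz'.2 _ (Metric.ball_mem_nhds z' hε)
    exact ⟨w₀, h1, h2⟩
  obtain ⟨m, hm0, hmd⟩ := exists_smul_expI_eq z' w₀
  set d := dist z' w₀ with hd
  have hdε : d < ε := by rw [hd, dist_comm]; exact hw₀
  have hcont : Continuous fun φ => (m * rot φ) • expI d := by
    have h1 : Continuous fun φ => m * rot φ := continuous_const.mul continuous_rot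
    rw [UpperHalfPlane.isEmbedding_coe.continuous_iff]
    have hij : ∀ i j, Continuous fun φ => (((m * rot φ) i j : ℝ) : ℂ) := fun i j => by
      have : Continuous fun φ => ((m * rot φ : SL2) : M2) i j :=
        (continuous_subtype_val.comp h1).matrix_elem i j
      exact Complex.continuous_ofReal.comp this
    have h2 : (fun φ => (((m * rot φ) • expI d : ℍ) : ℂ)) = fun φ =>
        (((m * rot φ) 0 0 : ℝ) * (expI d : ℂ) + ((m * rot φ) 0 1 : ℝ)) /
          (((m * rot φ) 1 0 : ℝ) * (expI d : ℂ) + ((m * rot φ) 1 1 : ℝ)) := by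
      funext φ
      rw [coe_sl_smul]
    change Continuous fun φ => (((m * rot φ) • expI d : ℍ) : ℂ)
    rw [h2]
    exact (((hij 0 0).mul continuous_const).add (hij 0 1)).div
      (((hij 1 0).mul continuous_const).add (hij 1 1))
      (fun φ => sl_denom_ne_zero _ (expI d).im_pos.ne')
  have hnear : ∀ᶠ φ in 𝓝 (0 : ℝ), (m * rot φ) • expI d ∉ Y.region := by
    refine hcont.continuousAt.eventually (Y.isClosed.isOpen_compl.mem_nhds ?_)
    have : rot 0 = 1 := by
      refine Matrix.SpecialLinearGroup.ext _ _ fun i j => ?_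
      fin_cases i <;> fin_cases j <;> simp [rot]
    change (m * rot 0) • expI d ∉ Y.region
    rw [this, mul_one, hmd]
    exact hw₀C
  obtain ⟨η, hη, hηC⟩ := Metric.eventually_nhds_iff_ball.mp hnear
  obtain ⟨φ, hφ0, hφη, hφ10, hφF⟩ := exists_rot_generic (k * m) F hη
  have hN0 : (m * rot φ) • expI 0 = z' := by rw [mul_smul, rot_smul_I, hm0]
  have hNd : (m * rot φ) • expI d ∉ Y.region :=
    hηC φ (by rw [Metric.mem_ball, Real.dist_eq, sub_zero, abs_of_pos hφ0]; exact hφη)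
  rw [mul_assoc] at hφ10 hφF
  set N := m * rot φ with hN
  have hray : ∀ s, 0 ≤ s → N • expI s ∉ P.orbit := by
    intro s hs ho
    have hds : ∀ a b, dist (N • expI a) (N • expI b) = |a - b| := fun a b => by
      rw [(isometry_smul_expI N).dist_eq, Real.dist_eq]
    rcases le_or_gt s d with h | h
    · refine hball ?_ ho
      rw [Metric.mem_ball, ← hN0, hds, sub_zero, abs_of_nonneg hs]
      linarith
    -- Up to distance d the ray stays in a ball free of the orbit. If it returned to the region
    -- later, convexity would put its point at distance d in the region too.
    · refine hNd (Y.convex z' hz'C (N • expI s) (interior_subset (orbit_subset_interior ho)) _ ?_)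
      have hd0 : 0 ≤ d := dist_nonneg
      rw [← hN0, hds, hds, hds, abs_of_nonpos, abs_of_nonpos, abs_of_nonpos] <;> linarith
  have hden : ∀ u : ℝ, (((k * N) 1 0 : ℝ) * Complex.I + ((k * N) 1 1 : ℝ) * u : ℂ) ≠ 0 := by
    intro u h
    have := congrArg Complex.im h
    simp at this
    exact hφ10 this
  -- With u = exp(-s), the ray extends continuously to its real endpoint at u = 0.
  let T : ℝ → ℂ := fun u => (((k * N) 0 0 : ℝ) * Complex.I + ((k * N) 0 1 : ℝ) * u) /
    (((k * N) 1 0 : ℝ) * Complex.I + ((k * N) 1 1 : ℝ) * u)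
  have hT : Continuous T := by
    refine Continuous.div (by fun_prop) (by fun_prop) hden
  have hTu : ∀ u, 0 < u → T u = ((k • N • expI (-Real.log u) : ℍ) : ℂ) := by
    intro u hu
    rw [← mul_smul, coe_sl_smul, coe_expI, Real.exp_neg, Real.exp_log hu]
    have : (u : ℂ) ≠ 0 := by exact_mod_cast hu.ne'
    have h1 := hden u
    have h2 : (((k * N) 1 0 : ℝ) * (((u⁻¹ : ℝ) : ℂ) * Complex.I) + ((k * N) 1 1 : ℝ) : ℂ) ≠ 0 := by
      refine sl_denom_ne_zero _ ?_
      simpa using hu.ne'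
    simp only [T]
    rw [div_eq_div_iff h1 h2]
    push_cast
    field_simp
  have hT0 : T 0 = (((k * N) 0 0 / (k * N) 1 0 : ℝ) : ℂ) := by
    simp only [T]
    have : (((k * N) 1 0 : ℝ) : ℂ) ≠ 0 := by exact_mod_cast hφ10
    rw [Complex.ofReal_zero, mul_zero, mul_zero, add_zero, add_zero,
      mul_div_mul_right _ _ Complex.I_ne_zero, Complex.ofReal_div]
  refine ⟨T 0, by rw [hT0, Complex.ofReal_im], JoinedIn.trans (y := ((k • z' : ℍ) : ℂ)) ?_ ?_⟩
  · obtain ⟨γ, hγ⟩ := hj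
    refine ⟨⟨⟨fun x => ((k • γ x : ℍ) : ℂ), ?_⟩, ?_, ?_⟩, fun x => hcoe _ (hγ x)⟩
    · exact UpperHalfPlane.continuous_coe.comp (γ.continuous.const_smul k)
    · simp
    · simp
  · refine ⟨⟨⟨fun x => T (1 - (x : ℝ)), by fun_prop⟩, ?_, ?_⟩, fun x => ?_⟩
    · change T (1 - ((0 : I) : ℝ)) = _
      rw [hTu _ (by simp)]
      simp [hN0]
    · simp
    · change T (1 - (x : ℝ)) ∈ _
      rcases x.2.2.lt_or_eq with h | h
      · rw [hTu _ (sub_pos.mpr h)]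
        refine hcoe _ (hray _ ?_)
        rw [neg_nonneg]
        exact Real.log_nonpos (by linarith) (by linarith [x.2.1])
      · rw [h, sub_self, hT0]
        refine ⟨by simp, ?_, fun p hp e => ?_⟩
        · rintro ⟨v, -, e⟩
          have := congrArg Complex.im e
          exact (k • v).im_pos.ne' (by simpa using this)
        · have e' : (k * N) 0 0 / (k * N) 1 0 = p := by exact_mod_cast e
          rw [div_eq_iff hφ10] at e'
          exact hφF p hp e'

end GeneralPosition

/-! ### Edges of the lifted graph -/

theorem val_finRotate_of_lt {N : ℕ} (i : Fin N) (h : (i : ℕ) + 1 < N) :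
    ((finRotate N i : Fin N) : ℕ) = i + 1 := by
  obtain ⟨n, rfl⟩ : ∃ n, N = n + 1 := ⟨N - 1, by omega⟩
  exact coe_finRotate_of_ne_last (fun h' => by rw [h'] at h; simp at h)

theorem val_finRotate_of_eq {N : ℕ} (i : Fin N) (h : (i : ℕ) + 1 = N) :
    ((finRotate N i : Fin N) : ℕ) = 0 := by
  obtain ⟨n, rfl⟩ : ∃ n, N = n + 1 := ⟨N - 1, by omega⟩
  have : i = Fin.last n := Fin.ext (by simp; omega)
  rw [this, finRotate_last]
  rfl

namespace GeneralPosition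

variable {S : Type*} [TopologicalSpace S] {Y : HyperbolicStructure S} {c : ℝ → S} {r : ℕ}
  (P : GeneralPosition Y c r)

theorem time_injective : Function.Injective P.time := by
  intro q q' h
  obtain ⟨k, rfl⟩ := P.order.surjective q
  obtain ⟨k', rfl⟩ := P.order.surjective q'
  rw [P.strictMono.injective h]

theorem next_order (k : Fin (2 * r)) : P.next (P.order k) = P.order (finRotate (2 * r) k) := by
  simp [next]

theorem time_lt_endTime (q : Theta r) : P.time q < P.endTime q := by
  unfold endTime
  split_ifs with h
  · exact h
  · exact P.time_lt _ _

/-- There is no passage at a double point during a simple portion. -/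
theorem time_add_notMem_Ioo (q q' : Theta r) (m : ℤ) :
    P.time q' + m ∉ Set.Ioo (P.time q) (P.endTime q) := by
  rintro ⟨h1, h2⟩
  have a1 := P.time_lt q q'
  have a2 := P.time_lt q' q
  have a3 := P.time_lt (P.next q) q'
  have hm0 : 0 ≤ m := by
    by_contra! h
    have : (m : ℝ) ≤ -1 := by exact_mod_cast (by omega : m ≤ -1)
    linarith
  obtain ⟨i, rfl⟩ := P.order.surjective q
  obtain ⟨k, rfl⟩ := P.order.surjective q'
  have mono : ∀ a b : Fin (2 * r), a ≤ b → P.time (P.order a) ≤ P.time (P.order b) :=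
    fun a b h => P.strictMono.monotone h
  rw [P.next_order] at a3
  unfold endTime at h2
  rw [P.next_order] at h2
  by_cases hi : (i : ℕ) + 1 < 2 * r
  · have hrot := val_finRotate_of_lt i hi
    have hlt : P.time (P.order i) < P.time (P.order (finRotate (2 * r) i)) :=
      P.strictMono (Fin.lt_def.mpr (by omega))
    rw [if_pos hlt] at h2
    rcases hm0.eq_or_lt with rfl | hm
    · rw [Int.cast_zero, add_zero] at h1 h2
      have b1 : i < k := P.strictMono.lt_iff_lt.mp h1
      have b2 : k < finRotate (2 * r) i := P.strictMono.lt_iff_lt.mp h2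
      rw [Fin.lt_def] at b1 b2
      omega
    · have : (1 : ℝ) ≤ m := by exact_mod_cast hm
      linarith
  · have hrot := val_finRotate_of_eq i (by have := i.2; omega)
    have hge := mono (finRotate (2 * r) i) i (by rw [Fin.le_def]; omega)
    rw [if_neg (not_lt.mpr hge)] at h2
    have hk := k.2
    have b1 := mono k i (by rw [Fin.le_def]; omega)
    have b2 := mono (finRotate (2 * r) i) k (by rw [Fin.le_def]; omega)
    rcases hm0.eq_or_lt with rfl | hm
    · rw [Int.cast_zero, add_zero] at h1
      linarith
    · have : (1 : ℝ) ≤ m := by exact_mod_cast hm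
      linarith

/-- The lift of a simple portion. -/
def closedEdge (x : SL2 × Theta r) : Set ℍ :=
  (fun t => x.1 • P.lift t) '' Set.Icc (P.time x.2) (P.endTime x.2)

/-- The lift of a simple portion, without its endpoints. -/
def openEdge (x : SL2 × Theta r) : Set ℍ :=
  (fun t => x.1 • P.lift t) '' Set.Ioo (P.time x.2) (P.endTime x.2)

theorem closedEdge_subset_orbit {x : SL2 × Theta r} (hx : x.1 ∈ Y.group) :
    P.closedEdge x ⊆ P.orbit := by
  rintro _ ⟨t, -, rfl⟩
  exact ⟨x.1, hx, t, rfl⟩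

/-- A coincidence on the loop comes either from periodicity or from a double point. The second case
is impossible in the interior of a portion; in the first, starting times that differ modulo the
shift would put a passage inside a portion. -/
theorem edge_unique {x y : SL2 × Theta r} (hx : x.1 ∈ Y.group) (hy : y.1 ∈ Y.group) {t t' : ℝ}
    (ht : t ∈ Set.Ioo (P.time y.2) (P.endTime y.2))
    (ht' : t' ∈ Set.Icc (P.time x.2) (P.endTime x.2)) (h : x.1 • P.lift t' = y.1 • P.lift t) :
    t' = t ∧ x.2 = y.2 ∧ PMEq x.1 y.1 := by
  have hc : c t = c t' := by
    rw [← P.proj_lift t, ← P.proj_lift t']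
    refine (Y.proj_eq_iff _ (P.lift_mem_region t) _ (P.lift_mem_region t')).mpr
      ⟨x.1⁻¹ * y.1, mul_mem (inv_mem hx) hy, ?_⟩
    rw [mul_smul, ← h, inv_smul_smul]
  rcases P.eq_imp t t' hc with ⟨n, hn⟩ | ⟨q, m, n, h1, -⟩
  · have h0 : P.time x.2 + (-n : ℤ) = P.time y.2 := by
      push_cast
      by_contra hne
      rcases lt_or_gt_of_ne hne with h1 | h1
      · refine P.time_add_notMem_Ioo x.2 y.2 n ⟨by linarith, ?_⟩
        linarith [ht.1, ht'.2]
      · refine P.time_add_notMem_Ioo y.2 x.2 (-n) ⟨by push_cast; linarith, ?_⟩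
        push_cast
        linarith [ht.2, ht'.1]
    have a1 := P.time_lt x.2 y.2
    have a2 := P.time_lt y.2 x.2
    push_cast at h0
    have hn0 : n = 0 := by
      have h3 : ((-1 : ℤ) : ℝ) < n := by push_cast; linarith
      have h4 : (n : ℝ) < ((1 : ℤ) : ℝ) := by push_cast; linarith
      have h5 : -1 < n := by exact_mod_cast h3
      have h6 : n < 1 := by exact_mod_cast h4
      omega
    subst hn0
    simp only [Int.cast_zero, add_zero] at hn
    simp only [Int.cast_zero, neg_zero, add_zero] at h0
    subst hn
    exact ⟨rfl, P.time_injective h0, Y.pmEq_of_smul_eq hx hy (P.lift_mem_region _) h⟩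
  · exact absurd (h1 ▸ ht) (P.time_add_notMem_Ioo y.2 q m)

/-- The pairs which represent the same lift of a simple portion. -/
def EdgeEq (x y : SL2 × Theta r) : Prop := x.2 = y.2 ∧ PMEq x.1 y.1

theorem closedEdge_disjoint_openEdge {x y : SL2 × Theta r} (hx : x.1 ∈ Y.group)
    (hy : y.1 ∈ Y.group) (h : ¬ EdgeEq x y) {z : ℍ} (hz : z ∈ P.closedEdge x) :
    z ∉ P.openEdge y := by
  rintro ⟨t, ht, rfl⟩
  obtain ⟨t', ht', e⟩ := hz
  exact h (P.edge_unique hx hy ht ht' e).2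

theorem joinedIn_closedEdge {x : SL2 × Theta r} {H : Set ℍ} (hH : P.closedEdge x ⊆ H) :
    JoinedIn H (x.1 • P.lift (P.time x.2)) (x.1 • P.lift (P.endTime x.2)) := by
  have hle := (P.time_lt_endTime x.2).le
  have h1 : IsPathConnected (P.closedEdge x) :=
    ((convex_Icc _ _).isPathConnected ⟨P.time x.2, le_rfl, hle⟩).image
      (P.continuous_lift.const_smul x.1)
  exact (h1.joinedIn _ ⟨_, ⟨le_rfl, hle⟩, rfl⟩ _ ⟨_, ⟨hle, le_rfl⟩, rfl⟩).mono hH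

end GeneralPosition

/-! ### Ends of the lifted multi-curve -/

/-- The sequence `V` of points of the upper half-plane converges to the boundary point of
homogeneous coordinates `v`, along the orbit of a one-parameter group. -/
def TendsToEnd (V : ℕ → ℍ) (v : Fin 2 → ℝ) : Prop :=
  ∃ (M : SL2) (w : ℍ) (s : ℝ), 0 < s ∧ (∀ n : ℕ, V n = M • transl (n * s) • w) ∧
    v = (M : M2) *ᵥ ![1, 0]

/-- After division of numerator and denominator by exp(ns), only the first column of k M survives in
the limit. -/
theorem TendsToEnd.tendsto {V : ℕ → ℍ} {v : Fin 2 → ℝ} (h : TendsToEnd V v) (k : SL2)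
    (hk : ((k : M2) *ᵥ v) 1 ≠ 0) : Filter.Tendsto (fun n => ((k • V n : ℍ) : ℂ)) Filter.atTop
      (𝓝 ((((k : M2) *ᵥ v) 0 / ((k : M2) *ᵥ v) 1 : ℝ) : ℂ)) := by
  obtain ⟨M, w, s, hs, hV, rfl⟩ := h
  have e : (k : M2) *ᵥ (M : M2) *ᵥ ![1, 0] = ![(k * M) 0 0, (k * M) 1 0] := by
    rw [mulVec_mulVec, ← Matrix.SpecialLinearGroup.coe_mul]
    ext i
    fin_cases i <;> simp [mulVec, dotProduct, Fin.sum_univ_two]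
  rw [e] at hk ⊢
  simp only [cons_val_zero, cons_val_one] at hk ⊢
  set N := k * M with hN
  have hw : (w : ℂ) ≠ 0 := fun h => by
    have := congrArg Complex.im h
    exact w.im_pos.ne' this
  have hf : ∀ n : ℕ, ((k • V n : ℍ) : ℂ) = ((N 0 0 : ℝ) * (w : ℂ) + (N 0 1 : ℝ) *
      ((Real.exp (-(n * s)) : ℝ) : ℂ)) / ((N 1 0 : ℝ) * (w : ℂ) + (N 1 1 : ℝ) *
      ((Real.exp (-(n * s)) : ℝ) : ℂ)) := by
    intro n
    have h1 : ((transl (n * s) • w : ℍ) : ℂ) = ((Real.exp (n * s) : ℝ) : ℂ) * w := by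
      obtain ⟨a, b⟩ := transl_smul_re_im (n * s) w
      apply Complex.ext
      · simpa [-Complex.ofReal_exp] using a
      · simpa [-Complex.ofReal_exp] using b
    have h2 := sl_denom_ne_zero N (transl (n * s) • w).im_pos.ne'
    rw [hV, ← mul_smul k M, ← hN, coe_sl_smul]
    change ((N 1 0 : ℝ) * ((transl (n * s) • w : ℍ) : ℂ) + (N 1 1 : ℝ) : ℂ) ≠ 0 at h2
    rw [h1] at h2 ⊢
    rw [Real.exp_neg]
    have h3 : ((Real.exp (n * s) : ℝ) : ℂ) ≠ 0 := by exact_mod_cast (Real.exp_pos _).ne'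
    have h4 : ((N 1 0 : ℝ) * (w : ℂ) + (N 1 1 : ℝ) * (((Real.exp (n * s))⁻¹ : ℝ) : ℂ) : ℂ) =
        ((N 1 0 : ℝ) * (((Real.exp (n * s) : ℝ) : ℂ) * w) + (N 1 1 : ℝ)) *
          ((Real.exp (n * s) : ℝ) : ℂ)⁻¹ := by
      rw [Complex.ofReal_inv]
      generalize ((Real.exp (n * s) : ℝ) : ℂ) = x at *
      field_simp
    have h5 : ((N 0 0 : ℝ) * (w : ℂ) + (N 0 1 : ℝ) * (((Real.exp (n * s))⁻¹ : ℝ) : ℂ) : ℂ) =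
        ((N 0 0 : ℝ) * (((Real.exp (n * s) : ℝ) : ℂ) * w) + (N 0 1 : ℝ)) *
          ((Real.exp (n * s) : ℝ) : ℂ)⁻¹ := by
      rw [Complex.ofReal_inv]
      generalize ((Real.exp (n * s) : ℝ) : ℂ) = x at *
      field_simp
    rw [h4, h5, mul_div_mul_right _ _ (inv_ne_zero h3)]
  simp only [hf]
  have h6 : Filter.Tendsto (fun n : ℕ => Real.exp (-(n * s))) Filter.atTop (𝓝 0) :=
    Real.tendsto_exp_neg_atTop_nhds_zero.comp (tendsto_natCast_atTop_atTop.atTop_mul_const hs)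
  have hk' : ((N 1 0 : ℝ) : ℂ) ≠ 0 := by exact_mod_cast hk
  have h7 : ContinuousAt (fun x : ℝ => ((N 0 0 : ℝ) * (w : ℂ) + (N 0 1 : ℝ) * (x : ℂ)) /
      ((N 1 0 : ℝ) * (w : ℂ) + (N 1 1 : ℝ) * (x : ℂ))) 0 := by
    refine ContinuousAt.div (by fun_prop) (by fun_prop) ?_
    simpa using ⟨hk, hw⟩
  refine (h7.tendsto.comp h6).trans_eq ?_
  congr 1
  push_cast
  rw [mul_zero, mul_zero, add_zero, add_zero, mul_div_mul_right _ _ hw]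


theorem perm_apply_inv {α : Type*} (κ : Equiv.Perm α) (x : α) : κ (κ⁻¹ x) = x :=
  κ.apply_symm_apply x

/-- The sum over N steps is invariant along the cycle since κ ^ N = 1. Summing it over the cycle
gives N times the cycle sum, which fixes its sign. -/
theorem sum_iterate_pos {α : Type*} [Fintype α] [DecidableEq α] (κ : Equiv.Perm α) (f : α → ℝ)
    (q : α) (N : ℕ) (hN0 : 0 < N) (hN : κ ^ N = 1)
    (h : 0 < ∑ q' ∈ Finset.univ.filter (fun q' => κ.SameCycle q q'), f q') :
    0 < ∑ i ∈ Finset.range N, f ((κ ^ i) q) := by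
  set s : α → ℝ := fun q => ∑ i ∈ Finset.range N, f ((κ ^ i) q) with hs
  have h1 : ∀ q, s (κ q) = s q := by
    intro q
    have e1 := Finset.sum_range_succ (fun i => f ((κ ^ i) q)) N
    have e2 := Finset.sum_range_succ' (fun i => f ((κ ^ i) q)) N
    simp only [hN, pow_succ, Equiv.Perm.mul_apply, pow_zero, Equiv.Perm.one_apply] at e1 e2
    simp only [hs]
    linarith
  have h2 : ∀ (n : ℕ) q, s ((κ ^ n) q) = s q := by
    intro n
    induction n with
    | zero => intro q; simp
    | succ n ih => intro q; rw [pow_succ, Equiv.Perm.mul_apply, ih, h1]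
  set C := Finset.univ.filter fun q' => κ.SameCycle q q' with hC
  have hqC : q ∈ C := by simp [hC, Equiv.Perm.SameCycle.refl]
  have h3 : ∑ q' ∈ C, s q' = C.card * s q := by
    rw [← nsmul_eq_mul]
    refine Finset.sum_eq_card_nsmul fun q' hq' => ?_
    obtain ⟨n, -, hn⟩ := (Finset.mem_filter.mp hq').2.exists_pow_eq'
    rw [← hn, h2]
  have h4 : ∑ q' ∈ C, s q' = N * ∑ q' ∈ C, f q' := by
    simp only [hs]
    have hi : ∀ i ∈ Finset.range N, ∑ q' ∈ C, f ((κ ^ i) q') = ∑ q' ∈ C, f q' := ?_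
    · rw [Finset.sum_comm, Finset.sum_congr rfl hi, Finset.sum_const, Finset.card_range,
        nsmul_eq_mul]
    intro i _
    refine Finset.sum_equiv (κ ^ i) (fun q' => ?_) fun q' _ => rfl
    simp [hC]
  have h5 : 0 < (C.card : ℝ) * s q := by
    rw [← h3, h4]
    positivity
  have h6 : (0 : ℝ) < C.card := by exact_mod_cast Finset.card_pos.mpr ⟨q, hqC⟩
  exact (mul_pos_iff_of_pos_left h6).mp h5

theorem transl_pmEq_one {s : ℝ} (h : PMEq (transl s) 1) : s = 0 := by
  have h1 : |trace (transl s : M2)| = |trace ((1 : SL2) : M2)| := h.abs_trace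
  rw [trace_transl, abs_of_pos (by positivity)] at h1
  simp at h1
  have h2 : Real.cosh (s / 2) = Real.cosh 0 := by rw [Real.cosh_zero]; linarith
  by_contra hne
  rw [Real.cosh_zero] at h2
  exact (Real.one_lt_cosh.mpr (by simpa using hne)).ne' h2

/-- `e` can be joined within `H` to points which tend to the boundary point of homogeneous
coordinates `v`. -/
def ReachesBoundary (H : Set ℍ) (e : ℍ) (v : Fin 2 → ℝ) : Prop :=
  ∃ V : ℕ → ℍ, TendsToEnd V v ∧ ∀ n, JoinedIn H e (V n)

namespace LiftedDiagram

variable {S : Type*} [TopologicalSpace S] {Y : HyperbolicStructure S} {c : ℝ → S} {r : ℕ}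
  {P : GeneralPosition Y c r} {L : Fin r → ℝ} {θ : Theta r → ℝ} (D : LiftedDiagram P L θ)

/-- The lift of a simple portion which comes next on the multi-curve. -/
def betaStep : Equiv.Perm (SL2 × Theta r) where
  toFun x := (x.1 * D.cont x.2, P.nextOnBeta x.2)
  invFun x := (x.1 * (D.cont (P.nextOnBeta.symm x.2))⁻¹, P.nextOnBeta.symm x.2)
  left_inv x := by simp
  right_inv x := by simp

/-- The frame of the line that carries a lifted portion of the geodesic diagram. -/
def lineFrame (x : SL2 × Theta r) : SL2 := x.1 * D.frame x.2

theorem betaStep_fst_mem {x : SL2 × Theta r} : (D.betaStep x).1 ∈ Y.group ↔ x.1 ∈ Y.group :=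
  mul_mem_cancel_right (D.cont_mem x.2)

theorem betaStep_zpow_fst_mem {x : SL2 × Theta r} (hx : x.1 ∈ Y.group) (n : ℤ) :
    ((D.betaStep ^ n) x).1 ∈ Y.group := by
  induction n with
  | zero => simpa using hx
  | succ n ih => rw [add_comm, _root_.zpow_add, zpow_one, Equiv.Perm.mul_apply, D.betaStep_fst_mem]; exact ih
  | pred n ih =>
    rw [← D.betaStep_fst_mem, ← Equiv.Perm.mul_apply, ← _root_.zpow_one_add]
    rwa [add_sub_cancel]

theorem lineFrame_betaStep (x : SL2 × Theta r) :
    PMEq (D.lineFrame x * transl (θ x.2)) (D.lineFrame (D.betaStep x)) := by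
  have := (D.cont_frame x.2).mul_left x.1
  rwa [← mul_assoc, ← mul_assoc] at this

theorem start_betaStep (x : SL2 × Theta r) :
    (D.betaStep x).1 • P.lift (P.time (D.betaStep x).2) = x.1 • P.lift (P.endTime x.2) := by
  rw [← D.cont_smul, ← mul_smul]
  rfl

theorem betaStep_pow_snd (n : ℕ) (x : SL2 × Theta r) :
    ((D.betaStep ^ n) x).2 = (P.nextOnBeta ^ n) x.2 := by
  induction n with
  | zero => rfl
  | succ n ih => rw [pow_succ', pow_succ', Equiv.Perm.mul_apply, Equiv.Perm.mul_apply, ← ih]; rfl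

theorem lineFrame_betaStep_pow (n : ℕ) (x : SL2 × Theta r) :
    PMEq (D.lineFrame x * transl (∑ i ∈ Finset.range n, θ ((P.nextOnBeta ^ i) x.2)))
      (D.lineFrame ((D.betaStep ^ n) x)) := by
  induction n with
  | zero => simpa [transl_zero] using PMEq.refl _
  | succ n ih =>
    rw [Finset.sum_range_succ, ← transl_mul, ← mul_assoc, pow_succ', Equiv.Perm.mul_apply,
      ← D.betaStep_pow_snd]
    exact (ih.mul_right _).trans (D.lineFrame_betaStep _)

/-- After finitely many steps, one follows the closed geodesic a whole number of times. -/
theorem exists_period (q : Theta r) : ∃ (N : ℕ) (s : ℝ), 0 < N ∧ 0 < s ∧ ∀ x : SL2 × Theta r,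
    x.2 = q → ∀ n : ℤ, ((D.betaStep ^ (N * n)) x).2 = q ∧
      PMEq (D.lineFrame x * transl (n * s)) (D.lineFrame ((D.betaStep ^ (N * n)) x)) := by
  classical
  -- The order is a common multiple of the cycle lengths, so N steps go around a whole number of
  -- times.
  set N := orderOf P.nextOnBeta with hN
  have hN0 : 0 < N := orderOf_pos _
  have hN1 : P.nextOnBeta ^ N = 1 := pow_orderOf_eq_one _
  set s := ∑ i ∈ Finset.range N, θ ((P.nextOnBeta ^ i) q) with hs
  have hs0 : 0 < s := by
    refine sum_iterate_pos _ _ _ _ hN0 hN1 ?_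
    have := D.beta_pos q
    unfold GeneralPosition.betaLength at this
    convert this
  have hone : ∀ x : SL2 × Theta r, x.2 = q → ((D.betaStep ^ N) x).2 = q ∧
      PMEq (D.lineFrame x * transl s) (D.lineFrame ((D.betaStep ^ N) x)) := by
    rintro x rfl
    refine ⟨by rw [D.betaStep_pow_snd, hN1]; rfl, D.lineFrame_betaStep_pow N x⟩
  have hinv : ∀ x : SL2 × Theta r, x.2 = q → (((D.betaStep ^ N)⁻¹) x).2 = q := by
    intro x hx
    have := D.betaStep_pow_snd N ((D.betaStep ^ N)⁻¹ x)
    rw [hN1, perm_apply_inv] at this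
    rw [← hx, this]
    rfl
  refine ⟨N, s, hN0, hs0, fun x hx n => ?_⟩
  rw [_root_.zpow_mul, zpow_natCast]
  induction n with
  | zero => exact ⟨hx, by simpa [transl_zero] using PMEq.refl _⟩
  | succ n ih =>
    obtain ⟨h1, h2⟩ := hone _ ih.1
    rw [add_comm, _root_.zpow_add, zpow_one, Equiv.Perm.mul_apply]
    refine ⟨h1, ?_⟩
    have e : ((1 + (n : ℤ) : ℤ) : ℝ) * s = n * s + s := by push_cast; ring
    rw [e, ← transl_mul, ← mul_assoc]
    exact (ih.2.mul_right _).trans h2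
  | pred n ih =>
    have h0 := hinv _ ih.1
    obtain ⟨-, h2⟩ := hone _ h0
    rw [perm_apply_inv] at h2
    rw [sub_eq_neg_add, _root_.zpow_add, _root_.zpow_neg_one, Equiv.Perm.mul_apply]
    refine ⟨h0, ?_⟩
    have e : ((-1 + -(n : ℤ) : ℤ) : ℝ) * s = (-(n : ℤ) : ℤ) * s + -s := by push_cast; ring
    rw [e, ← transl_mul, ← mul_assoc]
    have h3 := (ih.2.trans h2.symm).mul_right (transl (-s))
    rwa [mul_assoc (D.lineFrame _) (transl s), transl_mul, add_neg_cancel, transl_zero, mul_one] at h3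

theorem lineFrame_betaStep_zpow (n : ℤ) (x : SL2 × Theta r) :
    ∃ s, PMEq (D.lineFrame x * transl s) (D.lineFrame ((D.betaStep ^ n) x)) := by
  rcases Int.eq_nat_or_neg n with ⟨m, rfl | rfl⟩
  · rw [zpow_natCast]
    exact ⟨_, D.lineFrame_betaStep_pow m x⟩
  · set y := (D.betaStep ^ (-(m : ℤ))) x with hy
    have hyx : (D.betaStep ^ m) y = x := by
      rw [hy, _root_.zpow_neg, zpow_natCast, perm_apply_inv]
    have h := D.lineFrame_betaStep_pow m y
    rw [hyx] at h
    refine ⟨-∑ i ∈ Finset.range m, θ ((P.nextOnBeta ^ i) y.2), ?_⟩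
    have h3 := h.symm.mul_right (transl (-∑ i ∈ Finset.range m, θ ((P.nextOnBeta ^ i) y.2)))
    rwa [mul_assoc, transl_mul, add_neg_cancel, transl_zero, mul_one] at h3

theorem edgeEq_betaStep {x y : SL2 × Theta r} (h : GeneralPosition.EdgeEq x y) :
    GeneralPosition.EdgeEq (D.betaStep x) (D.betaStep y) := by
  obtain ⟨h1, h2⟩ := h
  refine ⟨congrArg P.nextOnBeta h1, ?_⟩
  change PMEq (x.1 * D.cont x.2) (y.1 * D.cont y.2)
  rw [h1]
  exact h2.mul_right _

theorem lineFrame_of_edgeEq {x y : SL2 × Theta r} (h : GeneralPosition.EdgeEq x y) :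
    PMEq (D.lineFrame x) (D.lineFrame y) := by
  unfold lineFrame
  rw [h.1]
  exact h.2.mul_right _

/-- The multi-curve does not come back to the same lift of a simple portion. -/
theorem not_edgeEq_betaStep_pow {n : ℕ} (hn : n ≠ 0) (x : SL2 × Theta r) :
    ¬ GeneralPosition.EdgeEq ((D.betaStep ^ n) x) x := by
  intro h
  -- A return after n steps would recur after nN steps, where the frame has moved by ns > 0 along
  -- its line: a contradiction.
  have hk : ∀ k : ℕ, GeneralPosition.EdgeEq ((D.betaStep ^ (n * k)) x) x := by
    have hs : ∀ (m : ℕ) {y z : SL2 × Theta r}, GeneralPosition.EdgeEq y z →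
        GeneralPosition.EdgeEq ((D.betaStep ^ m) y) ((D.betaStep ^ m) z) := by
      intro m
      induction m with
      | zero => exact fun h => h
      | succ m ih =>
        intro y z h
        rw [pow_succ, Equiv.Perm.mul_apply, Equiv.Perm.mul_apply]
        exact ih (D.edgeEq_betaStep h)
    intro k
    induction k with
    | zero => exact ⟨rfl, PMEq.refl _⟩
    | succ k ih =>
      rw [mul_add, mul_one, add_comm, pow_add, Equiv.Perm.mul_apply]
      have := hs n ih
      exact ⟨this.1.trans h.1, this.2.trans h.2⟩
  obtain ⟨N, s, hN, hs, H⟩ := D.exists_period x.2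
  obtain ⟨-, h1⟩ := H x rfl n
  have h2 := D.lineFrame_of_edgeEq (hk N)
  rw [show (N : ℤ) * (n : ℤ) = ((n * N : ℕ) : ℤ) by push_cast; ring, zpow_natCast] at h1
  have h3 := (h1.trans h2).mul_left (D.lineFrame x)⁻¹
  rw [inv_mul_cancel_left, inv_mul_cancel] at h3
  have h4 := transl_pmEq_one h3
  have : (0 : ℝ) < n := by exact_mod_cast Nat.pos_of_ne_zero hn
  have h5 : ((n : ℤ) : ℝ) * s = n * s := by push_cast; rfl
  rw [h5] at h4
  exact (mul_pos this hs).ne' h4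

theorem not_edgeEq_betaStep_neg {n : ℕ} (hn : n ≠ 0) (x : SL2 × Theta r) :
    ¬ GeneralPosition.EdgeEq ((D.betaStep ^ (-(n : ℤ))) x) x := by
  intro h
  set y := (D.betaStep ^ (-(n : ℤ))) x with hy
  have hyx : (D.betaStep ^ n) y = x := by
    rw [hy, _root_.zpow_neg, zpow_natCast, perm_apply_inv]
  refine D.not_edgeEq_betaStep_pow hn y ?_
  rw [hyx]
  exact ⟨h.1.symm, h.2.symm⟩

/-- Following the multi-curve forward, one reaches the forward end of the corresponding line. -/
theorem reachesBoundary_forward {x : SL2 × Theta r} {H : Set ℍ}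
    (hH : ∀ n : ℕ, n ≠ 0 → P.closedEdge ((D.betaStep ^ n) x) ⊆ H) :
    ReachesBoundary H (x.1 • P.lift (P.endTime x.2)) ((D.lineFrame x : M2) *ᵥ ![1, 0]) := by
  obtain ⟨N, s, hN, hs, hper⟩ := D.exists_period x.2
  have hj : ∀ n : ℕ, JoinedIn H (x.1 • P.lift (P.endTime x.2))
      (((D.betaStep ^ (n + 1)) x).1 • P.lift (P.time ((D.betaStep ^ (n + 1)) x).2)) := by
    intro n
    induction n with
    | zero =>
      rw [zero_add, pow_one, D.start_betaStep]
      refine JoinedIn.refl (hH 1 one_ne_zero ?_)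
      refine ⟨_, ⟨le_rfl, (P.time_lt_endTime _).le⟩, ?_⟩
      rw [pow_one]
      exact D.start_betaStep x
    | succ n ih =>
      refine ih.trans ?_
      rw [pow_succ' _ (n + 1), Equiv.Perm.mul_apply, D.start_betaStep]
      exact P.joinedIn_closedEdge (hH (n + 1) (Nat.succ_ne_zero n))
  have hj' : ∀ n : ℕ, n ≠ 0 → JoinedIn H (x.1 • P.lift (P.endTime x.2))
      (((D.betaStep ^ n) x).1 • P.lift (P.time ((D.betaStep ^ n) x).2)) := by
    intro n hn
    obtain ⟨m, rfl⟩ := Nat.exists_eq_succ_of_ne_zero hn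
    exact hj m
  -- The index n + 1 avoids the edge of x itself, which need not be contained in H.
  refine ⟨fun n => ((D.betaStep ^ (N * (n + 1))) x).1 •
    P.lift (P.time ((D.betaStep ^ (N * (n + 1))) x).2), ⟨D.lineFrame x, transl s • (D.frame x.2)⁻¹ •
      P.lift (P.time x.2), s, hs, fun n => ?_, rfl⟩,
    fun n => hj' _ (Nat.mul_ne_zero hN.ne' (Nat.succ_ne_zero n))⟩
  obtain ⟨h1, h2⟩ := hper x rfl ((n + 1 : ℕ) : ℤ)
  rw [show (N : ℤ) * ((n + 1 : ℕ) : ℤ) = ((N * (n + 1) : ℕ) : ℤ) by push_cast; ring,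
    zpow_natCast] at h1 h2
  rw [← mul_smul (transl _) (transl s), transl_mul, ← mul_smul,
    show (n : ℝ) * s + s = ((n + 1 : ℕ) : ℤ) * s by push_cast; ring, h2.smul]
  unfold lineFrame
  simp only [h1, mul_smul, smul_inv_smul]

/-- The matrix of the quarter turn which exchanges the ends of the imaginary axis. -/
def reverse : SL2 := ⟨!![0, -1; 1, 0], by rw [det_fin_two_of]; norm_num⟩

theorem transl_mul_reverse (s : ℝ) : transl s * reverse = reverse * transl (-s) := by
  refine Matrix.SpecialLinearGroup.ext _ _ fun i j => ?_
  rw [Matrix.SpecialLinearGroup.coe_mul, Matrix.SpecialLinearGroup.coe_mul]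
  fin_cases i <;> fin_cases j <;> simp [transl, reverse, neg_div]

/-- Following the multi-curve backward, one reaches the backward end of the corresponding line. -/
theorem reachesBoundary_backward {x : SL2 × Theta r} {H : Set ℍ}
    (hH : ∀ n : ℕ, n ≠ 0 → P.closedEdge ((D.betaStep ^ (-(n : ℤ))) x) ⊆ H) :
    ReachesBoundary H (x.1 • P.lift (P.time x.2)) ((D.lineFrame x : M2) *ᵥ ![0, 1]) := by
  obtain ⟨N, s, hN, hs, hper⟩ := D.exists_period x.2
  have hstep : ∀ n : ℕ, D.betaStep ((D.betaStep ^ (-((n + 1 : ℕ) : ℤ))) x) =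
      (D.betaStep ^ (-(n : ℤ))) x := by
    intro n
    rw [← Equiv.Perm.mul_apply, ← _root_.zpow_one_add]
    congr 2
    push_cast
    ring
  have hj : ∀ n : ℕ, JoinedIn H (x.1 • P.lift (P.time x.2))
      (((D.betaStep ^ (-((n + 1 : ℕ) : ℤ))) x).1 •
        P.lift (P.time ((D.betaStep ^ (-((n + 1 : ℕ) : ℤ))) x).2)) := by
    intro n
    have h1 := (P.joinedIn_closedEdge (hH (n + 1) (Nat.succ_ne_zero n))).symm
    rw [← D.start_betaStep, hstep] at h1
    induction n with
    | zero =>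
      have h0 : (D.betaStep ^ (-((0 : ℕ) : ℤ))) x = x := by simp
      rw [h0] at h1
      exact h1
    | succ n ih =>
      refine (ih ?_).trans h1
      have h2 := (P.joinedIn_closedEdge (hH (n + 1) (Nat.succ_ne_zero n))).symm
      rwa [← D.start_betaStep, hstep] at h2
  have hj' : ∀ n : ℕ, n ≠ 0 → JoinedIn H (x.1 • P.lift (P.time x.2))
      (((D.betaStep ^ (-(n : ℤ))) x).1 • P.lift (P.time ((D.betaStep ^ (-(n : ℤ))) x).2)) := by
    intro n hn
    obtain ⟨m, rfl⟩ := Nat.exists_eq_succ_of_ne_zero hn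
    exact hj m
  -- Conjugation by `reverse` turns the backward translations into forward ones, as `TendsToEnd`
  -- requires.
  refine ⟨fun n => ((D.betaStep ^ (-((N * (n + 1) : ℕ) : ℤ))) x).1 •
    P.lift (P.time ((D.betaStep ^ (-((N * (n + 1) : ℕ) : ℤ))) x).2), ⟨D.lineFrame x * reverse,
      transl s • reverse⁻¹ • (D.frame x.2)⁻¹ • P.lift (P.time x.2), s, hs, fun n => ?_, ?_⟩,
    fun n => hj' _ (Nat.mul_ne_zero hN.ne' (Nat.succ_ne_zero n))⟩
  · obtain ⟨h1, h2⟩ := hper x rfl (-((n + 1 : ℕ) : ℤ))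
    rw [show (N : ℤ) * -((n + 1 : ℕ) : ℤ) = -((N * (n + 1) : ℕ) : ℤ) by push_cast; ring] at h1 h2
    have e : (D.lineFrame x * reverse) * (transl (n * s) * transl s) * reverse⁻¹ =
        D.lineFrame x * transl ((-((n + 1 : ℕ) : ℤ) : ℤ) * s) := by
      rw [transl_mul, mul_assoc (D.lineFrame x) reverse,
        show (n : ℝ) * s + s = -((-((n + 1 : ℕ) : ℤ) : ℤ) * s) by push_cast; ring,
        ← transl_mul_reverse, mul_assoc, mul_inv_cancel_right]
    rw [← mul_smul (transl _) (transl s), ← mul_smul, ← mul_smul, e, h2.smul]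
    unfold lineFrame
    simp only [h1, mul_smul, smul_inv_smul]
  · rw [Matrix.SpecialLinearGroup.coe_mul, ← mulVec_mulVec]
    congr 1
    ext i
    fin_cases i <;> simp [reverse, mulVec, dotProduct, Fin.sum_univ_two]

end LiftedDiagram

/-! ### Cyclic order of the ends at a lifted double point -/

theorem hasStrictDerivAt_smul (g : SL2) {f : ℝ → ℍ} {v : ℂ} {t : ℝ}
    (hf : HasStrictDerivAt (fun s => (f s : ℂ)) v t) :
    HasStrictDerivAt (fun s => ((g • f s : ℍ) : ℂ))
      (v / ((g 1 0 : ℝ) * (f t : ℂ) + (g 1 1 : ℝ)) ^ 2) t := by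
  have hden := sl_denom_ne_zero g (f t).im_pos.ne'
  have h1 : HasStrictDerivAt (fun s => ((g 0 0 : ℝ) * (f s : ℂ) + (g 0 1 : ℝ)) /
      ((g 1 0 : ℝ) * (f s : ℂ) + (g 1 1 : ℝ)))
      ((((g 0 0 : ℝ) * v) * ((g 1 0 : ℝ) * (f t : ℂ) + (g 1 1 : ℝ)) -
        ((g 0 0 : ℝ) * (f t : ℂ) + (g 0 1 : ℝ)) * ((g 1 0 : ℝ) * v)) /
        ((g 1 0 : ℝ) * (f t : ℂ) + (g 1 1 : ℝ)) ^ 2) t :=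
    ((hf.const_mul _).add_const _).fun_div ((hf.const_mul _).add_const _) hden
  have h2 : (fun s => ((g • f s : ℍ) : ℂ)) = fun s => ((g 0 0 : ℝ) * (f s : ℂ) + (g 0 1 : ℝ)) /
      ((g 1 0 : ℝ) * (f s : ℂ) + (g 1 1 : ℝ)) := funext fun s => coe_sl_smul _ _
  rw [h2]
  refine h1.congr_deriv ?_
  congr 1
  have hd : ((g 0 0 : ℝ) : ℂ) * (g 1 1 : ℝ) - (g 0 1 : ℝ) * (g 1 0 : ℝ) = 1 := by
    exact_mod_cast sl_det g
  linear_combination v * hd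

/-- The determinant of two vectors of the plane. -/
def planeDet (v w : Fin 2 → ℝ) : ℝ := v 0 * w 1 - v 1 * w 0

theorem planeDet_mulVec (g : SL2) (v w : Fin 2 → ℝ) :
    planeDet ((g : M2) *ᵥ v) ((g : M2) *ᵥ w) = planeDet v w := by
  simp only [planeDet, mulVec, dotProduct, Fin.sum_univ_two]
  linear_combination (v 0 * w 1 - v 1 * w 0) * sl_det g

/-- Finitely many boundary points can be moved away from infinity, so that real coordinates are
available for all of them. -/
theorem exists_finite_position (F : Finset (Fin 2 → ℝ)) (hF : ∀ v ∈ F, v ≠ 0) :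
    ∃ k : SL2, ∀ v ∈ F, ((k : M2) *ᵥ v) 1 ≠ 0 := by
  have hfin : (⋃ v ∈ F, {t : ℝ | v 0 + t * v 1 = 0}).Finite := by
    refine F.finite_toSet.biUnion fun v hv => Set.Subsingleton.finite ?_
    intro t ht t' ht'
    have h1 : v 0 + t * v 1 = 0 := ht
    have h2 : v 0 + t' * v 1 = 0 := ht'
    by_contra hne
    have h3 : v 1 = 0 := mul_left_cancel₀ (sub_ne_zero.mpr hne) (by linear_combination h1 - h2)
    rw [h3, mul_zero, add_zero] at h1
    exact hF v hv (by ext i; fin_cases i <;> simp [h1, h3])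
  obtain ⟨t, ht⟩ := hfin.infinite_compl.nonempty
  refine ⟨⟨!![0, -1; 1, t], by rw [det_fin_two_of]; norm_num⟩, fun v hv h => ht ?_⟩
  refine Set.mem_biUnion hv ?_
  simp [mulVec, dotProduct, Fin.sum_univ_two] at h
  exact h

theorem ReachesBoundary.reachesEnd {H : Set ℍ} {e : ℍ} {v : Fin 2 → ℝ}
    (h : ReachesBoundary H e v) (k : SL2) (hk : ((k : M2) *ᵥ v) 1 ≠ 0) :
    ReachesEnd ((fun z : ℍ => ((k • z : ℍ) : ℂ)) '' H) ((k • e : ℍ) : ℂ)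
      (((k : M2) *ᵥ v) 0 / ((k : M2) *ᵥ v) 1) := by
  obtain ⟨V, hV, hj⟩ := h
  refine ⟨fun n => ((k • V n : ℍ) : ℂ), hV.tendsto k hk, fun n => ?_⟩
  obtain ⟨γ, hγ⟩ := hj n
  exact ⟨⟨⟨fun x => ((k • γ x : ℍ) : ℂ),
    UpperHalfPlane.continuous_coe.comp (γ.continuous.const_smul k)⟩, by simp, by simp⟩,
    fun x => ⟨γ x, hγ x, rfl⟩⟩

theorem ReachesBoundary.ne_zero {H : Set ℍ} {e : ℍ} {v : Fin 2 → ℝ}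
    (h : ReachesBoundary H e v) : v ≠ 0 := by
  obtain ⟨V, ⟨M, w, s, -, -, rfl⟩, -⟩ := h
  intro h0
  have h1 := planeDet_mulVec M ![1, 0] ![0, 1]
  rw [h0] at h1
  simp [planeDet] at h1

theorem smul_coe_injective (k : SL2) : Function.Injective fun z : ℍ => ((k • z : ℍ) : ℂ) :=
  fun _ _ h => smul_left_cancel k (UpperHalfPlane.ext h)

namespace LiftedDiagram

variable {S : Type*} [TopologicalSpace S] {Y : HyperbolicStructure S} {c : ℝ → S} {r : ℕ}
  {P : GeneralPosition Y c r} {L : Fin r → ℝ} {θ : Theta r → ℝ} (D : LiftedDiagram P L θ)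

theorem hasStrictDerivAt_lift (t : ℝ) :
    HasStrictDerivAt (fun s => (P.lift s : ℂ)) (tangent P.lift t) t :=
  P.contDiff.contDiffAt.hasStrictDerivAt one_ne_zero

/-- Exactly two strands pass through a lifted double point. -/
theorem strands {j : Fin r} {g : SL2} (hg : g ∈ Y.group) {t : ℝ}
    (h : g • P.lift t = P.lift (P.time (j, -1))) :
    (∃ n : ℤ, t = P.time (j, -1) + n ∧ ∀ s, g • P.lift s = P.lift (s - n)) ∨
      ∃ n : ℤ, t = P.time (j, 1) + n ∧ ∀ s, g • P.lift s = D.opp j • P.lift (s - n) := by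
  have hc : c (P.time (j, -1)) = c t := by
    rw [← P.proj_lift, ← P.proj_lift]
    exact ((Y.proj_eq_iff _ (P.lift_mem_region _) _ (P.lift_mem_region _)).mpr ⟨g, hg, h⟩).symm
  have key : ∀ (a : ℝ) (n : ℤ) (f : SL2), f ∈ Y.group → t = a + n →
      f • P.lift a = P.lift (P.time (j, -1)) → ∀ s, g • P.lift s = f • P.lift (s - n) := by
    intro a n f hf ht hfa s
    obtain ⟨d, hd, hdl⟩ := P.exists_deck_zpow n
    have h1 : PMEq (g * d) f := by
      refine Y.pmEq_of_smul_eq (mul_mem hg hd) hf (P.lift_mem_region a) ?_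
      rw [mul_smul, hdl, ← ht, h, hfa]
    rw [← h1.smul, mul_smul, hdl, sub_add_cancel]
  rcases P.eq_imp _ _ hc with ⟨n, hn⟩ | ⟨q, m, n, hm, hn⟩
  · refine Or.inl ⟨n, hn, fun s => ?_⟩
    rw [key _ n 1 (one_mem _) hn (one_smul _ _), one_smul]
  · have a1 := P.time_lt q (j, -1)
    have a2 := P.time_lt (j, -1) q
    have hm0 : m = 0 := by
      have b1 : (m : ℝ) < 1 := by linarith
      have b2 : (-1 : ℝ) < m := by linarith
      have b1' : m < 1 := by exact_mod_cast b1
      have b2' : -1 < m := by exact_mod_cast b2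
      omega
    rw [hm0, Int.cast_zero, add_zero] at hm
    have hq := P.time_injective hm
    rw [← hq] at hn
    have hn' : t = P.time (j, 1) + n := by simpa [Theta.flip] using hn
    exact Or.inr ⟨n, hn', key _ n _ (D.opp_mem j) hn' (D.opp_smul j)⟩

/-- The boundary points reached after the two lifted portions which start at a double point, and the
one reached from this point itself without following them, are in the cyclic order prescribed by the
transversality of the strands. -/
theorem cyclic_order (hfill : IsFilling c) (hEight : IsGeneralizedEight c) (j : Fin r)
    {v₁ v₂ v₃ : Fin 2 → ℝ}
    (h₁ : ReachesBoundary (P.orbit \ P.openEdge (1, (j, -1))) (P.lift (P.endTime (j, -1))) v₁)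
    (h₂ : ReachesBoundary (P.orbit \ P.openEdge (D.opp j, (j, 1)))
      (D.opp j • P.lift (P.endTime (j, 1))) v₂)
    (h₃ : ReachesBoundary (P.orbit \ (P.openEdge (1, (j, -1)) ∪ P.openEdge (D.opp j, (j, 1))))
      (P.lift (P.time (j, -1))) v₃) :
    0 < planeDet v₁ v₂ * planeDet v₂ v₃ * planeDet v₃ v₁ := by
  obtain ⟨k, hk⟩ := exists_finite_position {v₁, v₂, v₃} (by
    intro v hv
    simp only [Finset.mem_insert, Finset.mem_singleton] at hv
    rcases hv with rfl | rfl | rfl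
    exacts [h₁.ne_zero, h₂.ne_zero, h₃.ne_zero])
  have hk1 := hk v₁ (by simp)
  have hk2 := hk v₂ (by simp)
  have hk3 := hk v₃ (by simp)
  set o := P.lift (P.time (j, -1)) with ho
  have hopp := D.opp_smul j
  set Φ : ℍ → ℂ := fun z => ((k • z : ℍ) : ℂ) with hΦ
  have hΦi : Function.Injective Φ := smul_coe_injective k
  have hΦc : Continuous Φ := UpperHalfPlane.continuous_coe.comp (continuous_const_smul k)
  set G := Φ '' P.orbit with hG
  have hd₁ := hasStrictDerivAt_smul k (hasStrictDerivAt_lift (P := P) (P.time (j, -1)))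
  have hd₂ := hasStrictDerivAt_smul k (f := fun t => D.opp j • P.lift t)
    (v := tangent (fun t => D.opp j • P.lift t) (P.time (j, 1))) (t := P.time (j, 1)) (by
      have h := hasStrictDerivAt_smul (D.opp j) (hasStrictDerivAt_lift (P := P) (P.time (j, 1)))
      unfold tangent at h ⊢
      rwa [h.hasDerivAt.deriv])
  rw [hopp] at hd₂
  rw [← ho] at hd₁
  set den : ℂ := ((k 1 0 : ℝ) * (o : ℂ) + (k 1 1 : ℝ)) with hden
  have hden0 : den ≠ 0 := sl_denom_ne_zero k o.im_pos.ne'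
  -- The isometry k multiplies both tangent vectors at o by the same complex number, so the
  -- orientation is kept.
  have hv : 0 < (conj (tangent P.lift (P.time (j, -1)) / den ^ 2) *
      (tangent (fun t => D.opp j • P.lift t) (P.time (j, 1)) / den ^ 2)).im := by
    have e : conj (tangent P.lift (P.time (j, -1)) / den ^ 2) *
        (tangent (fun t => D.opp j • P.lift t) (P.time (j, 1)) / den ^ 2) =
        ((1 / Complex.normSq (den ^ 2) : ℝ) : ℂ) * (conj (tangent P.lift (P.time (j, -1))) *
          tangent (fun t => D.opp j • P.lift t) (P.time (j, 1))) := by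
      rw [map_div₀, Complex.ofReal_div, Complex.normSq_eq_conj_mul_self, Complex.ofReal_one]
      have h1 : den ^ 2 ≠ 0 := pow_ne_zero 2 hden0
      have h2 : conj (den ^ 2) ≠ 0 := (map_ne_zero _).mpr h1
      generalize den ^ 2 = x at *
      field_simp
    rw [e, Complex.im_ofReal_mul]
    exact mul_pos (one_div_pos.mpr (Complex.normSq_pos.mpr (pow_ne_zero 2 hden0))) (D.opp_pos j)
  have hemb : Topology.IsOpenEmbedding Φ :=
    UpperHalfPlane.isOpenEmbedding_coe.comp (Homeomorph.smul k).isOpenEmbedding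
  have hor : ∀ {g : SL2}, g ∈ Y.group → ∀ t, g • P.lift t ∈ P.orbit := fun hg t => ⟨_, hg, t, rfl⟩
  have hor1 : ∀ t, P.lift t ∈ P.orbit := fun t => by simpa using hor (one_mem _) t
  have himg₁ : (fun t => Φ (P.lift t)) '' Set.Ioo (P.time (j, -1)) (P.endTime (j, -1)) =
      Φ '' P.openEdge (1, (j, -1)) := by
    simp only [GeneralPosition.openEdge, Set.image_image, one_smul]
  have himg₂ : (fun t => Φ (D.opp j • P.lift t)) '' Set.Ioo (P.time (j, 1)) (P.endTime (j, 1)) =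
      Φ '' P.openEdge (D.opp j, (j, 1)) := by
    simp only [GeneralPosition.openEdge, Set.image_image]
  have main := cyclic_order_of_strands (G := G) (o := Φ o) (by
      rintro _ ⟨z, -, rfl⟩
      exact (k • z).im_pos) hv (f₁ := fun t => Φ (P.lift t)) (f₂ := fun t => Φ (D.opp j • P.lift t))
    (P.time_lt_endTime (j, -1)) (P.time_lt_endTime (j, 1)) rfl (by rw [hopp]) hd₁ hd₂ (by
      intro δ hδ
      rw [← hemb.map_nhds_eq, Filter.eventually_map]
      have hnear : ∀ a b : ℝ, ∀ n : ℤ, a = b + n → ∀ᶠ s in 𝓝 a, |s - n - b| < δ := by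
        intro a b n hab
        filter_upwards [Metric.ball_mem_nhds a hδ] with s hs
        rwa [Metric.mem_ball, Real.dist_eq, hab, ← sub_sub, sub_right_comm] at hs
      have := P.eventually_mem_orbit o (Q := fun z => (∃ t, |t - P.time (j, -1)| < δ ∧
          P.lift t = z) ∨ ∃ t, |t - P.time (j, 1)| < δ ∧ D.opp j • P.lift t = z) (by
        intro g hg t hgt
        rcases D.strands hg hgt with ⟨n, hn, hs⟩ | ⟨n, hn, hs⟩
        · filter_upwards [hnear _ _ n hn] with s hs'
          exact Or.inl ⟨_, hs', (hs s).symm⟩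
        · filter_upwards [hnear _ _ n hn] with s hs'
          exact Or.inr ⟨_, hs', (hs s).symm⟩)
      filter_upwards [this] with z hz hzG
      rcases hz (hΦi.mem_set_image.mp hzG) with ⟨t, ht, h⟩ | ⟨t, ht, h⟩
      · exact Or.inl ⟨t, ht, congrArg Φ h⟩
      · exact Or.inr ⟨t, ht, congrArg Φ h⟩)
    (hΦc.comp P.continuous_lift) (hΦc.comp (P.continuous_lift.const_smul _))
    (fun t => ⟨_, hor1 t, rfl⟩) (fun t => ⟨_, hor (D.opp_mem j) t, rfl⟩)
    (fun t ht t' ht' h => (P.edge_unique (x := (1, (j, -1))) (y := (1, (j, -1))) (one_mem _)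
      (one_mem _) ht ht' (by simpa using hΦi h)).1)
    (fun t ht t' ht' h => (P.edge_unique (x := (D.opp j, (j, 1))) (y := (D.opp j, (j, 1)))
      (D.opp_mem j) (D.opp_mem j) ht ht' (hΦi h)).1)
    (by
      rw [← hemb.map_nhds_eq, Filter.eventually_map]
      filter_upwards [isOpen_interior.mem_nhds (P.lift_mem (P.time (j, -1)))] with z hz hzG F
      obtain ⟨q, hq, T, hT⟩ := GeneralPosition.exists_joinedIn_real (P := P) hfill hEight k
        (interior_subset hz) (fun h => hzG ⟨z, h, rfl⟩) F
      exact ⟨⟨T, T.continuous⟩, T.source, by simpa using hq, fun x => hT x⟩)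
    (p₁ := ((k : M2) *ᵥ v₁) 0 / ((k : M2) *ᵥ v₁) 1) (p₂ := ((k : M2) *ᵥ v₂) 0 / ((k : M2) *ᵥ v₂) 1)
    (p₃ := ((k : M2) *ᵥ v₃) 0 / ((k : M2) *ᵥ v₃) 1)
    (by
      rw [himg₁, hG, ← Set.image_sdiff hΦi]
      exact h₁.reachesEnd k hk1)
    (by
      rw [himg₂, hG, ← Set.image_sdiff hΦi]
      exact h₂.reachesEnd k hk2)
    (by
      rw [himg₁, himg₂, ← Set.image_union, hG, ← Set.image_sdiff hΦi]
      exact h₃.reachesEnd k hk3)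
  rw [← planeDet_mulVec k v₁, ← planeDet_mulVec k v₂, ← planeDet_mulVec k v₃]
  generalize (k : M2) *ᵥ v₁ = w₁ at *
  generalize (k : M2) *ᵥ v₂ = w₂ at *
  generalize (k : M2) *ᵥ v₃ = w₃ at *
  -- Each vector occurs in two determinants, so passing to affine coordinates extracts a square.
  have e : planeDet w₁ w₂ * planeDet w₂ w₃ * planeDet w₃ w₁ =
      (w₁ 1 * w₂ 1 * w₃ 1) ^ 2 * ((w₁ 0 / w₁ 1 - w₂ 0 / w₂ 1) * (w₂ 0 / w₂ 1 - w₃ 0 / w₃ 1) *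
        (w₃ 0 / w₃ 1 - w₁ 0 / w₁ 1)) := by
    unfold planeDet
    field_simp
  rw [e]
  exact mul_pos (by positivity) main

end LiftedDiagram

/-! ### Position of the bars and spacing of consecutive bars -/

theorem ReachesBoundary.neg {H : Set ℍ} {e : ℍ} {v : Fin 2 → ℝ} (h : ReachesBoundary H e v) :
    ReachesBoundary H e (-v) := by
  obtain ⟨V, ⟨M, w, s, hs, hV, rfl⟩, hj⟩ := h
  refine ⟨V, ⟨-M, w, s, hs, fun n => ?_, ?_⟩, hj⟩
  · rw [hV, PMEq.smul (Or.inr rfl : PMEq (-M) M)]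
  · rw [Matrix.SpecialLinearGroup.coe_neg, neg_mulVec]

theorem ReachesBoundary.congr_pmEq {H : Set ℍ} {e : ℍ} {v : Fin 2 → ℝ} {A B : SL2}
    (h : ReachesBoundary H e ((A : M2) *ᵥ v)) (hAB : PMEq B A) :
    ReachesBoundary H e ((B : M2) *ᵥ v) := by
  rcases hAB with rfl | rfl
  · exact h
  · rw [Matrix.SpecialLinearGroup.coe_neg, neg_mulVec]
    exact h.neg

theorem coe_cross (a : ℝ) : (cross a : M2) =
    !![Real.cosh (a / 2), Real.sinh (a / 2); Real.sinh (a / 2), Real.cosh (a / 2)] := rfl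

theorem coe_transl (θ : ℝ) :
    (transl θ : M2) = !![Real.exp (θ / 2), 0; 0, Real.exp (-(θ / 2))] := rfl

/-- The four sign choices give the four positions of the second line: to the left or to the right of
the first, in parallel or opposite direction. -/
theorem coe_quarter_mul_transl_mul_quarter (κ κ' : ℤˣ) (L : ℝ) :
    ((quarter κ * transl L * quarter κ' : SL2) : M2) =
      !![(Real.exp (L / 2) - ((κ * κ' : ℤˣ) : ℤ) * Real.exp (-(L / 2))) / 2,
          (((κ' : ℤ) : ℝ) * Real.exp (L / 2) + ((κ : ℤ) : ℝ) * Real.exp (-(L / 2))) / 2;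
        -(((κ : ℤ) : ℝ) * Real.exp (L / 2) + ((κ' : ℤ) : ℝ) * Real.exp (-(L / 2))) / 2,
          (Real.exp (-(L / 2)) - ((κ * κ' : ℤˣ) : ℤ) * Real.exp (L / 2)) / 2] := by
  have h2 : √2 ≠ 0 := by positivity
  have h3 : √2 ^ 2 = 2 := Real.sq_sqrt (by norm_num)
  rw [Matrix.SpecialLinearGroup.coe_mul, Matrix.SpecialLinearGroup.coe_mul, coe_transl]
  ext i j
  rcases Int.units_eq_one_or κ with rfl | rfl <;> rcases Int.units_eq_one_or κ' with rfl | rfl <;>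
    fin_cases i <;> fin_cases j <;>
    simp [quarter, Matrix.mul_apply, Fin.sum_univ_two] <;> field_simp <;> rw [h3] <;> ring

namespace LiftedDiagram

variable {S : Type*} [TopologicalSpace S] {Y : HyperbolicStructure S} {c : ℝ → S} {r : ℕ}
  {P : GeneralPosition Y c r} {L : Fin r → ℝ} {θ : Theta r → ℝ} (D : LiftedDiagram P L θ)

theorem betaStep_subset {x y : SL2 × Theta r} (hx : x.1 ∈ Y.group) (hy : y.1 ∈ Y.group) (n : ℤ)
    (h : ¬ GeneralPosition.EdgeEq ((D.betaStep ^ n) x) y) :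
    P.closedEdge ((D.betaStep ^ n) x) ⊆ P.orbit \ P.openEdge y := fun _ hz =>
  ⟨P.closedEdge_subset_orbit (D.betaStep_zpow_fst_mem hx n) hz,
    P.closedEdge_disjoint_openEdge (D.betaStep_zpow_fst_mem hx n) hy h hz⟩

/-- Lifted portions that are carried by distinct lines do not follow each other. -/
theorem not_edgeEq_of_line_ne {x y : SL2 × Theta r} {K : SL2}
    (h : PMEq (D.lineFrame y) (D.lineFrame x * K)) (hK : K 1 0 ≠ 0) (n : ℤ) :
    ¬ GeneralPosition.EdgeEq ((D.betaStep ^ n) x) y := by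
  intro he
  obtain ⟨s, hs⟩ := D.lineFrame_betaStep_zpow n x
  have h1 := ((hs.trans (D.lineFrame_of_edgeEq he)).trans h).mul_left (D.lineFrame x)⁻¹
  rw [inv_mul_cancel_left, inv_mul_cancel_left] at h1
  apply hK
  rcases h1 with h1 | h1
  · rw [← h1]; simp [transl]
  · rw [← neg_eq_iff_eq_neg] at h1
    rw [← h1, Matrix.SpecialLinearGroup.coe_neg]; simp [transl]

theorem reaches_forward {x : SL2 × Theta r} (hx : x.1 ∈ Y.group) :
    ReachesBoundary (P.orbit \ P.openEdge x) (x.1 • P.lift (P.endTime x.2))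
      ((D.lineFrame x : M2) *ᵥ ![1, 0]) :=
  D.reachesBoundary_forward fun n hn => by
    have := D.betaStep_subset hx hx n (by
      rw [zpow_natCast]
      exact D.not_edgeEq_betaStep_pow hn x)
    rwa [zpow_natCast] at this

/-- The multi-curve through x stays on its own line, so it never uses the edge y, which is carried
by another line; K 1 0 ≠ 0 ensures that the lines differ. -/
theorem reaches_backward {x y : SL2 × Theta r} {K : SL2} (hx : x.1 ∈ Y.group) (hy : y.1 ∈ Y.group)
    (h : PMEq (D.lineFrame y) (D.lineFrame x * K)) (hK : K 1 0 ≠ 0) :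
    ReachesBoundary (P.orbit \ P.openEdge y) (x.1 • P.lift (P.time x.2))
      ((D.lineFrame x : M2) *ᵥ ![0, 1]) :=
  D.reachesBoundary_backward fun _ _ =>
    D.betaStep_subset hx hy _ (D.not_edgeEq_of_line_ne h hK _)

theorem reaches_backward_union {x y : SL2 × Theta r} {K : SL2} (hx : x.1 ∈ Y.group)
    (hy : y.1 ∈ Y.group) (h : PMEq (D.lineFrame y) (D.lineFrame x * K)) (hK : K 1 0 ≠ 0) :
    ReachesBoundary (P.orbit \ (P.openEdge x ∪ P.openEdge y)) (x.1 • P.lift (P.time x.2))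
      ((D.lineFrame x : M2) *ᵥ ![0, 1]) :=
  D.reachesBoundary_backward fun n hn => by
    rw [← Set.sdiff_inter_sdiff]
    exact Set.subset_inter (D.betaStep_subset hx hx _ (D.not_edgeEq_betaStep_neg hn x))
      (D.betaStep_subset hx hy _ (D.not_edgeEq_of_line_ne h hK _))

/-- Determinants are invariant under SL(2, ℝ) and each vector occurs twice, so both the common frame
M and the sign ambiguities disappear. -/
theorem cyclic_order_frame (hfill : IsFilling c) (hEight : IsGeneralizedEight c) (j : Fin r)
    {M A₁ A₂ A₃ K₁ K₂ K₃ : SL2} {v₁ v₂ v₃ : Fin 2 → ℝ}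
    (e₁ : PMEq A₁ (M * K₁)) (e₂ : PMEq A₂ (M * K₂)) (e₃ : PMEq A₃ (M * K₃))
    (h₁ : ReachesBoundary (P.orbit \ P.openEdge (1, (j, -1))) (P.lift (P.endTime (j, -1)))
      ((A₁ : M2) *ᵥ v₁))
    (h₂ : ReachesBoundary (P.orbit \ P.openEdge (D.opp j, (j, 1)))
      (D.opp j • P.lift (P.endTime (j, 1))) ((A₂ : M2) *ᵥ v₂))
    (h₃ : ReachesBoundary (P.orbit \ (P.openEdge (1, (j, -1)) ∪ P.openEdge (D.opp j, (j, 1))))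
      (P.lift (P.time (j, -1))) ((A₃ : M2) *ᵥ v₃)) :
    0 < planeDet ((K₁ : M2) *ᵥ v₁) ((K₂ : M2) *ᵥ v₂) *
      planeDet ((K₂ : M2) *ᵥ v₂) ((K₃ : M2) *ᵥ v₃) *
        planeDet ((K₃ : M2) *ᵥ v₃) ((K₁ : M2) *ᵥ v₁) := by
  have := D.cyclic_order hfill hEight j (h₁.congr_pmEq e₁.symm) (h₂.congr_pmEq e₂.symm)
    (h₃.congr_pmEq e₃.symm)
  simpa only [Matrix.SpecialLinearGroup.coe_mul, ← mulVec_mulVec, planeDet_mulVec] using this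

/-- The bars are orthogonal to the multi-curve and go from its right to its left. -/
theorem opp_mul_frame (hfill : IsFilling c) (hEight : IsGeneralizedEight c) (j : Fin r) :
    PMEq (D.opp j * D.frame (j, 1)) (D.frame (j, -1) * cross (-(L j))) := by
  obtain ⟨κ, κ', h⟩ := D.opp_frame j
  rw [mul_assoc, mul_assoc, ← mul_assoc (quarter κ)] at h
  set K : SL2 := quarter κ * transl (L j) * quarter κ' with hK
  have hKM := coe_quarter_mul_transl_mul_quarter κ κ' (L j)
  rw [← hK] at hKM
  have hy1 : ((1 : SL2), (j, (-1 : ℤˣ))).1 ∈ Y.group := one_mem _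
  have hy2 : (D.opp j, (j, (1 : ℤˣ))).1 ∈ Y.group := D.opp_mem j
  have l1 : D.lineFrame (1, (j, -1)) = D.frame (j, -1) := one_mul _
  have l2 : D.lineFrame (D.opp j, (j, 1)) = D.opp j * D.frame (j, 1) := rfl
  have e1 : PMEq (D.lineFrame (1, (j, -1))) (D.frame (j, -1) * 1) := by
    rw [l1, mul_one]; exact PMEq.refl _
  have hL : Real.exp (-(L j / 2)) < Real.exp (L j / 2) :=
    Real.exp_lt_exp.mpr (by linarith [D.L_pos j])
  have hL0 := Real.exp_pos (-(L j / 2))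
  have hinv : (K⁻¹ : SL2) 1 0 = -K 1 0 := by
    rw [Matrix.SpecialLinearGroup.coe_inv, Matrix.adjugate_fin_two]
    rfl
  have hK10 : K 1 0 ≠ 0 := by
    have : K 1 0 = (K : M2) 1 0 := rfl
    rw [this, hKM]
    rcases Int.units_eq_one_or κ with rfl | rfl <;>
      rcases Int.units_eq_one_or κ' with rfl | rfl <;> simp <;> intro <;> linarith
  have h12 : PMEq (D.lineFrame (D.opp j, (j, 1))) (D.lineFrame (1, (j, -1)) * K) := by
    rw [l1]; exact h
  have h21 : PMEq (D.lineFrame (1, (j, -1))) (D.lineFrame (D.opp j, (j, 1)) * K⁻¹) := by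
    have := h12.symm.mul_right K⁻¹
    rwa [mul_inv_cancel_right] at this
  have f1 := D.reaches_forward hy1
  have f2 := D.reaches_forward hy2
  have b1 := D.reaches_backward_union hy1 hy2 h12 hK10
  have b2 := D.reaches_backward_union hy2 hy1 h21 (by rw [hinv]; exact neg_ne_zero.mpr hK10)
  simp only [one_smul] at f1 b1
  simp only [D.opp_smul] at b2
  rw [Set.union_comm] at b2
  -- The two forward ends are tested against each backward end: A1 places the second line to the
  -- left, then A2 makes the directions parallel. Only κ = 1, κ' = -1 survives.
  have A1 := D.cyclic_order_frame hfill hEight j e1 h e1 f1 f2 b1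
  have A2 := D.cyclic_order_frame hfill hEight j e1 h h f1 f2 b2
  rw [hKM] at A1 A2
  rcases Int.units_eq_one_or κ with rfl | rfl <;> rcases Int.units_eq_one_or κ' with rfl | rfl
  · exfalso
    simp [planeDet, mulVec, dotProduct, Fin.sum_univ_two] at A2
    generalize Real.exp (L j / 2) = x at *
    generalize Real.exp (-(L j / 2)) = y at *
    have := mul_pos (mul_pos (add_pos (hL0.trans hL) hL0) (sub_pos.mpr hL)) (mul_pos (hL0.trans hL) hL0)
    linarith
  · have : K = cross (-(L j)) := by
      refine Matrix.SpecialLinearGroup.ext _ _ fun a b => ?_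
      rw [hKM, coe_cross]
      fin_cases a <;> fin_cases b <;> simp [neg_div, Real.cosh_eq, Real.sinh_eq] <;> ring
    rw [← this]
    exact h
  · exfalso
    simp [planeDet, mulVec, dotProduct, Fin.sum_univ_two] at A1
    generalize Real.exp (L j / 2) = x at *
    generalize Real.exp (-(L j / 2)) = y at *
    have := mul_pos (add_pos (hL0.trans hL) hL0) (sub_pos.mpr hL)
    linarith
  · exfalso
    simp [planeDet, mulVec, dotProduct, Fin.sum_univ_two] at A1
    generalize Real.exp (L j / 2) = x at *
    generalize Real.exp (-(L j / 2)) = y at *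
    have := mul_pos (add_pos (hL0.trans hL) hL0) (sub_pos.mpr hL)
    linarith

end LiftedDiagram

theorem one_lt_of_cone {θ a b : ℝ}
    (h : Real.exp (-(θ / 2)) * (Real.cosh (a / 2) * Real.cosh (b / 2)) <
      Real.exp (θ / 2) * (Real.sinh (a / 2) * Real.sinh (b / 2))) :
    1 < Real.exp θ * (Real.tanh (a / 2) * Real.tanh (b / 2)) := by
  have h1 := Real.cosh_pos (a / 2)
  have h2 := Real.cosh_pos (b / 2)
  rw [Real.tanh_eq_sinh_div_cosh, Real.tanh_eq_sinh_div_cosh, div_mul_div_comm, ← mul_div_assoc,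
    one_lt_div (by positivity)]
  have h3 := mul_lt_mul_of_pos_left h (Real.exp_pos (θ / 2))
  rwa [← mul_assoc, ← Real.exp_add, add_neg_cancel, Real.exp_zero, one_mul, ← mul_assoc,
    ← Real.exp_add, add_halves] at h3

theorem pmEq_mul_inv {A B C : SL2} (h : PMEq A (B * C)) : PMEq B (A * C⁻¹) := by
  have := h.symm.mul_right C⁻¹
  rwa [mul_inv_cancel_right] at this

theorem inv_one_zero (K : SL2) : (K⁻¹ : SL2) 1 0 = -K 1 0 := by
  rw [Matrix.SpecialLinearGroup.coe_inv, Matrix.adjugate_fin_two]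
  rfl

theorem cross_one_zero_ne_zero {a : ℝ} (ha : a ≠ 0) : cross a 1 0 ≠ 0 := by
  have : cross a 1 0 = Real.sinh (a / 2) := rfl
  rw [this, ne_eq, Real.sinh_eq_zero]
  simpa using ha

theorem transl_mul_cross_one_zero (θ a : ℝ) :
    (transl θ * cross a : SL2) 1 0 = Real.exp (-(θ / 2)) * Real.sinh (a / 2) := by
  rw [Matrix.SpecialLinearGroup.coe_mul, coe_transl, coe_cross]
  simp [Matrix.mul_apply, Fin.sum_univ_two]

theorem transl_mul_cross_one_zero_ne_zero (θ : ℝ) {a : ℝ} (ha : a ≠ 0) :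
    (transl θ * cross a : SL2) 1 0 ≠ 0 := by
  rw [transl_mul_cross_one_zero]
  exact mul_ne_zero (Real.exp_pos _).ne' (cross_one_zero_ne_zero ha)

namespace LiftedDiagram

variable {S : Type*} [TopologicalSpace S] {Y : HyperbolicStructure S} {c : ℝ → S} {r : ℕ}
  {P : GeneralPosition Y c r} {L : Fin r → ℝ} {θ : Theta r → ℝ} (D : LiftedDiagram P L θ)

include D in
-- Both bars are to the right of the line of (j, 1). In its frame, the line across the first bar has
-- forward end coth(L/2), and the line across the second has backward end exp θ · tanh(L'/2). The
-- second end is reached through the edge (j, 1), the first through the edge (j, -1); the cyclic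
-- order with the backward end 0 places the first before the second.
theorem one_lt_of_next_neg (hfill : IsFilling c) (hEight : IsGeneralizedEight c) {j j' : Fin r}
    (h : P.next (j, 1) = (j', -1)) :
    1 < Real.exp (θ (j, 1)) * (Real.tanh (L j / 2) * Real.tanh (L j' / 2)) := by
  have hn : P.nextOnBeta (j, 1) = (j', 1) := by
    simp [GeneralPosition.nextOnBeta, h, Theta.flip]
  have hL := D.L_pos j
  have hL' := D.L_pos j'
  -- The lifted portion that leaves the loop passage at the end of the edge (j, 1): its line lies
  -- across the second bar.
  set x : SL2 × Theta r := (D.opp j * D.cont (j, 1) * (D.opp j')⁻¹, (j', -1)) with hx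
  have hy1 : ((1 : SL2), (j, (-1 : ℤˣ))).1 ∈ Y.group := one_mem _
  have hy2 : (D.opp j, (j, (1 : ℤˣ))).1 ∈ Y.group := D.opp_mem j
  have hxg : x.1 ∈ Y.group :=
    mul_mem (mul_mem (D.opp_mem j) (D.cont_mem _)) (inv_mem (D.opp_mem j'))
  have hstart : x.1 • P.lift (P.time x.2) = D.opp j • P.lift (P.endTime (j, 1)) := by
    rw [hx, ← D.opp_smul, ← D.cont_smul, hn]
    simp only [mul_smul, inv_smul_smul]
  have o1 := D.opp_mul_frame hfill hEight j
  have o2 := pmEq_mul_inv (D.opp_mul_frame hfill hEight j')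
  rw [cross_inv, neg_neg] at o2
  have hcf := D.cont_frame (j, 1)
  rw [hn] at hcf
  have x2 : PMEq (D.lineFrame x)
      (D.lineFrame (D.opp j, (j, 1)) * (transl (θ (j, 1)) * cross (L j'))) := by
    have e1 := o2.mul_left (D.opp j * D.cont (j, 1) * (D.opp j')⁻¹)
    have e2 := (hcf.symm.mul_left (D.opp j)).mul_right (cross (L j'))
    refine e1.trans ?_
    convert e2 using 1 <;> simp only [lineFrame, mul_assoc, inv_mul_cancel_left]
  have x1 : PMEq (D.lineFrame x)
      (D.frame (j, -1) * (cross (-L j) * (transl (θ (j, 1)) * cross (L j')))) := by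
    rw [← mul_assoc]
    exact x2.trans (o1.mul_right _)
  have l1 : PMEq (D.lineFrame (1, (j, -1))) (D.frame (j, -1) * 1) := by
    rw [lineFrame, one_mul, mul_one]; exact PMEq.refl _
  have h21 : PMEq (D.lineFrame (1, (j, -1))) (D.lineFrame (D.opp j, (j, 1)) * (cross (-L j))⁻¹) := by
    rw [lineFrame, one_mul]
    exact pmEq_mul_inv o1
  have f1 := D.reaches_forward hy1
  have f2 := D.reaches_backward hxg hy2 (pmEq_mul_inv x2) (by
    rw [inv_one_zero]
    exact neg_ne_zero.mpr (transl_mul_cross_one_zero_ne_zero _ hL'.ne'))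
  have f3 := D.reaches_backward_union hy2 hy1 h21 (by
    rw [cross_inv, neg_neg]
    exact cross_one_zero_ne_zero hL.ne')
  rw [hstart] at f2
  simp only [one_smul] at f1
  simp only [D.opp_smul] at f3
  rw [Set.union_comm] at f3
  have A := D.cyclic_order_frame hfill hEight j l1 x1 o1 f1 f2 f3
  simp only [Matrix.SpecialLinearGroup.coe_mul, coe_cross, coe_transl] at A
  simp [planeDet, mulVec, dotProduct, Fin.sum_univ_two, neg_div, Matrix.mul_apply] at A
  refine one_lt_of_cone ?_
  have h1 := Real.cosh_sq (L j / 2)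
  have hp := mul_pos (Real.cosh_pos (L j / 2)) (mul_pos (Real.exp_pos (θ (j, 1) / 2))
    (Real.sinh_pos_iff.mpr (half_pos hL')))
  generalize Real.sinh (L j / 2) = s at *
  generalize Real.cosh (L j / 2) = c at *
  generalize Real.sinh (L j' / 2) = s' at *
  generalize Real.cosh (L j' / 2) = c' at *
  generalize Real.exp (θ (j, 1) / 2) = e at *
  generalize Real.exp (-(θ (j, 1) / 2)) = f at *
  refine sub_pos.mp (pos_of_mul_pos_left (b := c * (e * s')) ?_ hp.le)
  refine (neg_pos.mpr A).trans_eq ?_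
  linear_combination -(-(s * (e * s')) + c * (f * c')) * (c * (e * s')) * h1

include D in
-- The mirror case, with both bars to the left of the line of (j, -1): in its frame the ends to
-- compare are -exp θ · tanh(L'/2), reached through the edge (j, -1), and -coth(L/2), reached
-- through the edge (j, 1).
theorem one_lt_of_next_pos (hfill : IsFilling c) (hEight : IsGeneralizedEight c) {j j' : Fin r}
    (h : P.next (j, -1) = (j', 1)) :
    1 < Real.exp (θ (j, -1)) * (Real.tanh (L j / 2) * Real.tanh (L j' / 2)) := by
  have hn : P.nextOnBeta (j, -1) = (j', -1) := by
    simp [GeneralPosition.nextOnBeta, h, Theta.flip]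
  have hL := D.L_pos j
  have hL' := D.L_pos j'
  set x : SL2 × Theta r := (D.cont (j, -1) * D.opp j', (j', 1)) with hx
  have hy1 : ((1 : SL2), (j, (-1 : ℤˣ))).1 ∈ Y.group := one_mem _
  have hy2 : (D.opp j, (j, (1 : ℤˣ))).1 ∈ Y.group := D.opp_mem j
  have hxg : x.1 ∈ Y.group := mul_mem (D.cont_mem _) (D.opp_mem j')
  have hstart : x.1 • P.lift (P.time x.2) = P.lift (P.endTime (j, -1)) := by
    rw [hx, ← D.cont_smul, hn, ← D.opp_smul]
    simp only [mul_smul]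
  have o1 := D.opp_mul_frame hfill hEight j
  have o2 := D.opp_mul_frame hfill hEight j'
  have hcf := D.cont_frame (j, -1)
  rw [hn] at hcf
  have l1 : D.lineFrame (1, (j, -1)) = D.frame (j, -1) := one_mul _
  have x1 : PMEq (D.lineFrame x)
      (D.frame (j, -1) * (transl (θ (j, -1)) * cross (-L j'))) := by
    have e1 := o2.mul_left (D.cont (j, -1))
    have e2 := hcf.symm.mul_right (cross (-L j'))
    rw [← mul_assoc, ← mul_assoc] at e1
    rw [← mul_assoc]
    exact e1.trans e2
  have h12 : PMEq (D.lineFrame (D.opp j, (j, 1))) (D.lineFrame (1, (j, -1)) * cross (-L j)) := by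
    rw [l1]; exact o1
  have l1' : PMEq (D.lineFrame (1, (j, -1))) (D.frame (j, -1) * 1) := by
    rw [l1, mul_one]; exact PMEq.refl _
  have f1 := D.reaches_backward hxg hy1 (pmEq_mul_inv (l1 ▸ x1)) (by
    rw [inv_one_zero]
    exact neg_ne_zero.mpr (transl_mul_cross_one_zero_ne_zero _ (neg_ne_zero.mpr hL'.ne')))
  have f2 := D.reaches_forward hy2
  have f3 := D.reaches_backward_union hy1 hy2 h12
    (cross_one_zero_ne_zero (neg_ne_zero.mpr hL.ne'))
  rw [hstart] at f1
  simp only [one_smul] at f3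
  have A := D.cyclic_order_frame hfill hEight j x1 o1 l1' f1 f2 f3
  simp only [Matrix.SpecialLinearGroup.coe_mul, coe_cross, coe_transl] at A
  simp [planeDet, mulVec, dotProduct, Fin.sum_univ_two, neg_div, Matrix.mul_apply] at A
  refine one_lt_of_cone ?_
  have hp := mul_pos (Real.cosh_pos (L j / 2)) (mul_pos (Real.exp_pos (θ (j, -1) / 2))
    (Real.sinh_pos_iff.mpr (half_pos hL')))
  refine sub_pos.mp (pos_of_mul_pos_left ?_ hp.le)
  refine A.trans_eq ?_
  ring

include D in
/-- The two bars at the ends of a simple portion whose ends are on the same side of the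
multi-curve are far enough from each other. -/
theorem one_lt_of_next (hfill : IsFilling c) (hEight : IsGeneralizedEight c) (q : Theta r)
    (h : q.2 ≠ (P.next q).2) :
    1 < Real.exp (θ q) * (Real.tanh (L q.1 / 2) * Real.tanh (L (P.next q).1 / 2)) := by
  obtain ⟨j, κ⟩ := q
  obtain ⟨⟨j', κ'⟩, hn⟩ : ∃ x, P.next (j, κ) = x := ⟨_, rfl⟩
  rw [hn] at h ⊢
  rcases Int.units_eq_one_or κ with rfl | rfl <;> rcases Int.units_eq_one_or κ' with rfl | rfl
  · exact absurd rfl h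
  · exact D.one_lt_of_next_neg hfill hEight hn
  · exact D.one_lt_of_next_pos hfill hEight hn
  · exact absurd rfl h

end LiftedDiagram

/-! ### The deck transformation as a product, and conclusion -/

namespace GeneralPosition

variable {S : Type*} [TopologicalSpace S] {Y : HyperbolicStructure S} {c : ℝ → S} {r : ℕ}
  (P : GeneralPosition Y c r)

theorem endTime_order_of_lt (k : Fin (2 * r)) (h : (k : ℕ) + 1 < 2 * r) :
    P.endTime (P.order k) = P.time (P.next (P.order k)) := by
  refine if_pos ?_
  rw [next_order]
  exact P.strictMono (Fin.lt_def.mpr (by rw [val_finRotate_of_lt k h]; omega))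

theorem endTime_order_of_eq (k : Fin (2 * r)) (h : (k : ℕ) + 1 = 2 * r) :
    P.endTime (P.order k) = P.time (P.next (P.order k)) + 1 := by
  refine if_neg (not_lt.mpr ?_)
  rw [next_order]
  exact P.strictMono.monotone (Fin.le_def.mpr (by rw [val_finRotate_of_eq k h]; omega))

/-- The passages at double points, in the order in which they occur, counted by the natural
numbers. -/
def passage (hr : 0 < 2 * r) (k : ℕ) : Theta r := P.order ⟨k % (2 * r), Nat.mod_lt _ hr⟩

theorem passage_of_lt (hr : 0 < 2 * r) {k : ℕ} (hk : k < 2 * r) :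
    P.passage hr k = P.order ⟨k, hk⟩ := by
  simp only [passage, Nat.mod_eq_of_lt hk]

theorem passage_two_mul (hr : 0 < 2 * r) : P.passage hr (2 * r) = P.passage hr 0 := by
  simp [passage]

theorem next_passage (hr : 0 < 2 * r) {k : ℕ} (hk : k < 2 * r) :
    P.next (P.passage hr k) = P.passage hr (k + 1) := by
  rw [P.passage_of_lt hr hk, P.next_order]
  refine congrArg P.order (Fin.ext ?_)
  rcases (by omega : k + 1 < 2 * r ∨ k + 1 = 2 * r) with h | h
  · rw [val_finRotate_of_lt _ h]
    exact (Nat.mod_eq_of_lt h).symm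
  · rw [val_finRotate_of_eq _ h]
    simp [h]

end GeneralPosition

/-- The matrix which expresses the crossing of the bar `B q`. -/
noncomputable def barMatrix {r : ℕ} (L : Fin r → ℝ) (q : Theta r) : SL2 :=
  cross (-((q.2 : ℤ) : ℝ) * L q.1)

namespace LiftedDiagram

variable {S : Type*} [TopologicalSpace S] {Y : HyperbolicStructure S} {c : ℝ → S} {r : ℕ}
  {P : GeneralPosition Y c r} {L : Fin r → ℝ} {θ : Theta r → ℝ} (D : LiftedDiagram P L θ)

theorem exists_flip (hfill : IsFilling c) (hEight : IsGeneralizedEight c) (q : Theta r) :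
    ∃ g ∈ Y.group, g • P.lift (P.time q) = P.lift (P.time (Theta.flip r q)) ∧
      PMEq (D.frame (Theta.flip r q)) (g * D.frame q * (barMatrix L q)⁻¹) := by
  obtain ⟨j, κ⟩ := q
  have h := D.opp_mul_frame hfill hEight j
  have e1 : ((1 : ℤˣ) : ℤ) = 1 := rfl
  have e2 : ((-1 : ℤˣ) : ℤ) = -1 := rfl
  rcases Int.units_eq_one_or κ with rfl | rfl
  · refine ⟨D.opp j, D.opp_mem j, by simpa [Theta.flip] using D.opp_smul j, ?_⟩
    have := pmEq_mul_inv h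
    simpa [Theta.flip, barMatrix] using this
  · refine ⟨(D.opp j)⁻¹, inv_mem (D.opp_mem j), ?_, ?_⟩
    · rw [inv_smul_eq_iff]
      simpa [Theta.flip] using (D.opp_smul j).symm
    · have := h.mul_left (D.opp j)⁻¹
      rw [inv_mul_cancel_left, ← mul_assoc] at this
      simpa [Theta.flip, barMatrix, cross_inv] using this

/-- Following the loop along a simple portion, then crossing a bar. -/
theorem exists_step (hfill : IsFilling c) (hEight : IsGeneralizedEight c) (q : Theta r) :
    ∃ g ∈ Y.group, g • P.lift (P.time (P.next q)) = P.lift (P.endTime q) ∧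
      PMEq (D.frame q * transl (θ q))
        (g * (D.frame (P.next q) * (barMatrix L (P.next q))⁻¹)) := by
  obtain ⟨g, hg, h1, h2⟩ := D.exists_flip hfill hEight (P.next q)
  refine ⟨D.cont q * g, mul_mem (D.cont_mem q) hg, ?_, ?_⟩
  · rw [mul_smul, h1]
    exact D.cont_smul q
  · refine (D.cont_frame q).trans ?_
    have := h2.mul_left (D.cont q)
    simp only [mul_assoc] at this ⊢
    exact this

/-- Each step along the loop multiplies the moving frame m on the right by a bar and a portion, up
to a deck transformation. That transformation is trivial while the loop runs along the chosen lift,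
and equals the deck transformation of the loop when the time wraps around. The product is therefore
conjugate to it up to sign. -/
theorem abs_trace_deck (hr : 1 ≤ r) (hfill : IsFilling c) (hEight : IsGeneralizedEight c) :
    |trace (D.deck : M2)| = |trace (List.ofFn fun k : Fin (2 * r) =>
      (barMatrix L (P.order k) : M2) * (transl (θ (P.order k)) : M2)).prod| := by
  have hn : 0 < 2 * r := by omega
  set q := P.passage hn with hq
  have hqk : ∀ k : Fin (2 * r), q k = P.order k := fun k => P.passage_of_lt hn k.2
  set m : ℕ → SL2 := fun k => D.frame (q k) * (barMatrix L (q k))⁻¹ with hm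
  set A : ℕ → SL2 := fun n =>
    (List.ofFn fun k : Fin n => barMatrix L (q k) * transl (θ (q k))).prod with hA
  have hA1 : ∀ n, A (n + 1) = A n * (barMatrix L (q n) * transl (θ (q n))) := fun n => by
    simp only [hA]
    rw [List.ofFn_succ', List.prod_concat]
    rfl
  have step : ∀ k < 2 * r, ∃ g ∈ Y.group,
      g • P.lift (P.time (q (k + 1))) = P.lift (P.endTime (q k)) ∧
        PMEq (m k * (barMatrix L (q k) * transl (θ (q k)))) (g * m (k + 1)) := by
    intro k hk
    obtain ⟨g, hg, h1, h2⟩ := D.exists_step hfill hEight (q k)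
    rw [hq, P.next_passage hn hk] at h1 h2
    refine ⟨g, hg, h1, ?_⟩
    simp only [hm, ← mul_assoc]
    rw [inv_mul_cancel_right, mul_assoc g]
    exact h2
  have run : ∀ n, n < 2 * r → PMEq (m 0 * A n) (m n) := by
    intro n
    induction n with
    | zero => intro _; simpa [hA] using PMEq.refl (m 0)
    | succ n ih =>
      intro h
      obtain ⟨g, hg, h1, h2⟩ := step n (by omega)
      have h3 : P.endTime (q n) = P.time (q (n + 1)) := by
        rw [hq, ← P.next_passage hn (by omega), P.passage_of_lt hn (by omega : n < 2 * r)]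
        exact P.endTime_order_of_lt ⟨n, by omega⟩ h
      have h4 : PMEq g 1 := Y.pmEq_of_smul_eq hg (one_mem _) (P.lift_mem_region _)
        (by rw [h1, h3, one_smul])
      rw [hA1, ← mul_assoc]
      refine ((ih (by omega)).mul_right _).trans (h2.trans ?_)
      simpa using h4.mul_right (m (n + 1))
  -- Only the last portion ends one period later, which makes the deck transformation appear exactly
  -- once.
  have last : PMEq (m 0 * A (2 * r)) (D.deck * m 0) := by
    obtain ⟨n, hn'⟩ : ∃ n, 2 * r = n + 1 := ⟨2 * r - 1, by omega⟩
    obtain ⟨g, hg, h1, h2⟩ := step n (by omega)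
    have hq0 : q (n + 1) = q 0 := by rw [← hn', hq, P.passage_two_mul]
    have h3 : P.endTime (q n) = P.time (q (n + 1)) + 1 := by
      rw [hq, ← P.next_passage hn (by omega), P.passage_of_lt hn (by omega : n < 2 * r)]
      exact P.endTime_order_of_eq ⟨n, by omega⟩ hn'.symm
    have h4 : PMEq g D.deck := Y.pmEq_of_smul_eq hg D.deck_mem (P.lift_mem_region _)
      (by rw [h1, h3, D.deck_smul])
    rw [hn', hA1, ← mul_assoc]
    refine ((run n (by omega)).mul_right _).trans (h2.trans ?_)
    have hm0 : m (n + 1) = m 0 := by simp only [hm, hq0]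
    rw [hm0]
    exact h4.mul_right _
  have hcoe : (A (2 * r) : M2) = (List.ofFn fun k : Fin (2 * r) =>
      (barMatrix L (P.order k) : M2) * (transl (θ (P.order k)) : M2)).prod := by
    rw [← Matrix.SpecialLinearGroup.coeMonoidHom_apply, map_list_prod, List.map_ofFn]
    simp only [Function.comp_def, hqk, Matrix.SpecialLinearGroup.coeMonoidHom_apply,
      Matrix.SpecialLinearGroup.coe_mul]
  rw [← hcoe]
  exact abs_trace_of_mul_eq last.symm

include D in
theorem two_lt_trace (hr : 1 ≤ r) (hfill : IsFilling c) (hEight : IsGeneralizedEight c) :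
    2 < trace (List.ofFn fun k : Fin (2 * r) =>
      (barMatrix L (P.order k) : M2) * (transl (θ (P.order k)) : M2)).prod := by
  have hn : 0 < 2 * r := by omega
  have := two_lt_trace_prod hn (fun k => (P.passage hn k).2) (fun k => L (P.passage hn k).1)
    (fun k => θ (P.passage hn k)) (fun k => D.L_pos _) (by simp only [P.passage_two_mul])
    (by simp only [P.passage_two_mul]) (fun k hk hne => by
      rw [← P.next_passage hn hk] at hne ⊢
      exact D.one_lt_of_next hfill hEight _ hne)
  simp only [fun k : Fin (2 * r) => P.passage_of_lt hn k.2] at this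
  exact this

end LiftedDiagram

theorem mainTheorem4 {S : Type*} [TopologicalSpace S] [CompactSpace S]
    (Y : HyperbolicStructure S) (c : ℝ → S) (r : ℕ) (hr : 1 ≤ r)
    (P : GeneralPosition Y c r) (hfill : IsFilling c) (hEight : IsGeneralizedEight c)
    (L : Fin r → ℝ) (θ : Theta r → ℝ) (hY : HasCoordinates Y P L θ) :
    Y.IsGeodesicLength c (Y.length c) ∧
    Real.cosh (Y.length c / 2) =
      ∑ δ : Fin (2 * r) → ℤˣ with ∏ k, δ k = 1,
        (∏ k, hyp (δ k) (θ (P.order k) / 2)) *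
          Real.cosh ((1 / 2) * ∑ k, ((rho δ k : ℤ) : ℝ) * (((P.order k).2 : ℤ) : ℝ) *
            L (P.order k).1) := by
  obtain ⟨D⟩ := hY.nonempty_liftedDiagram
  have htr := D.abs_trace_deck hr hfill hEight
  have h2 := D.two_lt_trace hr hfill hEight
  -- The positivity of the product's trace removes the absolute value left by the ambiguity ±1.
  rw [abs_of_pos (a := trace (List.prod _)) (zero_lt_two.trans h2)] at htr
  obtain ⟨h3, h4⟩ := Y.isGeodesicLength_length P.continuous_lift P.lift_mem_region P.proj_lift
    D.deck_mem D.deck_smul (by rw [htr]; exact h2)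
  refine ⟨h3, ?_⟩
  have h5 := trace_prod_cross_mul_transl
    (fun k : Fin (2 * r) => -(((P.order k).2 : ℤ) : ℝ) * L (P.order k).1)
    (fun k => θ (P.order k))
  have h6 : 2 * Real.cosh (Y.length c / 2) = _ := h4.symm.trans (htr.trans h5)
  refine (mul_left_cancel₀ two_ne_zero h6).trans (Finset.sum_congr rfl fun δ _ => ?_)
  -- The matrices carry -ε L, the statement +ε L; cosh is even.
  rw [← Real.cosh_neg, ← mul_neg, ← Finset.sum_neg_distrib]
  congr 3
  exact Finset.sum_congr rfl fun k _ => by ring
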